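/- **Conventions.** Let $Q=-u^2-v^2+x_1^2+x_2^2$ on $\mathbb R^4$, let $\mathrm{AdS}=\{Q=-1\}$ with the Lorentzian metric induced by $Q$, and let $\widetilde{\mathrm{AdS}}$ be its universal covering. Write $\mathbb D^2=\{(x,y,z)\in\mathbb S^2 : z>0\}$. Then $\widetilde{\mathrm{AdS}}$ is identified with $\mathbb D^2\times\mathbb R$ with the metric $z^{-2}(ds^2-dt^2)$, where $ds^2$ is the spherical metric, with distance $d$. Its conformal boundary is $\partial\mathbb D^2\times\mathbb R$, and for $A\subset\widetilde{\mathrm{AdS}}$ we let $\partial A$ be the intersection of $\partial\mathbb D^2\times\mathbb R$ with the closure of $A$ in $\mathbb S^2\times\mathbb R$. For $\Lambda\subset\partial\mathbb D^2\times\mathbb R$, the invisible domain $E(\Lambda)$ is the set of points $(x,t)\in\mathbb D^2\times\mathbb R$ that are causally related to no point of $\Lambda$, i.e. such that $|t-s|<d(x,y)$ for every $(y,s)\in\Lambda$. If a group $G$ of isometries of $\widetilde{\mathrm{AdS}}$ preserves $E(\Lambda)$ and acts on it freely and properly discontinuously, $M_\Lambda(G)=G\backslash E(\Lambda)$ denotes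 the quotient spacetime. An *AdS spacetime* is a connected, time-oriented Lorentzian $3$-manifold of constant curvature $-1$, i.e. locally isometric to $\widetilde{\mathrm{AdS}}$. It is *globally hyperbolic* if it is strongly causal (its Alexandrov topology is the manifold topology) and, for all points $x,y$, the intersection of the causal future of $x$ with the causal past of $y$ is compact or empty. A *Cauchy surface* is an embedded spacelike ($C^1$) surface that every inextendible causal curve meets exactly once; it is *complete* if the induced Riemannian metric is complete. If $p:\widetilde M\to M$ is the universal covering of an AdS spacetime $M$ (with the pulled back metric and time-orientation) and $\Gamma$ is its group of deck transformations, a *developing map* is a local isometry $\mathcal D:\widetilde M\to\widetilde{\mathrm{AdS}}$, and its *holonomy* is a morphism $\tilde\rho$ from $\Gamma$ to the isometry group of $\widetilde{\mathrm{AdS}}$ with $\mathcal D\circ\gamma=\tilde\rho(\gamma)\circ\mathcal D$ for all $\gamma\in\Gamma$. **Proposition.** Let $M$ be a globally hyperbolic AdS spacetime with a complete Cauchy surface $S$. Then $M$ has a universal covering $p:\widetilde M\to M$ with a developing map $\mathcal D$ and a holonomy morphism $\tilde\rho$. For every such $p$, $\mathcal D$ and $\tilde\rho$, the preimage $p^{-1}(S)$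 is a Cauchy surface of $\widetilde M$, and for every Cauchy surface $\Sigma$ of $\widetilde M$ (in particular for $p^{-1}(S)$), with $\widetilde S=\mathcal D(\Sigma)$: the group $\tilde\rho(\Gamma)$ preserves $E(\partial\widetilde S)$ and acts on it freely and properly discontinuously, and $M$ embeds isometrically in the quotient spacetime $M_{\partial\widetilde S}(\tilde\rho(\Gamma))=\tilde\rho(\Gamma)\backslash E(\partial\widetilde S)$. -/

import Mathlib

open Set Filter Topology
open scoped Manifold ContDiff

universe u v

noncomputable section

namespace AdS

/-! ### The universal anti-de Sitter space -/

/-- The model vector space `ℝ³` of all our manifolds. -/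
abbrev E3 : Type := EuclideanSpace ℝ (Fin 3)

/-- The bilinear form of signature `(2,2)` on `ℝ⁴`, with coordinates `(u, v, x₁, x₂)`:
its quadratic form is `-u² - v² + x₁² + x₂²`. -/
def Q : LinearMap.BilinForm ℝ (Fin 4 → ℝ) :=
  Matrix.toBilin' (Matrix.diagonal ![-1, -1, 1, 1])

/-- The universal covering of `AdS = {Q = -1}`. Its total space is `ℝ³` with coordinates
`(x₁, x₂, t)`, and
`cover (x₁, x₂, t) = (√(1 + x₁² + x₂²) cos t, √(1 + x₁² + x₂²) sin t, x₁, x₂)`. -/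
def cover (x : E3) : Fin 4 → ℝ :=
  ![√(1 + x 0 ^ 2 + x 1 ^ 2) * Real.cos (x 2), √(1 + x 0 ^ 2 + x 1 ^ 2) * Real.sin (x 2),
    x 0, x 1]

/-- The anti-de Sitter metric on the universal covering: the pull-back of `Q`. -/
def modelMetric (x : E3) : LinearMap.BilinForm ℝ (TangentSpace 𝓘(ℝ, E3) x) :=
  LinearMap.BilinForm.comp Q (fderiv ℝ cover x).toLinearMap (fderiv ℝ cover x).toLinearMap

/-- The coordinate vector field `∂/∂t`. -/
def modelTime (x : E3) : TangentSpace 𝓘(ℝ, E3) x :=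
  (EuclideanSpace.single (2 : Fin 3) (1 : ℝ) : E3)

/-- `f` is a local isometry at every point of `s`: it is a local diffeomorphism there, and pulls
the bilinear form `h` back to the bilinear form `g`. -/
def IsLocalIsometryOn {M N : Type*} [TopologicalSpace M] [ChartedSpace E3 M]
    [TopologicalSpace N] [ChartedSpace E3 N]
    (g : ∀ x : M, LinearMap.BilinForm ℝ (TangentSpace 𝓘(ℝ, E3) x))
    (h : ∀ x : N, LinearMap.BilinForm ℝ (TangentSpace 𝓘(ℝ, E3) x))
    (f : M → N) (s : Set M) : Prop :=
  IsLocalDiffeomorphOn 𝓘(ℝ, E3) 𝓘(ℝ, E3) ∞ f s ∧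
    ∀ x ∈ s, ∀ v w : TangentSpace 𝓘(ℝ, E3) x,
      h (f x) (mfderiv 𝓘(ℝ, E3) 𝓘(ℝ, E3) f x v) (mfderiv 𝓘(ℝ, E3) 𝓘(ℝ, E3) f x w) = g x v w

end AdS

open AdS

/-- A (connected, time-oriented, three-dimensional) AdS spacetime: a smooth manifold with a
Lorentzian metric locally modeled on anti-de Sitter space. Smoothness, symmetry and the Lorentzian
signature of the metric follow from `locallyAdS`. The time-orientation is given by a continuous
timelike vector field. -/
structure AdSSpacetime where
  carrier : Type u
  [topology : TopologicalSpace carrier]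
  [charted : ChartedSpace E3 carrier]
  [manifold : IsManifold 𝓘(ℝ, E3) ∞ carrier]
  [t2 : T2Space carrier]
  [secondCountable : SecondCountableTopology carrier]
  [connected : ConnectedSpace carrier]
  metric : ∀ x : carrier, LinearMap.BilinForm ℝ (TangentSpace 𝓘(ℝ, E3) x)
  locallyAdS : ∀ x : carrier, ∃ (U : Set carrier) (φ : carrier → E3),
    IsOpen U ∧ x ∈ U ∧ IsLocalIsometryOn metric modelMetric φ U
  time : ∀ x : carrier, TangentSpace 𝓘(ℝ, E3) x
  time_continuous : Continuous fun x => (⟨x, time x⟩ : TangentBundle 𝓘(ℝ, E3) carrier)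
  time_timelike : ∀ x, metric x (time x) (time x) < 0

namespace AdSSpacetime

instance : CoeSort AdSSpacetime.{u} (Type u) := ⟨AdSSpacetime.carrier⟩

attribute [instance] topology charted manifold t2 secondCountable connected

variable (M : AdSSpacetime.{u})

/-! ### Causality -/

/-- Future-oriented causal (timelike or lightlike, nonzero) tangent vectors. -/
def FutureCausal {x : M} (v : TangentSpace 𝓘(ℝ, E3) x) : Prop :=
  M.metric x v v ≤ 0 ∧ M.metric x v (M.time x) < 0

/-- Future-oriented timelike tangent vectors. -/
def FutureTimelike {x : M} (v : TangentSpace 𝓘(ℝ, E3) x) : Prop :=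
  M.metric x v v < 0 ∧ M.metric x v (M.time x) < 0

/-- The velocity of a curve. -/
def velocity (c : ℝ → M) (s : ℝ) : TangentSpace 𝓘(ℝ, E3) (c s) :=
  mfderiv 𝓘(ℝ, ℝ) 𝓘(ℝ, E3) c s (1 : ℝ)

/-- The (chronological) future of a point. -/
def future (x : M) : Set M :=
  {y | ∃ c : ℝ → M, ContMDiff 𝓘(ℝ, ℝ) 𝓘(ℝ, E3) 1 c ∧ c 0 = x ∧ c 1 = y ∧
    ∀ s ∈ Icc (0 : ℝ) 1, M.FutureTimelike (M.velocity c s)}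

/-- The causal future of a point; it contains the point. -/
def causalFuture (x : M) : Set M :=
  {y | y = x ∨ ∃ c : ℝ → M, ContMDiff 𝓘(ℝ, ℝ) 𝓘(ℝ, E3) 1 c ∧ c 0 = x ∧ c 1 = y ∧
    ∀ s ∈ Icc (0 : ℝ) 1, M.FutureCausal (M.velocity c s)}

/-- Strong causality: the Alexandrov topology, generated by the common past-future regions,
is the manifold topology. -/
def IsStronglyCausal : Prop :=
  M.topology = TopologicalSpace.generateFrom
    {U | ∃ x y : M, y ∈ M.future x ∧ U = {z | z ∈ M.future x ∧ y ∈ M.future z}}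

def IsGloballyHyperbolic : Prop :=
  M.IsStronglyCausal ∧
    ∀ x y : M, IsCompact {z | z ∈ M.causalFuture x ∧ y ∈ M.causalFuture z}

/-- An inextendible causal curve, parametrized by `ℝ` and oriented to the future: it has no
end point, neither in the future nor in the past. -/
def IsInextendibleCausal (c : ℝ → M) : Prop :=
  ContMDiff 𝓘(ℝ, ℝ) 𝓘(ℝ, E3) 1 c ∧ (∀ s, M.FutureCausal (M.velocity c s)) ∧
    (¬ ∃ x, Tendsto c atTop (𝓝 x)) ∧ ¬ ∃ x, Tendsto c atBot (𝓝 x)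

/-- `S` is an embedded spacelike surface of class `C¹`: near each of its points it is a regular
level set of a `C¹` function, and the metric is positive definite on its tangent planes. -/
def IsSpacelikeSurface (S : Set M) : Prop :=
  ∀ x ∈ S, ∃ (U : Set M) (h : M → ℝ), IsOpen U ∧ x ∈ U ∧
    ContMDiffOn 𝓘(ℝ, E3) 𝓘(ℝ, ℝ) 1 h U ∧ S ∩ U = {y ∈ U | h y = 0} ∧
    ∀ y ∈ S ∩ U, mfderiv 𝓘(ℝ, E3) 𝓘(ℝ, ℝ) h y ≠ 0 ∧
      ∀ v : TangentSpace 𝓘(ℝ, E3) y, v ≠ 0 →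
        mfderiv 𝓘(ℝ, E3) 𝓘(ℝ, ℝ) h y v = 0 → 0 < M.metric y v v

/-- A Cauchy surface: an embedded spacelike surface that every inextendible causal curve meets
exactly once. -/
def IsCauchySurface (S : Set M) : Prop :=
  M.IsSpacelikeSurface S ∧ ∀ c : ℝ → M, M.IsInextendibleCausal c → ∃! s, c s ∈ S

/-- In the spacelike surface `S`, with the induced Riemannian metric, some `C¹` curve from `x`
to `y` has length less than `ε`; that is, the distance between `x` and `y` is less than `ε`. -/
def DistLT (S : Set M) (x y : M) (ε : ℝ) : Prop :=
  ∃ c : ℝ → M, ContMDiff 𝓘(ℝ, ℝ) 𝓘(ℝ, E3) 1 c ∧ c 0 = x ∧ c 1 = y ∧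
    (∀ s ∈ Icc (0 : ℝ) 1, c s ∈ S) ∧
    ∫ s in (0 : ℝ)..1, √(M.metric (c s) (M.velocity c s) (M.velocity c s)) < ε

/-- The induced Riemannian metric on the spacelike surface `S` is complete: every Cauchy sequence
for the induced distance converges in `S`. -/
def IsCompleteSurface (S : Set M) : Prop :=
  ∀ u : ℕ → M, (∀ n, u n ∈ S) →
    (∀ ε > 0, ∃ n₀, ∀ m ≥ n₀, ∀ n ≥ n₀, M.DistLT S (u m) (u n) ε) →
    ∃ x ∈ S, Tendsto u atTop (𝓝 x)

/-! ### Maps between spacetimes -/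

variable {M} {N : AdSSpacetime.{v}}

/-- A local isometry between AdS spacetimes. -/
def IsLocalIsometry (f : M → N) : Prop :=
  IsLocalIsometryOn M.metric N.metric f univ

/-- An isometric embedding (between manifolds of the same dimension). -/
def IsIsometricEmbedding (f : M → N) : Prop :=
  IsLocalIsometry f ∧ IsEmbedding f

/-- The differential of `f` sends the future to the future at every point of `s`. -/
def PreservesTimeOn (f : M → N) (s : Set M) : Prop :=
  ∀ x ∈ s, N.metric (f x) (mfderiv 𝓘(ℝ, E3) 𝓘(ℝ, E3) f x (M.time x)) (N.time (f x)) < 0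

/-- `p` is the universal covering of the spacetime `N`, and `M` carries the pulled back metric and
time-orientation. -/
structure IsUniversalCovering (p : M → N) : Prop where
  covering : IsCoveringMap p
  simplyConnected : SimplyConnectedSpace M
  isometry : IsLocalIsometry p
  time : PreservesTimeOn p univ

/-- The group of deck transformations of `p`, that is, the fundamental group when `p` is the
universal covering. -/
def deckGroup (p : M → N) : Subgroup (M ≃ₜ M) where
  carrier := {γ | ∀ x, p (γ x) = p x}
  one_mem' := fun _ => rfl
  mul_mem' := fun {a b} ha hb x => (ha (b x)).trans (hb x)
  inv_mem' := fun {a} ha x => by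
    have h := ha (a⁻¹ x)
    have e : a (a⁻¹ x) = x := a.apply_symm_apply x
    rw [e] at h
    exact h.symm

end AdSSpacetime

namespace AdS

open AdSSpacetime

lemma cover_differentiable : Differentiable ℝ cover := by
  have hpos : ∀ x : E3, 1 + x 0 ^ 2 + x 1 ^ 2 ≠ 0 := fun x => by positivity
  have hs : Differentiable ℝ fun x : E3 => √(1 + x 0 ^ 2 + x 1 ^ 2) := by
    refine Differentiable.sqrt ?_ hpos
    fun_prop
  rw [differentiable_pi]
  intro i
  fin_cases i
  · exact hs.mul (Real.differentiable_cos.comp (by fun_prop : Differentiable ℝ fun x : E3 => x 2))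
  · exact hs.mul (Real.differentiable_sin.comp (by fun_prop : Differentiable ℝ fun x : E3 => x 2))
  · exact (by fun_prop : Differentiable ℝ fun x : E3 => x 0)
  · exact (by fun_prop : Differentiable ℝ fun x : E3 => x 1)

lemma fderiv_cover_time (x : E3) :
    fderiv ℝ cover x (EuclideanSpace.single (2 : Fin 3) (1 : ℝ)) =
      ![-(√(1 + x 0 ^ 2 + x 1 ^ 2) * Real.sin (x 2)),
        √(1 + x 0 ^ 2 + x 1 ^ 2) * Real.cos (x 2), 0, 0] := by
  have h1 := (cover_differentiable x).hasFDerivAt.hasLineDerivAt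
    (EuclideanSpace.single (2 : Fin 3) (1 : ℝ))
  refine HasDerivAt.unique h1 ?_
  have e : (fun s : ℝ => cover (x + s • EuclideanSpace.single (2 : Fin 3) (1 : ℝ))) =
      fun s : ℝ => ![√(1 + x 0 ^ 2 + x 1 ^ 2) * Real.cos (x 2 + s),
        √(1 + x 0 ^ 2 + x 1 ^ 2) * Real.sin (x 2 + s), x 0, x 1] := by
    funext s
    simp [cover]
  rw [e]
  have ha : HasDerivAt (fun s : ℝ => x 2 + s) 1 0 := (hasDerivAt_id' (0 : ℝ)).const_add (x 2)
  rw [hasDerivAt_pi]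
  intro i
  fin_cases i
  · simpa using (ha.cos).const_mul (√(1 + x 0 ^ 2 + x 1 ^ 2))
  · simpa using (ha.sin).const_mul (√(1 + x 0 ^ 2 + x 1 ^ 2))
  · simpa using hasDerivAt_const (0 : ℝ) (x 0)
  · simpa using hasDerivAt_const (0 : ℝ) (x 1)

lemma modelTime_timelike (x : E3) : modelMetric x (modelTime x) (modelTime x) < 0 := by
  have h : modelMetric x (modelTime x) (modelTime x) =
      Q (fderiv ℝ cover x (EuclideanSpace.single (2 : Fin 3) (1 : ℝ)))
        (fderiv ℝ cover x (EuclideanSpace.single (2 : Fin 3) (1 : ℝ))) := rfl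
  rw [h, fderiv_cover_time]
  have hpos : 0 < 1 + x 0 ^ 2 + x 1 ^ 2 := by positivity
  have hsq := Real.sq_sqrt hpos.le
  have hcs := Real.sin_sq_add_cos_sq (x 2)
  simp only [Q, Matrix.toBilin'_apply', Matrix.mulVec_diagonal, dotProduct, Fin.sum_univ_four]
  simp
  nlinarith [hsq, hcs]

lemma modelTime_continuous :
    Continuous fun x : E3 => (⟨x, modelTime x⟩ : TangentBundle 𝓘(ℝ, E3) E3) := by
  have h : Continuous fun x : E3 => (tangentBundleModelSpaceHomeomorph 𝓘(ℝ, E3)).symm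
      ((x, EuclideanSpace.single (2 : Fin 3) (1 : ℝ)) : ModelProd E3 E3) :=
    (tangentBundleModelSpaceHomeomorph 𝓘(ℝ, E3)).symm.continuous.comp
      (continuous_id.prodMk continuous_const)
  exact h

lemma modelMetric_locallyAdS (x : E3) : ∃ (U : Set E3) (φ : E3 → E3),
    IsOpen U ∧ x ∈ U ∧ IsLocalIsometryOn modelMetric modelMetric φ U := by
  refine ⟨univ, id, isOpen_univ, mem_univ x, ?_, ?_⟩
  · intro y
    exact (Diffeomorph.refl 𝓘(ℝ, E3) E3 ∞).isLocalDiffeomorph y.1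
  · intro y _ v w
    rw [mfderiv_id]
    rfl

/-- The universal anti-de Sitter space as a spacetime. -/
def universalAdS : AdSSpacetime.{0} where
  carrier := E3
  metric := modelMetric
  locallyAdS := modelMetric_locallyAdS
  time := modelTime
  time_continuous := modelTime_continuous
  time_timelike := modelTime_timelike

/-! ### Conformal boundary and invisible domains -/

/-- The universal Einstein universe `𝕊² × ℝ`, with conformal structure `ds² - dt²`. -/
abbrev Ein : Type := Metric.sphere (0 : EuclideanSpace ℝ (Fin 3)) 1 × ℝ

/-- Two points of `𝕊² × ℝ` are causally related when their spherical distance is at most the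
difference of their time coordinates. -/
def CausallyRelated (q r : Ein) : Prop :=
  InnerProductGeometry.angle (q.1 : EuclideanSpace ℝ (Fin 3)) r.1 ≤ |q.2 - r.2|

lemma hemisphere_mem (x : E3) :
    (√(1 + x 0 ^ 2 + x 1 ^ 2))⁻¹ • (!₂[x 0, x 1, 1] : EuclideanSpace ℝ (Fin 3)) ∈
      Metric.sphere (0 : EuclideanSpace ℝ (Fin 3)) 1 := by
  have hpos : 0 < √(1 + x 0 ^ 2 + x 1 ^ 2) := Real.sqrt_pos.2 (by positivity)
  have hn : ‖(!₂[x 0, x 1, 1] : EuclideanSpace ℝ (Fin 3))‖ = √(1 + x 0 ^ 2 + x 1 ^ 2) := by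
    rw [EuclideanSpace.norm_eq]
    congr 1
    simp [Fin.sum_univ_three]
    ring
  rw [mem_sphere_zero_iff_norm, norm_smul, hn, norm_inv, Real.norm_of_nonneg hpos.le,
    inv_mul_cancel₀ hpos.ne']

/-- The conformal embedding of the universal anti-de Sitter space in `𝕊² × ℝ`, with image the
product of the open hemisphere `{z > 0}` and `ℝ`. In these coordinates the anti-de Sitter metric
is `(ds² - dt²) / z²`. -/
def toEin (x : E3) : Ein :=
  (⟨(√(1 + x 0 ^ 2 + x 1 ^ 2))⁻¹ • !₂[x 0, x 1, 1], hemisphere_mem x⟩, x 2)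

/-- The boundary at infinity of a subset of the universal anti-de Sitter space: the part of its
closure in `𝕊² × ℝ` that lies on the conformal boundary `{z = 0}`. -/
def boundaryAtInfinity (A : Set universalAdS) : Set Ein :=
  closure (toEin '' A) ∩ {q | (q.1 : EuclideanSpace ℝ (Fin 3)) 2 = 0}

/-- The invisible domain from `Λ`: the points of the universal anti-de Sitter space that are not
causally related to any point of `Λ`. -/
def invisibleDomain (Λ : Set Ein) : Set universalAdS :=
  {x | ∀ q ∈ Λ, ¬ CausallyRelated (toEin x) q}

/-! ### Developing maps and quotients -/

/-- `D` is a developing map, defined on the total space of the universal covering `p`, and `ρ` is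
its holonomy morphism, with values in the isometries of the universal anti-de Sitter space. -/
structure IsDevelopingPair {M' : AdSSpacetime.{u}} {M : AdSSpacetime.{v}} (p : M' → M)
    (D : M' → universalAdS) (ρ : deckGroup p →* (universalAdS ≃ₜ universalAdS)) : Prop where
  developing : IsLocalIsometry D
  holonomy : ∀ γ, IsLocalIsometry (ρ γ)
  equivariant : ∀ γ x, D (γ.1 x) = ρ γ (D x)

/-- The group `G` preserves `E`, and acts on it freely and properly discontinuously. -/
structure ActsFreelyProperlyOn (G : Subgroup (universalAdS ≃ₜ universalAdS))
    (E : Set universalAdS) : Prop where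
  invariant : ∀ γ ∈ G, γ '' E = E
  free : ∀ γ ∈ G, ∀ x ∈ E, γ x = x → γ = 1
  proper : ∀ K ⊆ E, IsCompact K → {γ | γ ∈ G ∧ (γ '' K ∩ K).Nonempty}.Finite

/-- The spacetime `N` is the quotient of `E` by the group `G` of isometries, with projection `π`
(the values of `π` outside `E` are irrelevant). -/
structure IsQuotientSpacetime (G : Subgroup (universalAdS ≃ₜ universalAdS))
    (E : Set universalAdS) (N : AdSSpacetime.{v}) (π : universalAdS → N) : Prop where
  isometry : IsLocalIsometryOn universalAdS.metric N.metric π E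
  time : PreservesTimeOn π E
  surjective : π '' E = univ
  fibers : ∀ x ∈ E, ∀ y ∈ E, π x = π y ↔ ∃ γ ∈ G, γ x = y

end AdS

end

/-!
The universal anti-de Sitter space is `ℝ³`, with coordinates `(x₁, x₂, t)` and a static metric
`adsForm`: vertical lines are timelike, the horizontal part is hyperbolic, and `toEin` embeds it
conformally in `𝕊² × ℝ`. Everything below takes place in these coordinates.

**Developing.** A local isometry on a connected open set extends to a global isometry, which lifts a
linear map of `ℝ⁴` (`exists_isometry_extension`). Hence the germs of local isometries from `M` to the
universal anti-de Sitter space form a covering of `M`, which carries a developing map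
(`exists_developedCovering`). The geometric part of the proof uses only such a connected covering
`p : X → M` with a developing map `D` (`IsDeveloped`). It applies to the germ covering, for which
simple connectedness is a consequence, and to every universal covering.

**Cauchy surfaces develop to graphs.** The maximal lift to `X` of an inextendible causal curve of the
anti-de Sitter space projects to an inextendible causal curve of `M`, so that it meets `p⁻¹(S)`
exactly once (`IsDeveloped.exists_lift_existsUnique_mem`). Applied to vertical lines, this retracts
`X` to `p⁻¹(S)` (`IsDeveloped.exists_retraction`). The projection of `D` to the `(x₁, x₂)`-plane is a
local homeomorphism on `p⁻¹(S)`. The induced metric of a spacelike surface is at most the Euclidean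
metric of its projection, so that for complete `S` the straight lines of the plane lift, and there is
a section over the whole plane (`IsDeveloped.exists_section`). By connectedness every vertical
segment ends on this section: `D` is injective, `D(p⁻¹(S))` is the graph of a function `f` on the
plane, and `X` is contractible (`IsDeveloped.exists_graph`, `contractibleSpace_of_section`). The
metric and the smooth structure of the universal covering are those of the image of `D`
(`exists_universalCovering`).

**The invisible domain is the domain of dependence.** Spacelike functions of the plane contract
spherical distances. If a point is causally related to a boundary point of the graph of `f`, then a
null line towards this boundary point misses the graph. Conversely, a causal curve that runs towards
the graph without reaching it converges to a boundary point of the graph. Therefore `E(∂graph)` is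
the set of points through which every inextendible causal curve meets the graph
(`IsSpacelikeGraphOn.mem_graphDomain_iff`). It contains `D(X)`, because causal curves lift. A Cauchy
surface of the universal covering also develops to an entire graph, by retraction of the section, and
two entire spacelike graphs, each in the domain of the other, have the same boundary
(`graphDomain_eq`): all Cauchy surfaces have the same invisible domain `E`.

**The action.** The points of the graph that are causally related to a compact set of `E` are bounded
(`IsSpacelikeGraphOn.exists_bound`), so that the action of the holonomy group on `E` is properly
discontinuous because the action of the deck transformations is. If the holonomy of `γ` fixes a point
of `E`, then it has finite order, and fixes a timelike geodesic (`exists_fixed_geodesic`). This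
geodesic meets the graph, which lies in `D(X)`, where `γ` has no fixed point unless it is trivial
(`actsFreelyProperlyOn`). The quotient of `E` is then a spacetime, whose time-orientation is glued by
a partition of unity (`IsModelQuotient.exists_spacetime`), and `D` descends to the embedding
of `M` (`exists_isometricEmbedding`).
-/

noncomputable section

namespace AdS

open AdSSpacetime

/-! ### The anti-de Sitter metric in coordinates -/

/-- The square `1 + x₁² + x₂²` of the radius of the circles `{(x₁, x₂)} × ℝ`. -/
def radiusSq (x : E3) : ℝ := 1 + x 0 ^ 2 + x 1 ^ 2

lemma radiusSq_pos (x : E3) : 0 < radiusSq x := by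
  unfold radiusSq; positivity

/-- The spacelike part of the anti-de Sitter metric, a hyperbolic metric on the `(x₁, x₂)`-plane. -/
def spaceForm (x v w : E3) : ℝ :=
  (v 0 * w 0 + v 1 * w 1 + (x 0 * v 1 - x 1 * v 0) * (x 0 * w 1 - x 1 * w 0)) / radiusSq x

/-- The anti-de Sitter metric in the coordinates `(x₁, x₂, t)`. -/
def adsForm (x v w : E3) : ℝ := spaceForm x v w - radiusSq x * (v 2 * w 2)

lemma fderiv_cover (x v : E3) :
    fderiv ℝ cover x v =
      ![(x 0 * v 0 + x 1 * v 1) / √(radiusSq x) * Real.cos (x 2)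
          - √(radiusSq x) * Real.sin (x 2) * v 2,
        (x 0 * v 0 + x 1 * v 1) / √(radiusSq x) * Real.sin (x 2)
          + √(radiusSq x) * Real.cos (x 2) * v 2, v 0, v 1] := by
  have h1 := (cover_differentiable x).hasFDerivAt.hasLineDerivAt v
  refine HasDerivAt.unique h1 ?_
  have hc : ∀ i : Fin 3, HasDerivAt (fun s : ℝ => (x + s • v) i) (v i) 0 := by
    intro i
    have : HasDerivAt (fun s : ℝ => x i + s * v i) (v i) 0 := by
      simpa using ((hasDerivAt_id' (0 : ℝ)).mul_const (v i)).const_add (x i)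
    simpa using this
  have hr : HasDerivAt (fun s : ℝ => √(1 + (x + s • v) 0 ^ 2 + (x + s • v) 1 ^ 2))
      ((x 0 * v 0 + x 1 * v 1) / √(radiusSq x)) 0 := by
    have h0 := (((hc 0).pow 2).const_add 1).add ((hc 1).pow 2)
    have h0' : (1 + (x + (0:ℝ) • v) 0 ^ 2 + (x + (0:ℝ) • v) 1 ^ 2) ≠ 0 := by positivity
    have := h0.sqrt h0'
    convert! this using 1
    simp only [zero_smul, add_zero, radiusSq]
    simp
    field_simp
  have hz : ∀ i, (x + (0:ℝ) • v) i = x i := by simp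
  have hs : √(1 + x 0 ^ 2 + x 1 ^ 2) = √(radiusSq x) := rfl
  rw [hasDerivAt_pi]
  intro i
  fin_cases i
  · have := hr.mul (hc 2).cos
    convert! this using 1
    simp only [hz, hs]
    simp only [Fin.zero_eta, Matrix.cons_val_zero]
    ring
  · have := hr.mul (hc 2).sin
    convert! this using 1
    simp only [hz, hs]
    simp only [Fin.mk_one, Matrix.cons_val_one, Matrix.cons_val_zero]
    ring
  · exact hc 0
  · exact hc 1

lemma Q_apply (a b : Fin 4 → ℝ) :
    Q a b = - (a 0 * b 0) - a 1 * b 1 + a 2 * b 2 + a 3 * b 3 := by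
  simp only [Q, Matrix.toBilin'_apply', Matrix.mulVec_diagonal, dotProduct, Fin.sum_univ_four]
  simp
  ring

lemma Q_fderiv_cover (x v w : E3) :
    Q (fderiv ℝ cover x v) (fderiv ℝ cover x w) = adsForm x v w := by
  have hr := radiusSq_pos x
  have hs := Real.sq_sqrt hr.le
  have hne : √(radiusSq x) ≠ 0 := (Real.sqrt_pos.2 hr).ne'
  have hcs := Real.sin_sq_add_cos_sq (x 2)
  rw [Q_apply, fderiv_cover, fderiv_cover]
  simp only [Matrix.cons_val_zero, Matrix.cons_val_one, Matrix.cons_val]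
  generalize hS : √(radiusSq x) = r at *
  have key : (v 0 * w 0 + v 1 * w 1 + (x 0 * v 1 - x 1 * v 0) * (x 0 * w 1 - x 1 * w 0)) /
      radiusSq x = v 0 * w 0 + v 1 * w 1
        - (x 0 * v 0 + x 1 * v 1) / r * ((x 0 * w 0 + x 1 * w 1) / r) := by
    rw [← hs]
    field_simp
    rw [hs, radiusSq]
    ring
  rw [adsForm, spaceForm, key, ← hs]
  linear_combination (-(x 0 * v 0 + x 1 * v 1) / r * ((x 0 * w 0 + x 1 * w 1) / r)
    - r ^ 2 * (v 2 * w 2)) * hcs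

lemma modelMetric_apply (x : E3) (v w : TangentSpace 𝓘(ℝ, E3) x) :
    modelMetric x v w = adsForm x v w := Q_fderiv_cover x v w

lemma cover_apply (x : E3) : cover x =
    ![√(radiusSq x) * Real.cos (x 2), √(radiusSq x) * Real.sin (x 2), x 0, x 1] := rfl

lemma Q_cover_fderiv (x v : E3) : Q (cover x) (fderiv ℝ cover x v) = 0 := by
  have hr := radiusSq_pos x
  have hs := Real.sq_sqrt hr.le
  have hne : √(radiusSq x) ≠ 0 := (Real.sqrt_pos.2 hr).ne'
  have hcs := Real.sin_sq_add_cos_sq (x 2)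
  rw [Q_apply, fderiv_cover, cover_apply]
  simp only [Matrix.cons_val_zero, Matrix.cons_val_one, Matrix.cons_val]
  generalize hS : √(radiusSq x) = r at *
  field_simp
  linear_combination (-(x 0 * v 0 + x 1 * v 1)) * hcs

lemma Q_cover (x : E3) : Q (cover x) (cover x) = -1 := by
  have hr := radiusSq_pos x
  have hs := Real.sq_sqrt hr.le
  have hcs := Real.sin_sq_add_cos_sq (x 2)
  rw [Q_apply, cover_apply]
  simp only [Matrix.cons_val_zero, Matrix.cons_val_one, Matrix.cons_val]
  generalize hS : √(radiusSq x) = r at *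
  have : r ^ 2 = 1 + x 0 ^ 2 + x 1 ^ 2 := by rw [hs, radiusSq]
  linear_combination (-r ^ 2) * hcs - this

lemma adsForm_comm (x v w : E3) : adsForm x v w = adsForm x w v := by
  unfold adsForm spaceForm; ring

lemma adsForm_add_left (x v v' w : E3) :
    adsForm x (v + v') w = adsForm x v w + adsForm x v' w := by
  simp only [adsForm, spaceForm, PiLp.add_apply]; ring

lemma adsForm_smul_left (x v w : E3) (c : ℝ) : adsForm x (c • v) w = c * adsForm x v w := by
  simp only [adsForm, spaceForm, PiLp.smul_apply, smul_eq_mul]; ring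

lemma spaceForm_nonneg (x v : E3) : 0 ≤ spaceForm x v v := by
  have hr := radiusSq_pos x
  refine div_nonneg ?_ hr.le
  nlinarith [sq_nonneg (v 0), sq_nonneg (v 1), sq_nonneg (x 0 * v 1 - x 1 * v 0)]

lemma spaceForm_cauchySchwarz (x v w : E3) :
    spaceForm x v w ^ 2 ≤ spaceForm x v v * spaceForm x w w := by
  have hr := radiusSq_pos x
  unfold spaceForm
  rw [div_mul_div_comm, div_pow, ← sq (radiusSq x)]
  gcongr
  nlinarith [sq_nonneg (v 0 * w 1 - v 1 * w 0),
    sq_nonneg (v 0 * (x 0 * w 1 - x 1 * w 0) - (x 0 * v 1 - x 1 * v 0) * w 0),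
    sq_nonneg (v 1 * (x 0 * w 1 - x 1 * w 0) - (x 0 * v 1 - x 1 * v 0) * w 1)]

lemma adsForm_time (x v w : E3) (hw0 : w 0 = 0) (hw1 : w 1 = 0) :
    adsForm x v w = - (radiusSq x * (v 2 * w 2)) := by
  simp [adsForm, spaceForm, hw0, hw1]

/-- The induced metric of a spacelike surface is at most the Euclidean metric of its projection
to the `(x₁, x₂)`-plane. -/
lemma adsForm_le (x v : E3) : adsForm x v v ≤ v 0 ^ 2 + v 1 ^ 2 := by
  have hr := radiusSq_pos x
  have h1 : spaceForm x v v ≤ v 0 ^ 2 + v 1 ^ 2 := by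
    rw [spaceForm, div_le_iff₀ hr, radiusSq]
    nlinarith [sq_nonneg (x 0 * v 0 + x 1 * v 1)]
  unfold adsForm
  nlinarith [mul_nonneg hr.le (mul_self_nonneg (v 2))]

/-- A nonzero causal vector is not horizontal. -/
lemma time_ne_zero_of_causal {x v : E3} (h : adsForm x v v ≤ 0) (hv : v ≠ 0) : v 2 ≠ 0 := by
  intro h2
  apply hv
  have hr := radiusSq_pos x
  have h1 : spaceForm x v v ≤ 0 := by simpa [adsForm, h2] using h
  rw [spaceForm, div_le_iff₀ hr, zero_mul] at h1
  have h0 : v 0 = 0 := by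
    nlinarith [sq_nonneg (v 0), sq_nonneg (v 1), sq_nonneg (x 0 * v 1 - x 1 * v 0)]
  have h1' : v 1 = 0 := by
    nlinarith [sq_nonneg (v 0), sq_nonneg (v 1), sq_nonneg (x 0 * v 1 - x 1 * v 0)]
  ext i
  fin_cases i <;> simp [h0, h1', h2]

/-- The reverse Cauchy-Schwarz inequality: the sign of the product of a causal vector and a timelike
vector is given by their time coordinates. -/
lemma adsForm_mul_time_neg {x v w : E3} (hv : adsForm x v v ≤ 0) (hv0 : v ≠ 0)
    (hw : adsForm x w w < 0) : adsForm x v w * (v 2 * w 2) < 0 := by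
  have hr := radiusSq_pos x
  have hv2 := time_ne_zero_of_causal hv hv0
  have hw2 : w 2 ≠ 0 := by
    refine time_ne_zero_of_causal hw.le ?_
    rintro rfl
    simp [adsForm, spaceForm] at hw
  have hcs := spaceForm_cauchySchwarz x v w
  have hvn := spaceForm_nonneg x v
  have hwn := spaceForm_nonneg x w
  unfold adsForm at *
  generalize spaceForm x v w = b at *
  generalize spaceForm x v v = bv at *
  generalize spaceForm x w w = bw at *
  generalize radiusSq x = r at *
  have hz : 0 < (v 2 * w 2) ^ 2 := by positivity
  have hv' : 0 < v 2 ^ 2 := by positivity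
  have h1 : b ^ 2 < (r * (v 2 * w 2)) ^ 2 := by
    have : bv * bw ≤ r * v 2 ^ 2 * bw := by
      apply mul_le_mul_of_nonneg_right _ hwn; nlinarith
    have : r * v 2 ^ 2 * bw < r * v 2 ^ 2 * (r * w 2 ^ 2) := by
      apply mul_lt_mul_of_pos_left _ (by positivity); nlinarith
    nlinarith
  have h2 := sq_lt_sq.1 h1
  have h3 : b * (v 2 * w 2) < r * (v 2 * w 2) * (v 2 * w 2) := by
    calc b * (v 2 * w 2) ≤ |b * (v 2 * w 2)| := le_abs_self _
      _ = |b| * |v 2 * w 2| := abs_mul _ _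
      _ < |r * (v 2 * w 2)| * |v 2 * w 2| := by
          apply mul_lt_mul_of_pos_right h2; positivity
      _ = r * (v 2 * w 2) * (v 2 * w 2) := by
          rw [abs_mul, abs_of_pos hr, mul_assoc, abs_mul_abs_self]; ring
  nlinarith

/-- The anti-de Sitter metric is nondegenerate. -/
lemma eq_zero_of_adsForm {x v : E3} (h : ∀ w, adsForm x v w = 0) : v = 0 := by
  have hr := radiusSq_pos x
  have h2 := h (EuclideanSpace.single (2 : Fin 3) (1 : ℝ))
  rw [adsForm_time _ _ _ (by simp) (by simp)] at h2
  have h2' : v 2 = 0 := by simpa [hr.ne'] using h2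
  by_contra hv
  exact time_ne_zero_of_causal (h v).le hv h2'

/-! ### The covering of the quadric and the isometries of its total space -/

lemma contDiff_radius {n : WithTop ℕ∞} : ContDiff ℝ n fun x : E3 => √(radiusSq x) := by
  refine ContDiff.sqrt ?_ fun x => (radiusSq_pos x).ne'
  unfold radiusSq
  fun_prop

lemma contDiff_cover {n : WithTop ℕ∞} : ContDiff ℝ n cover := by
  have hs := contDiff_radius (n := n)
  rw [contDiff_pi]
  intro i
  fin_cases i
  · exact hs.mul (Real.contDiff_cos.comp (by fun_prop : ContDiff ℝ n fun x : E3 => x 2))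
  · exact hs.mul (Real.contDiff_sin.comp (by fun_prop : ContDiff ℝ n fun x : E3 => x 2))
  · exact (by fun_prop : ContDiff ℝ n fun x : E3 => x 0)
  · exact (by fun_prop : ContDiff ℝ n fun x : E3 => x 1)

lemma radiusSq_eq_of_cover_eq {x y : E3} (h : cover x = cover y) :
    x 0 = y 0 ∧ x 1 = y 1 ∧ radiusSq x = radiusSq y := by
  have h2 : x 0 = y 0 := congrFun h 2
  have h3 : x 1 = y 1 := congrFun h 3
  exact ⟨h2, h3, by rw [radiusSq, radiusSq, h2, h3]⟩

lemma eq_of_cover_eq {x y : E3} (h : cover x = cover y) (ht : |x 2 - y 2| < Real.pi) :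
    x = y := by
  obtain ⟨h0, h1, hr⟩ := radiusSq_eq_of_cover_eq h
  have hpos : √(radiusSq y) ≠ 0 := (Real.sqrt_pos.2 (radiusSq_pos y)).ne'
  have hc : √(radiusSq x) * Real.cos (x 2) = √(radiusSq y) * Real.cos (y 2) := congrFun h 0
  have hs : √(radiusSq x) * Real.sin (x 2) = √(radiusSq y) * Real.sin (y 2) := congrFun h 1
  rw [hr] at hc hs
  have hc' := mul_left_cancel₀ hpos hc
  have hs' := mul_left_cancel₀ hpos hs
  -- The two angles have the same sine and cosine.
  have hsin : Real.sin (x 2 - y 2) = 0 := by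
    rw [Real.sin_sub, hc', hs']; ring
  have habs := abs_lt.1 ht
  have h2 : x 2 - y 2 = 0 := (Real.sin_eq_zero_iff_of_lt_of_lt habs.1 habs.2).1 hsin
  ext i
  fin_cases i
  · exact h0
  · exact h1
  · exact sub_eq_zero.1 h2

lemma cover_isLocallyInjective : IsLocallyInjective cover := by
  intro x
  refine ⟨{y | |y 2 - x 2| < Real.pi / 2}, ?_, ?_, ?_⟩
  · exact isOpen_lt (by fun_prop) continuous_const
  · simp [Real.pi_pos]
  · intro y hy z hz h
    refine eq_of_cover_eq h ?_
    have h1 := abs_lt.1 (show |y 2 - x 2| < Real.pi / 2 from hy)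
    have h2 := abs_lt.1 (show |z 2 - x 2| < Real.pi / 2 from hz)
    rw [abs_lt]
    constructor <;> linarith

/-- Uniqueness of lifts through `cover`. -/
lemma eqOn_of_cover_eqOn {A : Type*} [TopologicalSpace A] {s : Set A} (hs : IsPreconnected s)
    {f g : A → E3} (hf : ContinuousOn f s) (hg : ContinuousOn g s)
    (h : ∀ a ∈ s, cover (f a) = cover (g a)) {a : A} (ha : a ∈ s) (hfg : f a = g a) :
    s.EqOn f g :=
  (T2Space.isSeparatedMap cover).eqOn_of_comp_eqOn cover_isLocallyInjective hs hf hg h ha hfg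

/-- Existence of lifts through `cover`: the argument of the complex number `u + iv` lifts through
the complex exponential. -/
lemma exists_cover_lift {A : Type*} [TopologicalSpace A] [SimplyConnectedSpace A]
    [LocallyPathConnectedSpace A] (f : A → Fin 4 → ℝ) (hf : Continuous f)
    (hQ : ∀ a, Q (f a) (f a) = -1) {a : A} {y : E3} (hy : cover y = f a) :
    ∃ F : A → E3, Continuous F ∧ F a = y ∧ ∀ b, cover (F b) = f b := by
  have hnorm : ∀ b, f b 0 ^ 2 + f b 1 ^ 2 = 1 + f b 2 ^ 2 + f b 3 ^ 2 := by
    intro b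
    have := hQ b
    rw [Q_apply] at this
    linarith
  -- The complex number `u + iv` does not vanish; the imaginary part of a logarithm is the time.
  let z : C(A, ℂ) := ⟨fun b => ⟨f b 0, f b 1⟩, by
    have : (fun b => (⟨f b 0, f b 1⟩ : ℂ)) = fun b => (f b 0 : ℂ) + f b 1 * Complex.I := by
      funext b
      apply Complex.ext <;> simp
    rw [this]
    fun_prop⟩
  have hnsq : ∀ b, Complex.normSq (z b) = 1 + f b 2 ^ 2 + f b 3 ^ 2 := by
    intro b
    rw [← hnorm b, Complex.normSq_apply]
    change f b 0 * f b 0 + f b 1 * f b 1 = _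
    ring
  have hz : ∀ b, z b ∈ ({0}ᶜ : Set ℂ) := by
    intro b h0
    have h0' : z b = 0 := h0
    have := hnsq b
    rw [h0'] at this
    simp only [map_zero] at this
    nlinarith [sq_nonneg (f b 2), sq_nonneg (f b 3)]
  have he : Complex.exp (⟨Real.log √(radiusSq y), y 2⟩ : ℂ) = z a := by
    have hpos := Real.sqrt_pos.2 (radiusSq_pos y)
    apply Complex.ext
    · rw [Complex.exp_re]
      change Real.exp (Real.log _) * _ = f a 0
      rw [Real.exp_log hpos, ← hy]
      rfl
    · rw [Complex.exp_im]
      change Real.exp (Real.log _) * _ = f a 1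
      rw [Real.exp_log hpos, ← hy]
      rfl
  obtain ⟨G, ⟨hG0, hG⟩, -⟩ :=
    Complex.isCoveringMapOn_exp.existsUnique_continuousMap_lifts z he hz
  have hre : ∀ b, Real.exp (G b).re = √(1 + f b 2 ^ 2 + f b 3 ^ 2) := by
    intro b
    have h1 := congrFun hG b
    simp only [Function.comp_apply] at h1
    rw [← Complex.norm_exp, h1, Complex.norm_def, hnsq b]
  have hrad : ∀ b, √(radiusSq !₂[f b 2, f b 3, (G b).im]) = Real.exp (G b).re := by
    intro b
    rw [hre b]
    simp [radiusSq]
  refine ⟨fun b => !₂[f b 2, f b 3, (G b).im], ?_, ?_, ?_⟩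
  · refine (PiLp.continuous_toLp 2 _).comp ?_
    refine continuous_pi fun i => ?_
    fin_cases i
    · exact (continuous_apply 2).comp hf
    · exact (continuous_apply 3).comp hf
    · exact Complex.continuous_im.comp G.continuous
  · ext i
    fin_cases i
    · change f a 2 = y 0
      rw [← hy]; rfl
    · change f a 3 = y 1
      rw [← hy]; rfl
    · change (G a).im = y 2
      rw [hG0]
  · intro b
    have h1 := congrFun hG b
    simp only [Function.comp_apply] at h1
    rw [cover_apply, hrad b]
    funext i
    fin_cases i
    · have := congrArg Complex.re h1
      rw [Complex.exp_re] at this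
      exact this
    · have := congrArg Complex.im h1
      rw [Complex.exp_im] at this
      exact this
    · rfl
    · rfl

/-- A continuous map is as smooth as its composition with `cover`: the time coordinate is locally
the arc tangent of a smooth function. -/
lemma contDiffAt_of_cover {H : Type*} [NormedAddCommGroup H] [NormedSpace ℝ H] {φ : H → E3}
    {x : H} {n : WithTop ℕ∞} (hc : ContinuousAt φ x)
    (h : ContDiffAt ℝ n (fun y => cover (φ y)) x) : ContDiffAt ℝ n φ x := by
  rw [contDiffAt_pi] at h
  have h0 : ContDiffAt ℝ n (fun y => √(radiusSq (φ y)) * Real.cos (φ y 2)) x := h 0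
  have h1 : ContDiffAt ℝ n (fun y => √(radiusSq (φ y)) * Real.sin (φ y 2)) x := h 1
  rw [contDiffAt_euclidean]
  intro i
  fin_cases i
  · exact h 2
  · exact h 3
  · set t := φ x 2 with ht
    -- Rotate by the angle `t`, so that the time coordinate stays in the domain of the arc tangent.
    have hw : ContDiffAt ℝ n (fun y => √(radiusSq (φ y)) * Real.cos (φ y 2) * Real.cos t
        + √(radiusSq (φ y)) * Real.sin (φ y 2) * Real.sin t) x :=
      (h0.mul contDiffAt_const).add (h1.mul contDiffAt_const)
    have hy : ContDiffAt ℝ n (fun y => √(radiusSq (φ y)) * Real.sin (φ y 2) * Real.cos t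
        - √(radiusSq (φ y)) * Real.cos (φ y 2) * Real.sin t) x :=
      (h1.mul contDiffAt_const).sub (h0.mul contDiffAt_const)
    have hne : √(radiusSq (φ x)) * Real.cos (φ x 2) * Real.cos t
        + √(radiusSq (φ x)) * Real.sin (φ x 2) * Real.sin t ≠ 0 := by
      have hpos := Real.sqrt_pos.2 (radiusSq_pos (φ x))
      have hcs := Real.sin_sq_add_cos_sq t
      rw [← ht]
      have : √(radiusSq (φ x)) * Real.cos t * Real.cos t
        + √(radiusSq (φ x)) * Real.sin t * Real.sin t = √(radiusSq (φ x)) := by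
        linear_combination √(radiusSq (φ x)) * hcs
      rw [this]
      exact hpos.ne'
    have hA := (contDiffAt_const (c := t)).add
      ((Real.contDiff_arctan.contDiffAt).comp x (hy.div hw hne))
    refine hA.congr_of_eventuallyEq ?_
    have hcont : ContinuousAt (fun y => φ y 2) x :=
      (by fun_prop : Continuous fun z : E3 => z 2).continuousAt.comp hc
    have hnear : ∀ᶠ y in 𝓝 x, |φ y 2 - t| < Real.pi / 2 := by
      have := hcont (Metric.ball_mem_nhds _ (show 0 < Real.pi / 2 by positivity))
      filter_upwards [this] with y hy
      rwa [mem_preimage, Metric.mem_ball, Real.dist_eq] at hy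
    filter_upwards [hnear] with y hy
    have hpos := Real.sqrt_pos.2 (radiusSq_pos (φ y))
    have hlt := abs_lt.1 hy
    have e1 : √(radiusSq (φ y)) * Real.sin (φ y 2) * Real.cos t
        - √(radiusSq (φ y)) * Real.cos (φ y 2) * Real.sin t
        = √(radiusSq (φ y)) * Real.sin (φ y 2 - t) := by rw [Real.sin_sub]; ring
    have e2 : √(radiusSq (φ y)) * Real.cos (φ y 2) * Real.cos t
        + √(radiusSq (φ y)) * Real.sin (φ y 2) * Real.sin t
        = √(radiusSq (φ y)) * Real.cos (φ y 2 - t) := by rw [Real.cos_sub]; ring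
    change φ y 2 = t + Real.arctan (_ / _)
    beta_reduce
    rw [e1, e2, mul_div_mul_left _ _ hpos.ne', ← Real.tan_eq_sin_div_cos,
      Real.arctan_tan (by linarith) (by linarith)]
    ring

/-- The linear maps of `ℝ⁴` that preserve the quadratic form. -/
def PreservesQ (A : (Fin 4 → ℝ) →L[ℝ] (Fin 4 → ℝ)) : Prop := ∀ y z, Q (A y) (A z) = Q y z

lemma eq_zero_of_Q {y : Fin 4 → ℝ} (h : ∀ z, Q y z = 0) : y = 0 := by
  funext i
  have := h (Pi.single i 1)
  rw [Q_apply] at this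
  fin_cases i <;> simpa using this

lemma PreservesQ.comp {A B : (Fin 4 → ℝ) →L[ℝ] (Fin 4 → ℝ)} (hA : PreservesQ A)
    (hB : PreservesQ B) : PreservesQ (A.comp B) := fun y z => by
  simp only [ContinuousLinearMap.comp_apply]
  rw [hA, hB]

lemma PreservesQ.exists_inverse {A : (Fin 4 → ℝ) →L[ℝ] (Fin 4 → ℝ)} (hA : PreservesQ A) :
    ∃ B : (Fin 4 → ℝ) →L[ℝ] (Fin 4 → ℝ), PreservesQ B ∧ (∀ y, B (A y) = y) ∧
      ∀ y, A (B y) = y := by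
  have hinj : Function.Injective A.toLinearMap := by
    rw [injective_iff_map_eq_zero]
    intro y hy
    refine eq_zero_of_Q fun z => ?_
    rw [← hA y z]
    have : A y = 0 := hy
    rw [this]
    simp
  let e := LinearEquiv.ofInjectiveEndo A.toLinearMap hinj
  have h1 : ∀ y, e.symm (A y) = y := fun y => e.symm_apply_apply y
  have h2 : ∀ y, A (e.symm y) = y := fun y => e.apply_symm_apply y
  refine ⟨LinearMap.toContinuousLinearMap e.symm.toLinearMap, ?_, h1, h2⟩
  intro y z
  rw [← hA]
  change Q (A (e.symm y)) (A (e.symm z)) = _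
  rw [h2, h2]

/-- The homeomorphisms `g` of the universal anti-de Sitter space that lift a linear isometry of
`ℝ⁴`. They turn out to be its isometries. -/
def IsLinearLift (g : E3 → E3) : Prop :=
  ∃ A : (Fin 4 → ℝ) →L[ℝ] (Fin 4 → ℝ), PreservesQ A ∧ ∀ x, cover (g x) = A (cover x)

lemma IsLinearLift.comp {g h : E3 → E3} (hg : IsLinearLift g) (hh : IsLinearLift h) :
    IsLinearLift (g ∘ h) := by
  obtain ⟨A, hA, hgA⟩ := hg
  obtain ⟨B, hB, hhB⟩ := hh
  exact ⟨A.comp B, hA.comp hB, fun x => by simp [hgA, hhB]⟩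

lemma IsLinearLift.symm {g : E3 ≃ₜ E3} (hg : IsLinearLift g) : IsLinearLift g.symm := by
  obtain ⟨A, hA, hgA⟩ := hg
  obtain ⟨B, hB, hBA, -⟩ := hA.exists_inverse
  refine ⟨B, hB, fun x => ?_⟩
  rw [← hBA (cover (g.symm x)), ← hgA, g.apply_symm_apply]

lemma exists_homeomorph_lift {A : (Fin 4 → ℝ) →L[ℝ] (Fin 4 → ℝ)} (hA : PreservesQ A) {x y : E3}
    (h : cover y = A (cover x)) :
    ∃ g : E3 ≃ₜ E3, (∀ z, cover (g z) = A (cover z)) ∧ g x = y := by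
  obtain ⟨B, hB, hBA, hAB⟩ := hA.exists_inverse
  have hcov : Continuous cover := (contDiff_cover (n := 0)).continuous
  obtain ⟨g, hg, hgx, hgc⟩ := exists_cover_lift (fun z => A (cover z)) (A.continuous.comp hcov)
    (fun z => by rw [hA, Q_cover]) h
  have h' : cover x = B (cover y) := by rw [h, hBA]
  obtain ⟨k, hk, hky, hkc⟩ := exists_cover_lift (fun z => B (cover z)) (B.continuous.comp hcov)
    (fun z => by rw [hB, Q_cover]) h'
  have e1 : ∀ z, k (g z) = z := fun z =>
    eqOn_of_cover_eqOn isPreconnected_univ (hk.comp hg).continuousOn continuousOn_id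
      (fun z _ => by simp [hkc, hgc, hBA]) (mem_univ x) (by simp [hgx, hky]) (mem_univ z)
  have e2 : ∀ z, g (k z) = z := fun z =>
    eqOn_of_cover_eqOn isPreconnected_univ (hg.comp hk).continuousOn continuousOn_id
      (fun z _ => by simp [hkc, hgc, hAB]) (mem_univ y) (by simp [hgx, hky]) (mem_univ z)
  exact ⟨⟨⟨g, k, e1, e2⟩, hg, hk⟩, hgc, hgx⟩

lemma IsLinearLift.contDiff {g : E3 → E3} (hg : IsLinearLift g) (hc : Continuous g)
    {n : WithTop ℕ∞} : ContDiff ℝ n g := by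
  obtain ⟨A, -, hgA⟩ := hg
  rw [contDiff_iff_contDiffAt]
  intro x
  refine contDiffAt_of_cover hc.continuousAt ?_
  simp only [hgA]
  exact (A.contDiff.comp contDiff_cover).contDiffAt

lemma fderiv_cover_comp {φ : E3 → E3} {x : E3} (h : DifferentiableAt ℝ φ x) (v : E3) :
    fderiv ℝ (fun y => cover (φ y)) x v = fderiv ℝ cover (φ x) (fderiv ℝ φ x v) := by
  have := fderiv_comp x (cover_differentiable (φ x)) h
  change fderiv ℝ (cover ∘ φ) x v = _
  rw [this]
  rfl

lemma fderiv_linear_cover (A : (Fin 4 → ℝ) →L[ℝ] (Fin 4 → ℝ)) (x v : E3) :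
    fderiv ℝ (fun y => A (cover y)) x v = A (fderiv ℝ cover x v) := by
  have := A.hasFDerivAt.comp x (cover_differentiable x).hasFDerivAt
  exact congrArg (fun L : E3 →L[ℝ] (Fin 4 → ℝ) => L v) this.fderiv

lemma IsLinearLift.adsForm_fderiv {g : E3 → E3} (hg : IsLinearLift g) (hc : Continuous g)
    (x v w : E3) : adsForm (g x) (fderiv ℝ g x v) (fderiv ℝ g x w) = adsForm x v w := by
  have hd : DifferentiableAt ℝ g x := (hg.contDiff hc (n := 1)).contDiffAt.differentiableAt (by simp)
  obtain ⟨A, hA, hgA⟩ := hg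
  have hF : ∀ v, fderiv ℝ cover (g x) (fderiv ℝ g x v) = A (fderiv ℝ cover x v) := by
    intro v
    rw [← fderiv_cover_comp hd]
    simp only [hgA]
    exact fderiv_linear_cover A x v
  rw [← Q_fderiv_cover, hF, hF, hA, Q_fderiv_cover]

lemma isLocalIsometryOn_iff {φ : E3 → E3} {U : Set E3} :
    IsLocalIsometryOn modelMetric modelMetric φ U ↔
      IsLocalDiffeomorphOn 𝓘(ℝ, E3) 𝓘(ℝ, E3) ∞ φ U ∧ ∀ x ∈ U, ∀ v w : E3,
        adsForm (φ x) (fderiv ℝ φ x v) (fderiv ℝ φ x w) = adsForm x v w := by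
  unfold IsLocalIsometryOn
  refine and_congr_right fun _ => forall₂_congr fun x _ => ?_
  simp only [mfderiv_eq_fderiv]
  simp only [modelMetric_apply]
  rfl

lemma IsLinearLift.isLocalIsometryOn {g : E3 ≃ₜ E3} (hg : IsLinearLift g) (U : Set E3) :
    IsLocalIsometryOn modelMetric modelMetric g U := by
  rw [isLocalIsometryOn_iff]
  refine ⟨?_, fun x _ v w => hg.adsForm_fderiv g.continuous x v w⟩
  let d : Diffeomorph 𝓘(ℝ, E3) 𝓘(ℝ, E3) E3 E3 ∞ :=
    { g.toEquiv with
      contMDiff_toFun := (hg.contDiff g.continuous).contMDiff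
      contMDiff_invFun := (hg.symm.contDiff g.symm.continuous).contMDiff }
  exact d.isLocalDiffeomorph.isLocalDiffeomorphOn U

/-- Two linear maps that agree on an open set of the quadric are equal. -/
lemma linear_eq_of_eventuallyEq {A B : (Fin 4 → ℝ) →L[ℝ] (Fin 4 → ℝ)} {x : E3}
    (h : ∀ᶠ y in 𝓝 x, A (cover y) = B (cover y)) : A = B := by
  have hz : (fun y => (A - B) (cover y)) =ᶠ[𝓝 x] fun _ => 0 := by
    filter_upwards [h] with y hy
    simp [hy]
  have h0 : (A - B) (cover x) = 0 := hz.self_of_nhds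
  have h1 : ∀ v, (A - B) (fderiv ℝ cover x v) = 0 := by
    intro v
    rw [← fderiv_linear_cover, hz.fderiv_eq]
    simp
  have hr := Real.sqrt_pos.2 (radiusSq_pos x)
  have hs := Real.sq_sqrt (radiusSq_pos x).le
  have hcs := Real.sin_sq_add_cos_sq (x 2)
  -- The position vector and the tangent vectors span `ℝ⁴`.
  suffices H : ∀ y : Fin 4 → ℝ, ∃ (c : ℝ) (v : E3), y = c • cover x + fderiv ℝ cover x v by
    ext1 y
    obtain ⟨c, v, rfl⟩ := H y
    have := h1 v
    rw [sub_apply, sub_eq_zero] at this h0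
    rw [map_add, map_add, map_smul, map_smul, h0, this]
  intro y
  set c : ℝ := - Q y (cover x) with hc
  set τ := (-(y 0) * Real.sin (x 2) + y 1 * Real.cos (x 2)) / √(radiusSq x) with hτ
  refine ⟨c, !₂[y 2 - c * x 0, y 3 - c * x 1, τ], ?_⟩
  rw [fderiv_cover, cover_apply]
  have hcr : c = (y 0 * Real.cos (x 2) + y 1 * Real.sin (x 2)) * √(radiusSq x)
      - y 2 * x 0 - y 3 * x 1 := by
    rw [hc, Q_apply, cover_apply]
    simp
    ring
  have hrad : √(radiusSq x) ^ 2 = 1 + x 0 ^ 2 + x 1 ^ 2 := by rw [hs, radiusSq]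
  generalize √(radiusSq x) = r at *
  clear_value c τ
  have hτr : r * τ = -(y 0) * Real.sin (x 2) + y 1 * Real.cos (x 2) := by
    rw [hτ]; field_simp
  have hd : c * r + (x 0 * (y 2 - c * x 0) + x 1 * (y 3 - c * x 1)) / r
      = y 0 * Real.cos (x 2) + y 1 * Real.sin (x 2) := by
    field_simp
    linear_combination c * hrad + hcr
  funext i
  fin_cases i
  · simp
    linear_combination (-y 0) * hcs + (- Real.cos (x 2)) * hd + Real.sin (x 2) * hτr
  · simp
    linear_combination (-y 1) * hcs + (- Real.sin (x 2)) * hd - Real.cos (x 2) * hτr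
  · simp
  · simp

lemma IsLinearLift.eq_of_eventuallyEq {g h : E3 → E3} (hg : IsLinearLift g) (hh : IsLinearLift h)
    (hgc : Continuous g) (hhc : Continuous h) {x : E3} (he : g =ᶠ[𝓝 x] h) : g = h := by
  obtain ⟨A, -, hgA⟩ := hg
  obtain ⟨B, -, hhB⟩ := hh
  have hAB : A = B := linear_eq_of_eventuallyEq (x := x) <| by
    filter_upwards [he] with y hy
    rw [← hgA, ← hhB, hy]
  funext y
  exact eqOn_of_cover_eqOn isPreconnected_univ hgc.continuousOn hhc.continuousOn
    (fun z _ => by rw [hgA, hhB, hAB]) (mem_univ x) he.self_of_nhds (mem_univ y)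

/-! ### Rigidity of local isometries -/

/-- The frame of `ℝ⁴` given by the value and the differential of a map to `ℝ⁴`. -/
def frame (F : E3 → Fin 4 → ℝ) (x : E3) : (ℝ × E3) →L[ℝ] (Fin 4 → ℝ) :=
  (ContinuousLinearMap.fst ℝ ℝ E3).smulRight (F x) +
    (fderiv ℝ F x).comp (ContinuousLinearMap.snd ℝ ℝ E3)

lemma frame_apply (F : E3 → Fin 4 → ℝ) (x : E3) (y : ℝ × E3) :
    frame F x y = y.1 • F x + fderiv ℝ F x y.2 := rfl

lemma Q_comm (a b : Fin 4 → ℝ) : Q a b = Q b a := by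
  rw [Q_apply, Q_apply]; ring

lemma Q_frame_cover (x : E3) (y z : ℝ × E3) :
    Q (frame cover x y) (frame cover x z) = -(y.1 * z.1) + adsForm x y.2 z.2 := by
  simp only [frame_apply, map_add, map_smul, LinearMap.add_apply, LinearMap.smul_apply,
    Q_fderiv_cover, Q_cover, Q_cover_fderiv, smul_eq_mul, Q_comm _ (cover x)]
  ring

lemma frame_cover_injective (x : E3) : Function.Injective (frame cover x) := by
  rw [injective_iff_map_eq_zero]
  intro y hy
  have h : ∀ z : ℝ × E3, -(y.1 * z.1) + adsForm x y.2 z.2 = 0 := fun z => by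
    rw [← Q_frame_cover, hy]; simp
  have h1 : y.1 = 0 := by
    have := h (1, 0)
    simpa [adsForm, spaceForm] using this
  have h2 : y.2 = 0 := eq_zero_of_adsForm (x := x) fun w => by simpa [h1] using h (0, w)
  exact Prod.ext h1 h2

lemma exists_frame_equiv (x : E3) :
    ∃ e : (ℝ × E3) ≃L[ℝ] (Fin 4 → ℝ), (e : (ℝ × E3) →L[ℝ] (Fin 4 → ℝ)) = frame cover x := by
  have hfin : Module.finrank ℝ (ℝ × E3) = Module.finrank ℝ (Fin 4 → ℝ) := by simp
  let e := LinearEquiv.ofInjectiveOfFinrankEq (frame cover x).toLinearMap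
    (frame_cover_injective x) hfin
  exact ⟨e.toContinuousLinearEquiv, rfl⟩

lemma differentiableAt_frame {F : E3 → Fin 4 → ℝ} {x : E3} (h : ContDiffAt ℝ 2 F x) :
    DifferentiableAt ℝ (frame F) x := by
  have h1 : DifferentiableAt ℝ F x := h.differentiableAt (by simp)
  have h2 : DifferentiableAt ℝ (fderiv ℝ F) x :=
    (h.fderiv_right (m := 1) (by norm_num)).differentiableAt (by simp)
  unfold frame
  refine DifferentiableAt.add ?_ ?_
  · exact (ContinuousLinearMap.smulRightL ℝ (ℝ × E3) (Fin 4 → ℝ)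
      (ContinuousLinearMap.fst ℝ ℝ E3)).differentiableAt.comp x h1
  · exact h2.clm_comp (differentiableAt_const _)

/-- The linear map that sends the frame of `cover` at `x` to the frame of `F`. -/
def frameChange (F : E3 → Fin 4 → ℝ) (x : E3) : (Fin 4 → ℝ) →L[ℝ] (Fin 4 → ℝ) :=
  (frame F x).comp (ContinuousLinearMap.inverse (frame cover x))

lemma frameChange_frame (F : E3 → Fin 4 → ℝ) (x : E3) (y : ℝ × E3) :
    frameChange F x (frame cover x y) = frame F x y := by
  obtain ⟨e, he⟩ := exists_frame_equiv x
  rw [frameChange, ← he, ContinuousLinearMap.inverse_equiv]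
  simp

lemma differentiableAt_frameChange {F : E3 → Fin 4 → ℝ} {x : E3} (h : ContDiffAt ℝ 2 F x) :
    DifferentiableAt ℝ (frameChange F) x := by
  obtain ⟨e, he⟩ := exists_frame_equiv x
  have h1 : DifferentiableAt ℝ (ContinuousLinearMap.inverse :
      ((ℝ × E3) →L[ℝ] (Fin 4 → ℝ)) → _) (frame cover x) := by
    rw [← he]
    exact (contDiffAt_map_inverse (n := 1) e).differentiableAt (by simp)
  exact (differentiableAt_frame h).clm_comp
    (h1.comp x (differentiableAt_frame contDiff_cover.contDiffAt))

lemma frame_surjective (x : E3) (y : Fin 4 → ℝ) : ∃ z, frame cover x z = y := by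
  obtain ⟨e, he⟩ := exists_frame_equiv x
  refine ⟨e.symm y, ?_⟩
  rw [← he]
  simp

/-- A tensor that is symmetric in its first two variables and skew in the last two vanishes. -/
lemma eq_zero_of_symm_skew {V : Type*} (N : V → V → V → ℝ) (hs : ∀ u v w, N u v w = N v u w)
    (ha : ∀ u v w, N u v w = - N u w v) (u v w : V) : N u v w = 0 := by
  have h1 := ha u v w
  have h2 := hs u w v
  have h3 := ha w u v
  have h4 := hs w v u
  have h5 := ha v w u
  have h6 := hs v u w
  linarith

/-- The frame change of a local isometry is locally constant: its derivative, read in the frame,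
is a tensor that is symmetric in two variables and skew in two variables. -/
lemma fderiv_frameChange_eq_zero {F : E3 → Fin 4 → ℝ} {U : Set E3} (hU : IsOpen U)
    (hF : ContDiffOn ℝ 2 F U)
    (hQ : ∀ x ∈ U, ∀ y z, Q (frame F x y) (frame F x z) = Q (frame cover x y) (frame cover x z))
    {x : E3} (hx : x ∈ U) : fderiv ℝ (frameChange F) x = 0 := by
  have hUx : U ∈ 𝓝 x := hU.mem_nhds hx
  have hFx : ContDiffAt ℝ 2 F x := hF.contDiffAt hUx
  have hCx : ContDiffAt ℝ 2 cover x := contDiff_cover.contDiffAt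
  set A := frameChange F with hA
  set A' := fderiv ℝ A x with hA'
  have hAd : HasFDerivAt A A' x := (differentiableAt_frameChange hFx).hasFDerivAt
  have e0 : ∀ y, A y (cover y) = F y := fun y => by
    have := frameChange_frame F y (1, 0)
    simpa [frame_apply] using this
  have e1 : ∀ y v, A y (fderiv ℝ cover y v) = fderiv ℝ F y v := fun y v => by
    have := frameChange_frame F y (0, v)
    simpa [frame_apply] using this
  have hpres : ∀ y ∈ U, ∀ a b, Q (A y a) (A y b) = Q a b := by
    intro y hy a b
    obtain ⟨a, rfl⟩ := frame_surjective y a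
    obtain ⟨b, rfl⟩ := frame_surjective y b
    rw [hA, frameChange_frame, frameChange_frame, hQ y hy]
  -- The derivative kills the position vector.
  have d0 : ∀ u, A' u (cover x) = 0 := by
    intro u
    have h := (hAd.clm_apply (cover_differentiable x).hasFDerivAt).fderiv
    have h2 : (fun y => A y (cover y)) = F := funext e0
    rw [h2] at h
    have h3 := congrArg (fun L : E3 →L[ℝ] (Fin 4 → ℝ) => L u) h
    simp only [add_apply, ContinuousLinearMap.comp_apply,
      ContinuousLinearMap.flip_apply, e1] at h3
    simpa using h3
  -- Symmetry of second derivatives.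
  have d1 : ∀ u v, A' u (fderiv ℝ cover x v) = A' v (fderiv ℝ cover x u) := by
    have key : ∀ u v, A' u (fderiv ℝ cover x v) =
        fderiv ℝ (fderiv ℝ F) x u v - A x (fderiv ℝ (fderiv ℝ cover) x u v) := by
      intro u v
      have hd : HasFDerivAt (fderiv ℝ cover) (fderiv ℝ (fderiv ℝ cover) x) x :=
        ((hCx.fderiv_right (m := 1) (by norm_num)).differentiableAt (by simp)).hasFDerivAt
      have hd2 : HasFDerivAt (fderiv ℝ F) (fderiv ℝ (fderiv ℝ F) x) x :=
        ((hFx.fderiv_right (m := 1) (by norm_num)).differentiableAt (by simp)).hasFDerivAt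
      have h := (hAd.clm_apply (hd.clm_apply (hasFDerivAt_const v x))).fderiv
      have h2 : (fun y => A y (fderiv ℝ cover y v)) = fun y => fderiv ℝ F y v :=
        funext fun y => e1 y v
      rw [h2, (hd2.clm_apply (hasFDerivAt_const v x)).fderiv] at h
      have h3 := congrArg (fun L : E3 →L[ℝ] (Fin 4 → ℝ) => L u) h
      simp at h3
      rw [h3]
      abel
    intro u v
    rw [key, key, (hFx.isSymmSndFDerivAt (by simp)).eq, (hCx.isSymmSndFDerivAt (by simp)).eq]
  -- Skew-symmetry, because the frame changes preserve the quadratic form.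
  have d2 : ∀ u a b, Q (A' u a) (A x b) + Q (A x a) (A' u b) = 0 := by
    intro u a b
    let q := LinearMap.toContinuousBilinearMap Q
    have h1 := (hAd.clm_apply (hasFDerivAt_const a x))
    have h2 := (hAd.clm_apply (hasFDerivAt_const b x))
    have h := (q.hasFDerivAt_of_bilinear h1 h2).fderiv
    have h3 : (fun y => q (A y a) (A y b)) =ᶠ[𝓝 x] fun _ => Q a b := by
      filter_upwards [hUx] with y hy using hpres y hy a b
    rw [h3.fderiv_eq] at h
    have h4 := congrArg (fun L : E3 →L[ℝ] ℝ => L u) h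
    simp [q] at h4
    linarith
  have hN : ∀ u v w, Q (A' u (fderiv ℝ cover x v)) (A x (fderiv ℝ cover x w)) = 0 := by
    refine eq_zero_of_symm_skew _ (fun u v w => by rw [d1]) fun u v w => ?_
    have := d2 u (fderiv ℝ cover x v) (fderiv ℝ cover x w)
    rw [Q_comm (A x _)] at this
    linarith
  have hsurj : ∀ b, ∃ a, A x a = b := by
    obtain ⟨B, -, -, hB⟩ := PreservesQ.exists_inverse (A := A x) (fun a b => hpres x hx a b)
    exact fun b => ⟨B b, hB b⟩
  -- The derivative kills the tangent vectors: it is orthogonal to the tangent vectors by symmetry,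
  -- and to the position vector because it kills the latter.
  have d3 : ∀ u v, A' u (fderiv ℝ cover x v) = 0 := by
    intro u v
    refine eq_zero_of_Q fun b => ?_
    obtain ⟨a, rfl⟩ := hsurj b
    obtain ⟨⟨s, w⟩, rfl⟩ := frame_surjective x a
    rw [frame_apply, map_add, map_add, map_smul, map_smul, hN, add_zero]
    have := d2 u (fderiv ℝ cover x v) (cover x)
    rw [d0, map_zero, add_zero] at this
    simp [this]
  ext1 u
  ext1 a
  obtain ⟨⟨s, w⟩, rfl⟩ := frame_surjective x a
  rw [frame_apply, map_add, map_smul, d0, d3]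
  simp

/-- A local isometry on a connected open set is, after composition with `cover`, the restriction of
a linear map. -/
lemma exists_linear_of_isometry {φ : E3 → E3} {U : Set E3} (hU : IsOpen U)
    (hconn : IsPreconnected U) (hφ : ContDiffOn ℝ 2 φ U)
    (hiso : ∀ x ∈ U, ∀ v w : E3,
      adsForm (φ x) (fderiv ℝ φ x v) (fderiv ℝ φ x w) = adsForm x v w) (hne : U.Nonempty) :
    ∃ A, PreservesQ A ∧ ∀ x ∈ U, cover (φ x) = A (cover x) := by
  obtain ⟨x₀, hx₀⟩ := hne
  set F : E3 → Fin 4 → ℝ := fun x => cover (φ x) with hF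
  have hFs : ContDiffOn ℝ 2 F U := contDiff_cover.comp_contDiffOn hφ
  have hQ : ∀ x ∈ U, ∀ y z, Q (frame F x y) (frame F x z) =
      Q (frame cover x y) (frame cover x z) := by
    intro x hx y z
    have hd : DifferentiableAt ℝ φ x := (hφ.contDiffAt (hU.mem_nhds hx)).differentiableAt (by simp)
    have h1 : ∀ y : ℝ × E3, frame F x y = frame cover (φ x) (y.1, fderiv ℝ φ x y.2) := by
      intro y
      rw [frame_apply, frame_apply, hF, fderiv_cover_comp hd]
    rw [h1, h1, Q_frame_cover, Q_frame_cover, hiso x hx]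
  have hA : ∀ x ∈ U, frameChange F x = frameChange F x₀ := fun x hx =>
    hU.is_const_of_fderiv_eq_zero (𝕜 := ℝ) hconn
      (fun y hy => (differentiableAt_frameChange
        (hFs.contDiffAt (hU.mem_nhds hy))).differentiableWithinAt)
      (fun y hy => fderiv_frameChange_eq_zero hU hFs hQ hy) hx hx₀
  refine ⟨frameChange F x₀, ?_, ?_⟩
  · intro a b
    obtain ⟨a, rfl⟩ := frame_surjective x₀ a
    obtain ⟨b, rfl⟩ := frame_surjective x₀ b
    rw [frameChange_frame, frameChange_frame, hQ x₀ hx₀]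
  · intro x hx
    rw [← hA x hx]
    have := frameChange_frame F x (1, 0)
    simpa [frame_apply] using this.symm

/-- Every local isometry on a connected open set extends to a global isometry. -/
lemma exists_isometry_extension {φ : E3 → E3} {U : Set E3} (hU : IsOpen U)
    (hconn : IsPreconnected U) (hφ : IsLocalIsometryOn modelMetric modelMetric φ U)
    (hne : U.Nonempty) : ∃ g : E3 ≃ₜ E3, IsLinearLift g ∧ EqOn φ g U := by
  rw [isLocalIsometryOn_iff] at hφ
  have hs : ContDiffOn ℝ ∞ φ U := hφ.1.contMDiffOn.contDiffOn
  obtain ⟨A, hA, hAφ⟩ := exists_linear_of_isometry hU hconn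
    (hs.of_le (WithTop.coe_le_coe.2 le_top)) hφ.2 hne
  obtain ⟨x₀, hx₀⟩ := hne
  obtain ⟨g, hg, hgx⟩ := exists_homeomorph_lift hA (hAφ x₀ hx₀)
  exact ⟨g, ⟨A, hA, hg⟩, eqOn_of_cover_eqOn hconn hs.continuousOn g.continuous.continuousOn
    (fun x hx => by rw [hAφ x hx, hg]) hx₀ hgx.symm⟩

/-! ### Maximal lifts of curves through local homeomorphisms -/

/-- An open interval containing `0` is the image of a `C¹` parametrization by `ℝ` with positive
derivative: a map of the form `s / (1 + κ s⁺ + l s⁻)`. -/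
lemma exists_interval_param {J : Set ℝ} (hJ : IsOpen J) (hc : J.OrdConnected) (h0 : (0 : ℝ) ∈ J) :
    ∃ θ : ℝ → ℝ, ContDiff ℝ 1 θ ∧ (∀ s, 0 < deriv θ s) ∧ θ 0 = 0 ∧ range θ = J := by
  -- `κ` is the inverse of the upper end of `J`, or `0` if `J` is unbounded above.
  obtain ⟨κ, hκ0, hκ⟩ : ∃ κ : ℝ, 0 ≤ κ ∧ ∀ s, 0 ≤ s → (s ∈ J ↔ κ * s < 1) := by
    by_cases hb : BddAbove J
    · have hlub := isLUB_csSup ⟨0, h0⟩ hb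
      set β := sSup J with hβ
      have hβJ : β ∉ J := by
        intro hmem
        obtain ⟨ε, hε, hball⟩ := Metric.isOpen_iff.1 hJ β hmem
        have := hlub.1 (hball (show β + ε / 2 ∈ Metric.ball β ε by
          rw [Metric.mem_ball, Real.dist_eq, abs_lt]; constructor <;> linarith))
        linarith
      have hβ0 : 0 < β := lt_of_le_of_ne (hlub.1 h0) fun h => hβJ (h ▸ h0)
      refine ⟨β⁻¹, by positivity, fun s hs => ?_⟩
      rw [inv_mul_lt_iff₀ hβ0, mul_one]
      constructor
      · intro hsJ
        exact lt_of_le_of_ne (hlub.1 hsJ) fun h => hβJ (h ▸ hsJ)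
      · intro hsβ
        obtain ⟨b, hb, hsb, -⟩ := hlub.exists_between hsβ
        exact hc.out h0 hb ⟨hs, hsb.le⟩
    · refine ⟨0, le_rfl, fun s hs => ⟨fun _ => by simp, fun _ => ?_⟩⟩
      obtain ⟨b, hb, hsb⟩ := not_bddAbove_iff.1 hb s
      exact hc.out h0 hb ⟨hs, hsb.le⟩
  -- `l` is the inverse of the absolute value of the lower end of `J`, or `0`.
  obtain ⟨l, hl0, hl⟩ : ∃ l : ℝ, 0 ≤ l ∧ ∀ s, s ≤ 0 → (s ∈ J ↔ l * (-s) < 1) := by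
    by_cases hb : BddBelow J
    · have hglb := isGLB_csInf ⟨0, h0⟩ hb
      set α := sInf J with hα
      have hαJ : α ∉ J := by
        intro hmem
        obtain ⟨ε, hε, hball⟩ := Metric.isOpen_iff.1 hJ α hmem
        have := hglb.1 (hball (show α - ε / 2 ∈ Metric.ball α ε by
          rw [Metric.mem_ball, Real.dist_eq, abs_lt]; constructor <;> linarith))
        linarith
      have hα0 : α < 0 := lt_of_le_of_ne (hglb.1 h0) fun h => hαJ (h ▸ h0)
      refine ⟨(-α)⁻¹, by rw [inv_nonneg]; linarith, fun s hs => ?_⟩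
      rw [inv_mul_lt_iff₀ (by linarith), mul_one, neg_lt_neg_iff]
      constructor
      · intro hsJ
        exact lt_of_le_of_ne (hglb.1 hsJ) fun h => hαJ (h ▸ hsJ)
      · intro hsα
        obtain ⟨b, hb, -, hsb⟩ := hglb.exists_between hsα
        exact hc.out hb h0 ⟨hsb.le, hs⟩
    · refine ⟨0, le_rfl, fun s hs => ⟨fun _ => by simp, fun _ => ?_⟩⟩
      obtain ⟨b, hb, hsb⟩ := not_bddBelow_iff.1 hb s
      exact hc.out hb h0 ⟨hsb.le, hs⟩
  set d : ℝ → ℝ := fun s => 1 + κ * max s 0 + l * max (-s) 0 with hd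
  have hd1 : ∀ s, 1 ≤ d s := fun s => by
    have := mul_nonneg hκ0 (le_max_right s 0)
    have := mul_nonneg hl0 (le_max_right (-s) 0)
    simp only [hd]; linarith
  have hdc : Continuous d := by fun_prop
  have hderiv : ∀ s, HasDerivAt (fun s => s / d s) ((d s ^ 2)⁻¹) s := by
    intro s
    rcases lt_trichotomy s 0 with hs | rfl | hs
    · have h1 : HasDerivAt (fun s => s / (1 + l * (-s)))
          ((1 * (1 + l * (-s)) - s * (l * -1)) / (1 + l * (-s)) ^ 2) s := by
        refine (hasDerivAt_id' s).div ?_ ?_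
        · simpa using (((hasDerivAt_id' s).neg).const_mul l).const_add 1
        · nlinarith
      have h2 : d s = 1 + l * (-s) := by
        simp [hd, max_eq_right hs.le, max_eq_left (neg_nonneg.2 hs.le)]
      have h3 : (d s ^ 2)⁻¹ = (1 * (1 + l * (-s)) - s * (l * -1)) / (1 + l * (-s)) ^ 2 := by
        rw [h2, inv_eq_one_div]; congr 1; ring
      rw [h3]
      refine h1.congr_of_eventuallyEq ?_
      filter_upwards [Iio_mem_nhds hs] with u hu
      have hu' : u < 0 := hu
      simp [hd, max_eq_right hu'.le, max_eq_left (neg_nonneg.2 hu'.le)]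
    · rw [hasDerivAt_iff_tendsto_slope]
      have hcont : Tendsto (fun s => (d s)⁻¹) (𝓝[≠] 0) (𝓝 ((d 0 ^ 2)⁻¹)) := by
        have : (d 0 ^ 2)⁻¹ = (d 0)⁻¹ := by simp [hd]
        rw [this]
        exact ((hdc.inv₀ fun s => by linarith [hd1 s]).tendsto 0).mono_left nhdsWithin_le_nhds
      refine hcont.congr' ?_
      filter_upwards [self_mem_nhdsWithin] with u hu
      have hu' : u ≠ 0 := hu
      rw [slope_def_field]
      field_simp
      simp
    · have h1 : HasDerivAt (fun s => s / (1 + κ * s))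
          ((1 * (1 + κ * s) - s * (κ * 1)) / (1 + κ * s) ^ 2) s := by
        refine (hasDerivAt_id' s).div ?_ ?_
        · exact ((hasDerivAt_id' s).const_mul κ).const_add 1
        · nlinarith
      have h2 : d s = 1 + κ * s := by
        simp [hd, max_eq_left hs.le, max_eq_right (neg_nonpos.2 hs.le)]
      have h3 : (d s ^ 2)⁻¹ = (1 * (1 + κ * s) - s * (κ * 1)) / (1 + κ * s) ^ 2 := by
        rw [h2, inv_eq_one_div]; congr 1; ring
      rw [h3]
      refine h1.congr_of_eventuallyEq ?_
      filter_upwards [Ioi_mem_nhds hs] with u hu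
      have hu' : 0 < u := hu
      simp [hd, max_eq_left hu'.le, max_eq_right (neg_nonpos.2 hu'.le)]
  have hderiv' : deriv (fun s => s / d s) = fun s => (d s ^ 2)⁻¹ := funext fun s => (hderiv s).deriv
  refine ⟨fun s => s / d s, ?_, ?_, by simp, ?_⟩
  · rw [contDiff_one_iff_deriv, hderiv']
    refine ⟨fun s => (hderiv s).differentiableAt, ?_⟩
    exact (hdc.pow 2).inv₀ fun s => (pow_pos (lt_of_lt_of_le one_pos (hd1 s)) 2).ne'
  · intro s
    rw [hderiv']
    have : 0 < d s := by linarith [hd1 s]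
    positivity
  · ext t
    constructor
    · rintro ⟨s, rfl⟩
      have hds := hd1 s
      rcases le_total 0 s with hs | hs
      · have h2 : d s = 1 + κ * s := by
          simp [hd, max_eq_left hs, max_eq_right (neg_nonpos.2 hs)]
        rw [hκ _ (div_nonneg hs (by linarith)), mul_div_assoc', div_lt_one (by linarith), h2]
        linarith
      · have h2 : d s = 1 + l * (-s) := by
          simp [hd, max_eq_right hs, max_eq_left (neg_nonneg.2 hs)]
        rw [hl _ (div_nonpos_of_nonpos_of_nonneg hs (by linarith)), ← neg_div, mul_div_assoc',
          div_lt_one (by linarith), h2]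
        linarith
    · intro ht
      rcases le_total 0 t with h | h
      · have h1 := (hκ t h).1 ht
        -- The inverse of `s ↦ s / (1 + κ s)`.
        refine ⟨t / (1 - κ * t), ?_⟩
        have hpos : 0 < 1 - κ * t := by linarith
        have hs : 0 ≤ t / (1 - κ * t) := by positivity
        have h2 : d (t / (1 - κ * t)) = 1 + κ * (t / (1 - κ * t)) := by
          simp [hd, max_eq_left hs, max_eq_right (neg_nonpos.2 hs)]
        simp only [h2]
        have : 1 + κ * (t / (1 - κ * t)) = 1 / (1 - κ * t) := by field_simp; ring
        rw [this, div_div_div_cancel_right₀ hpos.ne', div_one]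
      · have h1 := (hl t h).1 ht
        -- The inverse of `s ↦ s / (1 - l s)`.
        refine ⟨t / (1 + l * t), ?_⟩
        have hpos : 0 < 1 + l * t := by linarith
        have hs : t / (1 + l * t) ≤ 0 := div_nonpos_of_nonpos_of_nonneg h hpos.le
        have h2 : d (t / (1 + l * t)) = 1 + l * (-(t / (1 + l * t))) := by
          simp [hd, max_eq_right hs, max_eq_left (neg_nonneg.2 hs)]
        simp only [h2]
        have : 1 + l * (-(t / (1 + l * t))) = 1 / (1 + l * t) := by field_simp; ring
        rw [this, div_div_div_cancel_right₀ hpos.ne', div_one]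

variable {X Y : Type*} [TopologicalSpace X] [TopologicalSpace Y]

/-- `c` lifts the curve `σ` through `P` on the set `J`, starting from `x` at time `0`. -/
structure IsCurveLift (P : X → Y) (σ : ℝ → Y) (x : X) (J : Set ℝ) (c : ℝ → X) : Prop where
  ordConnected : J.OrdConnected
  zero_mem : (0 : ℝ) ∈ J
  continuousOn : ContinuousOn c J
  zero : c 0 = x
  lift : ∀ s ∈ J, P (c s) = σ s

lemma IsCurveLift.eqOn [T2Space X] {P : X → Y} (hP : IsLocalHomeomorph P) {σ : ℝ → Y} {x : X}
    {J J' : Set ℝ} {c c' : ℝ → X} (h : IsCurveLift P σ x J c) (h' : IsCurveLift P σ x J' c') :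
    EqOn c c' (J ∩ J') :=
  (T2Space.isSeparatedMap P).eqOn_of_comp_eqOn hP.isLocallyInjective
    (h.ordConnected.inter h'.ordConnected).isPreconnected
    (h.continuousOn.mono inter_subset_left) (h'.continuousOn.mono inter_subset_right)
    (fun s hs => by simp [h.lift s hs.1, h'.lift s hs.2]) ⟨h.zero_mem, h'.zero_mem⟩
    (by rw [h.zero, h'.zero])

/-- Existence of maximal lifts: a maximal lift has no limit at an end point of its interval of
definition, and its interval contains that of any other lift. -/
lemma exists_maximal_lift [T2Space X] [T2Space Y] {P : X → Y} (hP : IsLocalHomeomorph P) {σ : ℝ → Y}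
    (hσ : Continuous σ) {x : X} (hx : P x = σ 0) :
    ∃ (J : Set ℝ) (c : ℝ → X), IsOpen J ∧ IsCurveLift P σ x J c ∧
      (∀ b ∈ closure J, b ∉ J → ∀ y, ¬ Tendsto c (𝓝[J] b) (𝓝 y)) ∧
      ∀ b d, IsCurveLift P σ x (uIcc 0 b) d → b ∈ J := by
  classical
  let F : Set (Set ℝ) := {I | IsOpen I ∧ ∃ d, IsCurveLift P σ x I d}
  let J : Set ℝ := ⋃₀ F
  have hopen : IsOpen J := isOpen_sUnion fun I hI => hI.1
  have hsel : ∀ s : ℝ, ∃ I d, s ∈ J → (s ∈ I ∧ IsOpen I ∧ IsCurveLift P σ x I d) := by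
    intro s
    by_cases hs : s ∈ J
    · obtain ⟨I, ⟨hI, d, hd⟩, hsI⟩ := hs
      exact ⟨I, d, fun _ => ⟨hsI, hI, hd⟩⟩
    · exact ⟨∅, fun _ => x, fun h => absurd h hs⟩
  choose I d hId using hsel
  let c : ℝ → X := fun s => d s s
  have hc : ∀ {I' : Set ℝ} {d' : ℝ → X}, IsOpen I' → IsCurveLift P σ x I' d' →
      EqOn c d' I' := by
    intro I' d' hI' hd' s hs
    have hsJ : s ∈ J := ⟨I', ⟨hI', d', hd'⟩, hs⟩
    obtain ⟨h1, -, h3⟩ := hId s hsJ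
    exact h3.eqOn hP hd' ⟨h1, hs⟩
  have hcJ : ContinuousOn c J := by
    intro s hs
    obtain ⟨h1, h2, h3⟩ := hId s hs
    exact (((h3.continuousOn.congr (hc h2 h3)).continuousAt (h2.mem_nhds h1))).continuousWithinAt
  -- The local inverse of `P` at the starting point shows that there is some lift.
  obtain ⟨e, hxe, rfl⟩ := hP x
  obtain ⟨ε, hε, hball⟩ := Metric.isOpen_iff.1 (e.open_target.preimage hσ) 0
    (show σ 0 ∈ e.target by rw [← hx]; exact e.map_source hxe)
  rw [Real.ball_eq_Ioo] at hball
  have hbase : IsCurveLift e σ x (Ioo (0 - ε) (0 + ε)) (e.symm ∘ σ) :=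
    { ordConnected := ordConnected_Ioo
      zero_mem := by constructor <;> linarith
      continuousOn := e.continuousOn_symm.comp hσ.continuousOn hball
      zero := by simp [← hx, e.left_inv hxe]
      lift := fun s hs => e.right_inv (hball hs) }
  have h0J : (0 : ℝ) ∈ J := ⟨_, ⟨isOpen_Ioo, _, hbase⟩, hbase.zero_mem⟩
  have hJord : J.OrdConnected :=
    (isPreconnected_sUnion 0 _ (fun I hI => hI.2.choose_spec.zero_mem)
      fun I hI => hI.2.choose_spec.ordConnected.isPreconnected).ordConnected
  have hcl : IsCurveLift e σ x J c :=
    { ordConnected := hJord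
      zero_mem := h0J
      continuousOn := hcJ
      zero := (hId 0 h0J).2.2.zero
      lift := fun s hs => (hId s hs).2.2.lift s (hId s hs).1 }
  -- A lift extends across every point where it has a limit.
  have hmax : ∀ b ∈ closure J, b ∉ J → ∀ y, ¬ Tendsto c (𝓝[J] b) (𝓝 y) := by
    intro b hb hbJ y hy
    have hne : (𝓝[J] b).NeBot := mem_closure_iff_nhdsWithin_neBot.1 hb
    obtain ⟨k, hyk, hek⟩ := hP y
    have hyb : e y = σ b := by
      have h1 : Tendsto (fun s => e (c s)) (𝓝[J] b) (𝓝 (e y)) :=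
        (hP.continuous.tendsto y).comp hy
      have h2 : Tendsto σ (𝓝[J] b) (𝓝 (σ b)) := (hσ.tendsto b).mono_left nhdsWithin_le_nhds
      refine tendsto_nhds_unique (h1.congr' ?_) h2
      filter_upwards [self_mem_nhdsWithin] with s hs using hcl.lift s hs
    have h1 : ∀ᶠ s in 𝓝 b, σ s ∈ k.target := by
      refine hσ.tendsto b (k.open_target.mem_nhds ?_)
      rw [← hyb, hek]
      exact k.map_source hyk
    have h2 : ∀ᶠ s in 𝓝 b, s ∈ J → c s ∈ k.source :=
      eventually_nhdsWithin_iff.1 (hy (k.open_source.mem_nhds hyk))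
    obtain ⟨δ, hδ, hball'⟩ := Metric.eventually_nhds_iff_ball.1 (h1.and h2)
    rw [Real.ball_eq_Ioo] at hball'
    set I := Ioo (b - δ) (b + δ) with hI
    have hbI : b ∈ I := by constructor <;> linarith
    obtain ⟨z, hzI, hzJ⟩ := mem_closure_iff.1 hb I isOpen_Ioo hbI
    let c' : ℝ → X := fun s => if s ∈ J then c s else k.symm (σ s)
    have hc1 : EqOn c' c J := fun s hs => by simp [c', hs]
    have hc2 : EqOn c' (k.symm ∘ σ) I := by
      intro s hs
      by_cases hsJ : s ∈ J
      · have h3 := hcl.lift s hsJ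
        simp only [c', hsJ, if_true, Function.comp_apply]
        rw [← h3, hek, k.left_inv ((hball' s hs).2 hsJ)]
      · simp [c', hsJ]
    have hnew : IsCurveLift e σ x (J ∪ I) c' :=
      { ordConnected := (IsPreconnected.union z hzJ hzI hJord.isPreconnected
          isPreconnected_Ioo).ordConnected
        zero_mem := Or.inl h0J
        continuousOn := by
          refine ContinuousOn.union_of_isOpen (hcJ.congr hc1) ?_ hopen isOpen_Ioo
          exact (k.continuousOn_symm.comp hσ.continuousOn fun s hs => (hball' s hs).1).congr hc2
        zero := by rw [hc1 h0J, hcl.zero]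
        lift := by
          rintro s (hs | hs)
          · rw [hc1 hs, hcl.lift s hs]
          · rw [hc2 hs, Function.comp_apply, hek, k.right_inv (hball' s hs).1] }
    exact hbJ ⟨_, ⟨hopen.union isOpen_Ioo, _, hnew⟩, Or.inr hbI⟩
  refine ⟨J, c, hopen, hcl, hmax, ?_⟩
  intro b d hd
  suffices H : uIcc 0 b ⊆ J from H right_mem_uIcc
  refine isPreconnected_uIcc.subset_of_closure_inter_subset hopen ⟨0, left_mem_uIcc, h0J⟩ ?_
  rintro b' ⟨hb', hb'K⟩
  by_contra hbJ
  refine hmax b' hb' hbJ (d b') ?_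
  have h1 : Tendsto d (𝓝[uIcc 0 b] b') (𝓝 (d b')) := hd.continuousOn b' hb'K
  have hne0 : b' ≠ 0 := fun h => hbJ (h ▸ h0J)
  -- Near `b'`, the interval `J` lies on the same side of `b'` as `0`.
  have hnear : ∀ᶠ s in 𝓝[J] b', s ∈ uIcc 0 b := by
    have hb'' : |b'| > 0 := abs_pos.2 hne0
    have : ∀ᶠ s in 𝓝[J] b', |s - b'| < |b'| := by
      refine nhdsWithin_le_nhds ?_
      filter_upwards [Metric.ball_mem_nhds b' hb''] with s hs
      rwa [Metric.mem_ball, Real.dist_eq] at hs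
    filter_upwards [this, self_mem_nhdsWithin] with s hs hsJ
    have hsub : uIcc 0 b' ⊆ uIcc 0 b := uIcc_subset_uIcc left_mem_uIcc hb'K
    refine hsub ?_
    have hnot : b' ∉ uIcc 0 s := fun h => hbJ (hJord.uIcc_subset h0J hsJ h)
    rw [mem_uIcc] at hnot ⊢
    push Not at hnot
    have h3 := abs_lt.1 hs
    rcases lt_or_gt_of_ne hne0 with hneg | hpos
    · rw [abs_of_neg hneg] at h3
      right
      refine ⟨?_, by linarith⟩
      by_contra hlt
      push Not at hlt
      exact absurd (hnot.2 hlt.le) (by linarith)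
    · rw [abs_of_pos hpos] at h3
      left
      refine ⟨by linarith, ?_⟩
      by_contra hlt
      push Not at hlt
      exact absurd (hnot.1 hpos.le) (by linarith)
  have hle : 𝓝[J] b' ≤ 𝓝[uIcc 0 b] b' :=
    le_inf (nhdsWithin_le_nhds) (le_principal_iff.2 hnear)
  refine (h1.mono_left hle).congr' ?_
  filter_upwards [hnear, self_mem_nhdsWithin] with s hs hsJ
  exact hd.eqOn hP hcl ⟨hs, hsJ⟩

/-- A maximal lift, parametrized by the whole real line. If it converges at an end, then its
interval of definition is unbounded at that end. -/
lemma exists_maximal_lift_param [T2Space X] [T2Space Y] {P : X → Y} (hP : IsLocalHomeomorph P)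
    {σ : ℝ → Y} (hσ : Continuous σ) {x : X} (hx : P x = σ 0) :
    ∃ (J : Set ℝ) (c : ℝ → X) (θ : ℝ → ℝ), IsOpen J ∧ IsCurveLift P σ x J c ∧
      (∀ b d, IsCurveLift P σ x (uIcc 0 b) d → b ∈ J) ∧
      ContDiff ℝ 1 θ ∧ (∀ s, 0 < deriv θ s) ∧ θ 0 = 0 ∧ range θ = J ∧
      (∀ y, Tendsto (c ∘ θ) atTop (𝓝 y) → Tendsto θ atTop atTop) ∧
      ∀ y, Tendsto (c ∘ θ) atBot (𝓝 y) → Tendsto θ atBot atBot := by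
  obtain ⟨J, c, hJ, hc, hmax, huniv⟩ := exists_maximal_lift hP hσ hx
  obtain ⟨θ, hθ, hθ', hθ0, hrange⟩ := exists_interval_param hJ hc.ordConnected hc.zero_mem
  have hmono : StrictMono θ := strictMono_of_deriv_pos hθ'
  have hmem : ∀ s, θ s ∈ J := fun s => hrange ▸ mem_range_self s
  have hsurj : ∀ t ∈ J, ∃ s, θ s = t := fun t ht => by rwa [← hrange] at ht
  refine ⟨J, c, θ, hJ, hc, huniv, hθ, hθ', hθ0, hrange, ?_, ?_⟩
  · intro y hy
    by_cases hb : BddAbove J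
    · exfalso
      have hlub := isLUB_csSup ⟨0, hc.zero_mem⟩ hb
      have hnot : sSup J ∉ J := by
        intro h
        obtain ⟨s, hs⟩ := hsurj _ h
        exact absurd (hlub.1 (hmem (s + 1))) (not_le.2 (hs ▸ hmono (lt_add_one s)))
      -- A limit at a finite end of `J` would contradict the maximality of the lift.
      refine hmax _ (hlub.mem_closure ⟨0, hc.zero_mem⟩) hnot y ?_
      have hle : 𝓝[J] (sSup J) ≤ map θ atTop := by
        intro S hS
        obtain ⟨s₀, hs₀⟩ := mem_atTop_sets.1 (mem_map.1 hS)
        have hlt : θ s₀ < sSup J := lt_of_le_of_ne (hlub.1 (hmem _)) fun h => hnot (h ▸ hmem _)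
        filter_upwards [self_mem_nhdsWithin, nhdsWithin_le_nhds (Ioi_mem_nhds hlt)] with t ht htl
        obtain ⟨s, rfl⟩ := hsurj t ht
        exact hs₀ s (hmono.lt_iff_lt.1 htl).le
      exact (tendsto_map'_iff.2 hy).mono_left hle
    · refine tendsto_atTop_atTop_of_monotone hmono.monotone fun b => ?_
      obtain ⟨t, ht, hbt⟩ := not_bddAbove_iff.1 hb b
      obtain ⟨s, rfl⟩ := hsurj t ht
      exact ⟨s, hbt.le⟩
  · intro y hy
    by_cases hb : BddBelow J
    · exfalso
      have hglb := isGLB_csInf ⟨0, hc.zero_mem⟩ hb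
      have hnot : sInf J ∉ J := by
        intro h
        obtain ⟨s, hs⟩ := hsurj _ h
        exact absurd (hglb.1 (hmem (s - 1))) (not_le.2 (hs ▸ hmono (sub_one_lt s)))
      refine hmax _ (hglb.mem_closure ⟨0, hc.zero_mem⟩) hnot y ?_
      have hle : 𝓝[J] (sInf J) ≤ map θ atBot := by
        intro S hS
        obtain ⟨s₀, hs₀⟩ := mem_atBot_sets.1 (mem_map.1 hS)
        have hlt : sInf J < θ s₀ :=
          lt_of_le_of_ne (hglb.1 (hmem _)) fun h => hnot (h.symm ▸ hmem _)
        filter_upwards [self_mem_nhdsWithin, nhdsWithin_le_nhds (Iio_mem_nhds hlt)] with t ht htl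
        obtain ⟨s, rfl⟩ := hsurj t ht
        exact hs₀ s (hmono.lt_iff_lt.1 htl).le
      exact (tendsto_map'_iff.2 hy).mono_left hle
    · refine tendsto_atBot_atBot_of_monotone hmono.monotone fun b => ?_
      obtain ⟨t, ht, hbt⟩ := not_bddBelow_iff.1 hb b
      obtain ⟨s, rfl⟩ := hsurj t ht
      exact ⟨s, hbt.le⟩

/-! ### Local isometries -/

section LocalIsometries

variable {M N P : Type*} [TopologicalSpace M] [ChartedSpace E3 M]
  [TopologicalSpace N] [ChartedSpace E3 N] [TopologicalSpace P] [ChartedSpace E3 P]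
  {g : ∀ x : M, LinearMap.BilinForm ℝ (TangentSpace 𝓘(ℝ, E3) x)}
  {h : ∀ x : N, LinearMap.BilinForm ℝ (TangentSpace 𝓘(ℝ, E3) x)}
  {k : ∀ x : P, LinearMap.BilinForm ℝ (TangentSpace 𝓘(ℝ, E3) x)}

/-- All tangent spaces are the same vector space, so that metrics can be compared along an equality
of points. -/
lemma metric_congr (h : ∀ x : N, LinearMap.BilinForm ℝ (TangentSpace 𝓘(ℝ, E3) x)) {a b : N}
    (hab : a = b) (v w : E3) :
    (h a : LinearMap.BilinForm ℝ E3) v w = (h b : LinearMap.BilinForm ℝ E3) v w := by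
  rw [hab]

lemma IsLocalIsometryOn.mdifferentiableAt {f : M → N} {s : Set M} (hf : IsLocalIsometryOn g h f s)
    {x : M} (hx : x ∈ s) : MDifferentiableAt 𝓘(ℝ, E3) 𝓘(ℝ, E3) f x :=
  (hf.1 ⟨x, hx⟩).mdifferentiableAt (by simp)

lemma IsLocalIsometryOn.mono {f : M → N} {s t : Set M} (hf : IsLocalIsometryOn g h f s)
    (hts : t ⊆ s) : IsLocalIsometryOn g h f t :=
  ⟨fun x => hf.1 ⟨x, hts x.2⟩, fun x hx => hf.2 x (hts hx)⟩

lemma IsLocalIsometryOn.comp {f : M → N} {f' : N → P} {s : Set M} {t : Set N}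
    (hf' : IsLocalIsometryOn h k f' t) (hf : IsLocalIsometryOn g h f s) (hst : MapsTo f s t) :
    IsLocalIsometryOn g k (f' ∘ f) s := by
  refine ⟨fun x => (hf.1 x).comp 𝓘(ℝ, E3) P (hf'.1 ⟨f x, hst x.2⟩), fun x hx v w => ?_⟩
  rw [mfderiv_comp x (hf'.mdifferentiableAt (hst hx)) (hf.mdifferentiableAt hx)]
  exact (hf'.2 (f x) (hst hx) _ _).trans (hf.2 x hx v w)

lemma isLocalDiffeomorphAt_congr {f f' : M → N} {x : M}
    (hf : IsLocalDiffeomorphAt 𝓘(ℝ, E3) 𝓘(ℝ, E3) ∞ f x) (he : f' =ᶠ[𝓝 x] f) :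
    IsLocalDiffeomorphAt 𝓘(ℝ, E3) 𝓘(ℝ, E3) ∞ f' x := by
  obtain ⟨Φ, hx, hΦ⟩ := hf
  obtain ⟨V, hV, hVo, hxV⟩ := mem_nhds_iff.1 he
  let e := Φ.toOpenPartialHomeomorph.restrOpen V hVo
  refine ⟨{ toPartialEquiv := e.toPartialEquiv
            open_source := e.open_source
            open_target := e.open_target
            contMDiffOn_toFun := Φ.contMDiffOn_toFun.mono inter_subset_left
            contMDiffOn_invFun := Φ.contMDiffOn_invFun.mono inter_subset_left }, ⟨hx, hxV⟩, ?_⟩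
  intro y hy
  exact (hV hy.2).trans (hΦ hy.1)

lemma IsLocalIsometryOn.congr {f f' : M → N} {s : Set M} (hf : IsLocalIsometryOn g h f s)
    (he : ∀ x ∈ s, f' =ᶠ[𝓝 x] f) : IsLocalIsometryOn g h f' s := by
  refine ⟨fun x => isLocalDiffeomorphAt_congr (hf.1 x) (he x x.2), fun x hx v w => ?_⟩
  rw [← hf.2 x hx v w, (he x hx).mfderiv_eq]
  exact metric_congr h (he x hx).self_of_nhds _ _

/-- Being a local isometry is a local property. -/
lemma isLocalIsometryOn_of_local {f : M → N} {s : Set M}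
    (hf : ∀ x ∈ s, ∃ (t : Set M) (f' : M → N), x ∈ t ∧ IsLocalIsometryOn g h f' t ∧
      f =ᶠ[𝓝 x] f') : IsLocalIsometryOn g h f s := by
  have H : ∀ x ∈ s, IsLocalIsometryOn g h f {x} := by
    intro x hx
    obtain ⟨t, f', hxt, hf', he⟩ := hf x hx
    refine (hf'.mono (singleton_subset_iff.2 hxt)).congr ?_
    rintro y rfl
    exact he
  exact ⟨fun x => (H x x.2).1 ⟨x, rfl⟩, fun x hx => (H x hx).2 x rfl⟩

/-- The differential of a map between manifolds modeled on `E3`, as an endomorphism of `E3`: all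
tangent spaces are the model space. -/
def mder (f : M → N) (x : M) : E3 →L[ℝ] E3 := mfderiv 𝓘(ℝ, E3) 𝓘(ℝ, E3) f x

lemma mder_congr {f f' : M → N} {x : M} (h : f =ᶠ[𝓝 x] f') : mder f x = mder f' x :=
  h.mfderiv_eq

lemma mder_comp {f : M → N} {f' : N → P} {x : M}
    (hf' : MDifferentiableAt 𝓘(ℝ, E3) 𝓘(ℝ, E3) f' (f x))
    (hf : MDifferentiableAt 𝓘(ℝ, E3) 𝓘(ℝ, E3) f x) (v : E3) :
    mder (f' ∘ f) x v = mder f' (f x) (mder f x v) :=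
  congrArg (fun L : E3 →L[ℝ] E3 => L v) (mfderiv_comp x hf' hf)

lemma mder_id (x : M) (v : E3) : mder (id : M → M) x v = v :=
  congrArg (fun L : E3 →L[ℝ] E3 => L v) (mfderiv_id (I := 𝓘(ℝ, E3)) (x := x))

/-- A local isometry has local inverses, which are local isometries. -/
lemma IsLocalIsometryOn.exists_inverse {f : M → N} {s : Set M} (hf : IsLocalIsometryOn g h f s)
    (hs : IsOpen s) {x : M} (hx : x ∈ s) :
    ∃ Φ : OpenPartialHomeomorph M N, x ∈ Φ.source ∧ Φ.source ⊆ s ∧ EqOn f Φ Φ.source ∧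
      IsLocalIsometryOn g h Φ Φ.source ∧ IsLocalIsometryOn h g Φ.symm Φ.target := by
  obtain ⟨Ψ, hxΨ, hΨ⟩ := hf.1 ⟨x, hx⟩
  let e := Ψ.toOpenPartialHomeomorph.restrOpen s hs
  let Ψ' : PartialDiffeomorph 𝓘(ℝ, E3) 𝓘(ℝ, E3) M N ∞ :=
    { toPartialEquiv := e.toPartialEquiv
      open_source := e.open_source
      open_target := e.open_target
      contMDiffOn_toFun := Ψ.contMDiffOn_toFun.mono inter_subset_left
      contMDiffOn_invFun := Ψ.contMDiffOn_invFun.mono inter_subset_left }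
  have hsub : e.source ⊆ s := inter_subset_right
  have heq : EqOn f e e.source := fun y hy => hΨ hy.1
  have hiso : IsLocalIsometryOn g h e e.source :=
    (hf.mono hsub).congr fun y hy => (heq.symm.eventuallyEq_of_mem (e.open_source.mem_nhds hy))
  refine ⟨e, ⟨hxΨ, hx⟩, hsub, heq, hiso, ?_, ?_⟩
  · intro z
    refine ⟨{ toPartialEquiv := e.symm.toPartialEquiv
              open_source := e.open_target
              open_target := e.open_source
              contMDiffOn_toFun := Ψ'.contMDiffOn_invFun
              contMDiffOn_invFun := Ψ'.contMDiffOn_toFun }, z.2, fun y _ => rfl⟩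
  · intro z hz v w
    have hy : e.symm z ∈ e.source := e.map_target hz
    have hd1 : MDifferentiableAt 𝓘(ℝ, E3) 𝓘(ℝ, E3) e.symm z :=
      (Ψ'.contMDiffOn_invFun.contMDiffAt (e.open_target.mem_nhds hz)).mdifferentiableAt (by simp)
    have hd2 := hiso.mdifferentiableAt hy
    have hid : (e ∘ e.symm) =ᶠ[𝓝 z] id := by
      filter_upwards [e.open_target.mem_nhds hz] with y hy using e.right_inv hy
    have hcomp := mfderiv_comp z hd2 hd1
    rw [hid.mfderiv_eq, mfderiv_id] at hcomp
    have hv : ∀ v : E3, (mfderiv 𝓘(ℝ, E3) 𝓘(ℝ, E3) e (e.symm z)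
        (mfderiv 𝓘(ℝ, E3) 𝓘(ℝ, E3) e.symm z v) : E3) = v := fun v =>
      (congrArg (fun L : E3 →L[ℝ] E3 => L v) hcomp).symm
    have h1 := hiso.2 (e.symm z) hy (mfderiv 𝓘(ℝ, E3) 𝓘(ℝ, E3) e.symm z v)
      (mfderiv 𝓘(ℝ, E3) 𝓘(ℝ, E3) e.symm z w)
    rw [← h1]
    have h2 := metric_congr h (e.right_inv hz) v w
    rw [← h2]
    exact congrArg₂ (fun a b : E3 => (h (e (e.symm z)) : LinearMap.BilinForm ℝ E3) a b)
      (hv v) (hv w)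

end LocalIsometries

lemma mder_eq_fderiv (f : E3 → E3) (x : E3) : mder f x = fderiv ℝ f x :=
  mfderiv_eq_fderiv

/-- The metric of a spacetime, as a function on pairs of vectors of the model space. -/
def form (M : AdSSpacetime.{u}) (x : M) (v w : E3) : ℝ := M.metric x v w

/-- The time-orientation of a spacetime, with values in the model space. -/
def timeVec (M : AdSSpacetime.{u}) (x : M) : E3 := M.time x

lemma form_time (M : AdSSpacetime.{u}) (x : M) : form M x (timeVec M x) (timeVec M x) < 0 :=
  M.time_timelike x

lemma adsForm_mder {M : AdSSpacetime.{u}} {φ : M → E3} {U : Set M}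
    (hφ : IsLocalIsometryOn M.metric modelMetric φ U) {x : M} (hx : x ∈ U) (v w : E3) :
    adsForm (φ x) (mder φ x v) (mder φ x w) = form M x v w := by
  have := hφ.2 x hx v w
  rw [modelMetric_apply] at this
  exact this

lemma form_mder {M : AdSSpacetime.{u}} {ψ : E3 → M} {U : Set E3}
    (hψ : IsLocalIsometryOn modelMetric M.metric ψ U) {x : E3} (hx : x ∈ U) (v w : E3) :
    form M (ψ x) (mder ψ x v) (mder ψ x w) = adsForm x v w :=
  (hψ.2 x hx v w).trans (modelMetric_apply x v w)

/-! ### Spaces developed over a spacetime -/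

/-- `X` is a space over the spacetime `M`, through the local homeomorphism `p`, with a developing
map `D`: locally, `D` is the composition of `p` with a local isometry of `M`. No smooth structure on
`X` is needed. -/
structure IsDeveloped (M : AdSSpacetime.{u}) {X : Type*} [TopologicalSpace X] (p : X → M)
    (D : X → E3) : Prop where
  localHomeomorph : IsLocalHomeomorph p
  chart : ∀ x, ∃ (U : Set M) (φ : M → E3), IsOpen U ∧ p x ∈ U ∧
    IsLocalIsometryOn M.metric modelMetric φ U ∧ ∀ᶠ y in 𝓝 x, D y = φ (p y)

section

variable {M : AdSSpacetime.{u}} {X : Type*} [TopologicalSpace X] {p : X → M} {D : X → E3}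

/-- The developing map is a local homeomorphism, through which `p` is locally the composition of
`D` with a local isometry to `M`. -/
lemma IsDeveloped.exists_local_model (hD : IsDeveloped M p D) (x : X) :
    ∃ (e : OpenPartialHomeomorph X E3) (ψ : E3 → M), x ∈ e.source ∧ EqOn D e e.source ∧
      IsLocalIsometryOn modelMetric M.metric ψ e.target ∧ ∀ y ∈ e.source, p y = ψ (D y) := by
  obtain ⟨U, φ, hU, hxU, hφ, hev⟩ := hD.chart x
  obtain ⟨Φ, hxΦ, -, hφΦ, -, hΦ⟩ := hφ.exists_inverse hU hxU
  obtain ⟨V, hV, hVo, hxV⟩ := mem_nhds_iff.1 hev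
  obtain ⟨k, hxk, rfl⟩ := hD.localHomeomorph x
  let e := (k.restrOpen V hVo).trans Φ
  have hs : ∀ y ∈ e.source, y ∈ k.source ∧ y ∈ V ∧ k y ∈ Φ.source := by
    intro y hy
    rw [OpenPartialHomeomorph.trans_source] at hy
    exact ⟨hy.1.1, hy.1.2, hy.2⟩
  have heq : EqOn D e e.source := by
    intro y hy
    obtain ⟨-, h2, h3⟩ := hs y hy
    exact (hV h2).trans (hφΦ h3)
  refine ⟨e, Φ.symm, ?_, heq, hΦ.mono ?_, ?_⟩
  · rw [OpenPartialHomeomorph.trans_source]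
    exact ⟨⟨hxk, hxV⟩, hxΦ⟩
  · intro z hz
    rw [OpenPartialHomeomorph.trans_target] at hz
    exact hz.1
  · intro y hy
    obtain ⟨-, -, h3⟩ := hs y hy
    rw [heq hy]
    exact (Φ.left_inv h3).symm

lemma IsDeveloped.isLocalHomeomorph (hD : IsDeveloped M p D) : IsLocalHomeomorph D := by
  rw [isLocalHomeomorph_iff_isLocalHomeomorphOn_univ]
  refine IsLocalHomeomorphOn.mk D univ fun x _ => ?_
  obtain ⟨e, ψ, hx, he, -⟩ := hD.exists_local_model x
  exact ⟨e, hx, he⟩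

lemma eventuallyEq_of_comp_eventuallyEq {φ φ' : M → E3} (hp : IsOpenMap p) {x : X}
    (h : ∀ᶠ y in 𝓝 x, φ (p y) = φ' (p y)) : φ =ᶠ[𝓝 (p x)] φ' := by
  have := hp.image_mem_nhds h
  filter_upwards [this]
  rintro _ ⟨y, hy, rfl⟩
  exact hy

/-- `T` is the time coordinate of the image of the time-orientation by the developing map. -/
def IsTimeCoordinate (M : AdSSpacetime.{u}) (p : X → M) (D : X → E3) (T : X → ℝ) : Prop :=
  ∀ x (U : Set M) (φ : M → E3), IsOpen U → p x ∈ U →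
    IsLocalIsometryOn M.metric modelMetric φ U → (∀ᶠ y in 𝓝 x, D y = φ (p y)) →
    T x = mder φ (p x) (timeVec M (p x)) 2

lemma time_ne_zero_of_isometry {φ : M → E3} {U : Set M}
    (hφ : IsLocalIsometryOn M.metric modelMetric φ U) {x : M} (hx : x ∈ U) :
    mder φ x (timeVec M x) 2 ≠ 0 := by
  have h3 := form_time M x
  rw [← adsForm_mder hφ hx] at h3
  refine time_ne_zero_of_causal h3.le fun h0 => ?_
  rw [h0] at h3
  simp [adsForm, spaceForm] at h3

lemma continuousOn_mder_time {φ : M → E3} {U : Set M} (hU : IsOpen U)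
    (hφ : IsLocalIsometryOn M.metric modelMetric φ U) :
    ContinuousOn (fun z => mder φ z (timeVec M z) 2) U := by
  have h1 : ContinuousOn (tangentMapWithin 𝓘(ℝ, E3) 𝓘(ℝ, E3) φ U)
      (Bundle.TotalSpace.proj ⁻¹' U) :=
    hφ.1.contMDiffOn.continuousOn_tangentMapWithin (by simp) hU.uniqueMDiffOn
  have h2 : ContinuousOn (fun z => tangentMapWithin 𝓘(ℝ, E3) 𝓘(ℝ, E3) φ U ⟨z, M.time z⟩) U :=
    h1.comp M.time_continuous.continuousOn fun z hz => hz
  have h3 : Continuous fun a : TangentBundle 𝓘(ℝ, E3) E3 => (show E3 from a.2).ofLp 2 :=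
    (by fun_prop : Continuous fun v : E3 => v 2).comp
      (continuous_snd.comp (tangentBundleModelSpaceHomeomorph 𝓘(ℝ, E3)).continuous)
  refine (h3.comp_continuousOn h2).congr fun z hz => ?_
  have h4 : mder φ z = mfderivWithin 𝓘(ℝ, E3) 𝓘(ℝ, E3) φ U z :=
    (mfderivWithin_of_isOpen hU hz).symm
  rw [h4]
  rfl

/-- The time coordinate of the image of the time-orientation by the developing map is a continuous
function without zeros. -/
lemma IsDeveloped.exists_time (hD : IsDeveloped M p D) :
    ∃ T : X → ℝ, Continuous T ∧ (∀ x, T x ≠ 0) ∧ IsTimeCoordinate M p D T := by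
  choose U φ hU hxU hφ hev using hD.chart
  have huniq : IsTimeCoordinate M p D fun x => mder (φ x) (p x) (timeVec M (p x)) 2 := by
    intro x U' φ' _ _ _ hev'
    have : φ x =ᶠ[𝓝 (p x)] φ' := by
      refine eventuallyEq_of_comp_eventuallyEq hD.localHomeomorph.isOpenMap ?_
      filter_upwards [hev x, hev'] with y h1 h2
      rw [← h1, ← h2]
    change mder (φ x) (p x) (timeVec M (p x)) 2 = _
    rw [mder_congr this]
  refine ⟨_, ?_, fun x => time_ne_zero_of_isometry (hφ x) (hxU x), huniq⟩
  rw [continuous_iff_continuousAt]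
  intro x
  have hloc : ∀ᶠ y in 𝓝 x, mder (φ y) (p y) (timeVec M (p y)) 2 =
      mder (φ x) (p y) (timeVec M (p y)) 2 := by
    filter_upwards [(hev x).eventually_nhds,
      hD.localHomeomorph.continuous.continuousAt ((hU x).mem_nhds (hxU x))] with y hy hyU
    exact huniq y (U x) (φ x) (hU x) hyU (hφ x) hy
  exact (((continuousOn_mder_time (hU x) (hφ x)).continuousAt ((hU x).mem_nhds (hxU x))).comp
    hD.localHomeomorph.continuous.continuousAt).congr
    (by filter_upwards [hloc] with y hy using hy.symm)

/-- Curves of `X` are as smooth in `M` as their developments, and their velocity has the same length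
and, up to a sign given by the time-orientation, the same direction in time. -/
lemma IsDeveloped.curve (hD : IsDeveloped M p D) {c : ℝ → X} {s : ℝ} (hc : ContinuousAt c s)
    (hDc : ContDiffAt ℝ 1 (D ∘ c) s) :
    ContMDiffAt 𝓘(ℝ, ℝ) 𝓘(ℝ, E3) 1 (p ∘ c) s ∧
    M.metric (p (c s)) (M.velocity (p ∘ c) s) (M.velocity (p ∘ c) s) =
      adsForm (D (c s)) (deriv (D ∘ c) s) (deriv (D ∘ c) s) ∧
    ∀ T : X → ℝ, IsTimeCoordinate M p D T →
      adsForm (D (c s)) (deriv (D ∘ c) s) (deriv (D ∘ c) s) ≤ 0 → deriv (D ∘ c) s ≠ 0 →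
      0 < T (c s) * deriv (D ∘ c) s 2 → M.FutureCausal (M.velocity (p ∘ c) s) := by
  obtain ⟨U, φ, hU, hxU, hφ, hev⟩ := hD.chart (c s)
  obtain ⟨Φ, hxΦ, hΦU, hφΦ, -, hΦ⟩ := hφ.exists_inverse hU hxU
  have hpc : ContinuousAt (p ∘ c) s := hD.localHomeomorph.continuous.continuousAt.comp hc
  have hev' : ∀ᶠ r in 𝓝 s, D (c r) = φ (p (c r)) := hc.eventually hev
  have hsrc : ∀ᶠ r in 𝓝 s, p (c r) ∈ Φ.source := hpc (Φ.open_source.mem_nhds hxΦ)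
  have hDs : D (c s) = φ (p (c s)) := hev'.self_of_nhds
  have hDΦ : D (c s) = Φ (p (c s)) := hDs.trans (hφΦ hxΦ)
  have hcm : ContMDiffAt 𝓘(ℝ, ℝ) 𝓘(ℝ, E3) 1 (p ∘ c) s := by
    have h1 : ContMDiffAt 𝓘(ℝ, E3) 𝓘(ℝ, E3) 1 Φ.symm ((D ∘ c) s) := by
      refine (hΦ.1.contMDiffOn.contMDiffAt (Φ.open_target.mem_nhds ?_)).of_le (by simp)
      rw [Function.comp_apply, hDΦ]
      exact Φ.map_source hxΦ
    refine (h1.comp s hDc.contMDiffAt).congr_of_eventuallyEq ?_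
    filter_upwards [hev', hsrc] with r h2 h3
    rw [Function.comp_apply, Function.comp_apply, Function.comp_apply, h2, hφΦ h3, Φ.left_inv h3]
  set vel : E3 := M.velocity (p ∘ c) s with hveldef
  have hvel : mder φ (p (c s)) vel = deriv (D ∘ c) s := by
    have h1 : (D ∘ c) =ᶠ[𝓝 s] (φ ∘ (p ∘ c)) := hev'
    have h2 := mfderiv_comp s (hφ.mdifferentiableAt hxU) (hcm.mdifferentiableAt (by simp))
    rw [← fderiv_apply_one_eq_deriv, ← mfderiv_eq_fderiv, h1.mfderiv_eq, h2]
    rfl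
  have h1 : form M (p (c s)) vel vel =
      adsForm (D (c s)) (deriv (D ∘ c) s) (deriv (D ∘ c) s) := by
    rw [← adsForm_mder hφ hxU, hvel, hDs]
  refine ⟨hcm, h1, ?_⟩
  intro T hT hcaus hne hpos
  have h2 : form M (p (c s)) vel (timeVec M (p (c s))) =
      adsForm (D (c s)) (deriv (D ∘ c) s) (mder φ (p (c s)) (timeVec M (p (c s)))) := by
    rw [← adsForm_mder hφ hxU, hvel, hDs]
  have h4 : adsForm (D (c s)) (mder φ (p (c s)) (timeVec M (p (c s))))
      (mder φ (p (c s)) (timeVec M (p (c s)))) < 0 := by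
    rw [hDs, adsForm_mder hφ hxU]
    exact form_time M _
  have h5 := adsForm_mul_time_neg hcaus hne h4
  rw [hT (c s) U φ hU hxU hφ hev, mul_comm] at hpos
  have h6 : form M (p (c s)) vel (timeVec M (p (c s))) < 0 := by
    rw [h2]
    by_contra h6
    push Not at h6
    exact absurd h5 (not_lt.2 (mul_nonneg h6 hpos.le))
  exact ⟨h1.trans_le hcaus, h6⟩

/-- A curve converges upstairs in a covering as soon as it converges downstairs. -/
lemma exists_tendsto_of_covering {X B : Type*} [TopologicalSpace X] [TopologicalSpace B]
    {p : X → B} (hp : IsCoveringMap p) {c : ℝ → X} {l : Filter ℝ} [l.NeBot]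
    (hl : ∀ S ∈ l, ∃ T ∈ l, T ⊆ S ∧ IsPreconnected T ∧ ContinuousOn c T) {y : B}
    (hy : Tendsto (p ∘ c) l (𝓝 y)) : ∃ x, p x = y ∧ Tendsto c l (𝓝 x) := by
  -- The fiber over `y` is not empty, because the sheets near `y` are not.
  obtain ⟨hdisc, U, hyU, hU, hpU, H, hH⟩ := hp y
  obtain ⟨T, hTl, hTU, hTc, hcT⟩ := hl _ (hy (hU.mem_nhds hyU))
  obtain ⟨s₀, hs₀⟩ := l.nonempty_of_mem hTl
  have hne : Nonempty (p ⁻¹' {y}) := ⟨(H ⟨c s₀, hTU hs₀⟩).2⟩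
  let t := (hp y).toTrivialization
  have hyt : y ∈ t.baseSet := (hp y).mem_toTrivialization_baseSet
  obtain ⟨T, hTl, hTU, hTc, hcT⟩ := hl _ (hy (t.open_baseSet.mem_nhds hyt))
  obtain ⟨s₀, hs₀⟩ := l.nonempty_of_mem hTl
  have hsrc : ∀ s ∈ T, c s ∈ t.source := fun s hs => t.mem_source.2 (hTU hs)
  -- On a connected set of parameters the curve stays in one sheet.
  have hconst : ∀ s ∈ T, (t (c s)).2 = (t (c s₀)).2 := fun s hs =>
    hTc.constant (f := fun s => (t (c s)).2)
      (continuous_snd.comp_continuousOn (t.continuousOn_toFun.comp hcT hsrc)) hs hs₀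
  set i := (t (c s₀)).2
  have htar : (y, i) ∈ t.target := t.mem_target.2 hyt
  refine ⟨t.toOpenPartialHomeomorph.symm (y, i), t.proj_symm_apply htar, ?_⟩
  have h1 : Tendsto (fun s => t.toOpenPartialHomeomorph.symm (p (c s), i)) l
      (𝓝 (t.toOpenPartialHomeomorph.symm (y, i))) :=
    (t.toOpenPartialHomeomorph.continuousAt_symm htar).tendsto.comp
      (hy.prodMk_nhds tendsto_const_nhds)
  refine h1.congr' ?_
  filter_upwards [hTl] with s hs
  have h2 : (p (c s), (t (c s)).2) = t (c s) := t.mk_proj_snd (hsrc s hs)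
  rw [← hconst s hs, h2]
  exact t.toOpenPartialHomeomorph.left_inv (hsrc s hs)

lemma exists_sign {A : Type*} [TopologicalSpace A] [PreconnectedSpace A] {f : A → ℝ}
    (hf : Continuous f) (h0 : ∀ a, f a ≠ 0) : (∀ a, 0 < f a) ∨ ∀ a, f a < 0 := by
  by_contra! h
  obtain ⟨⟨a, ha⟩, b, hb⟩ := h
  obtain ⟨c, hc⟩ := mem_range_of_exists_le_of_exists_ge hf ⟨a, ha⟩ ⟨b, hb⟩
  exact h0 c hc

/-- An inextendible causal curve of the universal anti-de Sitter space, with no orientation. -/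
structure IsUnorientedCausal (σ : ℝ → E3) : Prop where
  contDiff : ContDiff ℝ 1 σ
  causal : ∀ s, adsForm (σ s) (deriv σ s) (deriv σ s) ≤ 0
  deriv_ne : ∀ s, deriv σ s ≠ 0
  atTop : ∀ y, ¬ Tendsto σ atTop (𝓝 y)
  atBot : ∀ y, ¬ Tendsto σ atBot (𝓝 y)

lemma adsForm_smul_self (x v : E3) (a : ℝ) : adsForm x (a • v) (a • v) = a ^ 2 * adsForm x v v := by
  rw [adsForm_smul_left, adsForm_comm, adsForm_smul_left]; ring

/-- A curve of `X` with a causal development and without end points in `M` meets exactly once the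
preimage of a Cauchy surface: it is inextendible in `M`, up to a change of orientation. -/
lemma IsDeveloped.existsUnique_mem (hD : IsDeveloped M p D) {T : X → ℝ} (hTc : Continuous T)
    (hT0 : ∀ x, T x ≠ 0) (hT : IsTimeCoordinate M p D T) {S : Set M} (hS : M.IsCauchySurface S)
    {c : ℝ → X} (hc : Continuous c) (hDc : ContDiff ℝ 1 (D ∘ c))
    (hcaus : ∀ s, adsForm (D (c s)) (deriv (D ∘ c) s) (deriv (D ∘ c) s) ≤ 0)
    (hne : ∀ s, deriv (D ∘ c) s ≠ 0) (htop : ¬ ∃ y, Tendsto (p ∘ c) atTop (𝓝 y))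
    (hbot : ¬ ∃ y, Tendsto (p ∘ c) atBot (𝓝 y)) : ∃! s, p (c s) ∈ S := by
  have hd1 : Continuous (deriv (D ∘ c)) := (contDiff_one_iff_deriv.1 hDc).2
  have hfc : Continuous fun s => T (c s) * deriv (D ∘ c) s 2 :=
    (hTc.comp hc).mul ((by fun_prop : Continuous fun v : E3 => v 2).comp hd1)
  -- A curve with the opposite time-orientation is reversed.
  rcases exists_sign hfc (fun s => mul_ne_zero (hT0 _)
    (time_ne_zero_of_causal (hcaus s) (hne s))) with hpos | hneg
  · refine hS.2 (p ∘ c) ⟨fun s => (hD.curve hc.continuousAt hDc.contDiffAt).1, fun s => ?_,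
      htop, hbot⟩
    exact (hD.curve hc.continuousAt hDc.contDiffAt).2.2 T hT (hcaus s) (hne s) (hpos s)
  · set k : ℝ → X := fun s => c (-s) with hk
    have hkc : Continuous k := hc.comp continuous_neg
    have hDk : D ∘ k = fun s => (D ∘ c) (-s) := rfl
    have hkd : ContDiff ℝ 1 (D ∘ k) := hDc.comp contDiff_neg
    have hderiv : ∀ s, deriv (D ∘ k) s = (-1 : ℝ) • deriv (D ∘ c) (-s) := by
      intro s
      rw [hDk, deriv_comp_neg, neg_one_smul]
    have hkcaus : ∀ s, adsForm (D (k s)) (deriv (D ∘ k) s) (deriv (D ∘ k) s) ≤ 0 := by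
      intro s
      rw [hderiv, adsForm_smul_self]
      simpa using hcaus (-s)
    have huniq : ∃! s, p (k s) ∈ S := by
      refine hS.2 (p ∘ k) ⟨fun s => (hD.curve hkc.continuousAt hkd.contDiffAt).1, fun s => ?_,
        ?_, ?_⟩
      · refine (hD.curve hkc.continuousAt hkd.contDiffAt).2.2 T hT (hkcaus s) ?_ ?_
        · rw [hderiv]
          simpa using hne (-s)
        · rw [hderiv]
          have := hneg (-s)
          simp only [PiLp.smul_apply, smul_eq_mul, hk]
          linarith
      · rintro ⟨y, hy⟩
        refine hbot ⟨y, ?_⟩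
        have := hy.comp tendsto_neg_atBot_atTop
        refine this.congr fun s => ?_
        simp [hk]
      · rintro ⟨y, hy⟩
        refine htop ⟨y, ?_⟩
        have := hy.comp tendsto_neg_atTop_atBot
        refine this.congr fun s => ?_
        simp [hk]
    obtain ⟨s, hs, hs'⟩ := huniq
    refine ⟨-s, hs, fun r hr => ?_⟩
    have : p (k (-r)) ∈ S := by simpa [hk] using hr
    rw [← hs' _ this, neg_neg]

/-- An increasing bijection between `ℝ` and an interval that is unbounded above identifies their
upper ends, so that limits along `θ` are limits. -/
lemma map_atTop_of_interval {θ : ℝ → ℝ} (hθ : StrictMono θ) (hJ : (range θ).OrdConnected)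
    (h : Tendsto θ atTop atTop) : atTop ≤ map θ atTop := by
  intro S hS
  obtain ⟨s₀, hs₀⟩ := mem_atTop_sets.1 (mem_map.1 hS)
  filter_upwards [eventually_ge_atTop (θ s₀)] with t ht
  obtain ⟨s₁, hs₁⟩ := (h.eventually_ge_atTop t).exists
  obtain ⟨s, rfl⟩ := hJ.out (mem_range_self s₀) (mem_range_self s₁) ⟨ht, hs₁⟩
  exact hs₀ s (hθ.le_iff_le.1 ht)

lemma map_atBot_of_interval {θ : ℝ → ℝ} (hθ : StrictMono θ) (hJ : (range θ).OrdConnected)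
    (h : Tendsto θ atBot atBot) : atBot ≤ map θ atBot := by
  intro S hS
  obtain ⟨s₀, hs₀⟩ := mem_atBot_sets.1 (mem_map.1 hS)
  filter_upwards [eventually_le_atBot (θ s₀)] with t ht
  obtain ⟨s₁, hs₁⟩ := (h.eventually_le_atBot t).exists
  obtain ⟨s, rfl⟩ := hJ.out (mem_range_self s₁) (mem_range_self s₀) ⟨hs₁, ht⟩
  exact hs₀ s (hθ.le_iff_le.1 ht)

/-- The maximal lift of an inextendible causal curve of the anti-de Sitter space meets exactly once
the preimage of a Cauchy surface. -/
lemma IsDeveloped.exists_lift_existsUnique_mem [T2Space X] (hD : IsDeveloped M p D)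
    (hp : IsCoveringMap p) {S : Set M} (hS : M.IsCauchySurface S)
    {σ : ℝ → E3} (hσ : IsUnorientedCausal σ) {x : X} (hx : D x = σ 0) :
    ∃ (J : Set ℝ) (c : ℝ → X), IsOpen J ∧ IsCurveLift D σ x J c ∧
      (∀ b d, IsCurveLift D σ x (uIcc 0 b) d → b ∈ J) ∧ ∃! s, s ∈ J ∧ p (c s) ∈ S := by
  obtain ⟨J, c, θ, hJ, hc, hmax, hθ, hθ', hθ0, hrange, htop, hbot⟩ :=
    exists_maximal_lift_param hD.isLocalHomeomorph hσ.contDiff.continuous hx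
  refine ⟨J, c, hJ, hc, hmax, ?_⟩
  obtain ⟨T, hTc, hT0, hT⟩ := hD.exists_time
  have hmem : ∀ s, θ s ∈ J := fun s => hrange ▸ mem_range_self s
  have hmono : StrictMono θ := strictMono_of_deriv_pos hθ'
  have hDc : D ∘ (c ∘ θ) = σ ∘ θ := funext fun s => hc.lift _ (hmem s)
  have hcc : Continuous (c ∘ θ) := by
    rw [← continuousOn_univ]
    exact hc.continuousOn.comp hθ.continuous.continuousOn fun s _ => hmem s
  have hord : (range θ).OrdConnected := hrange ▸ hc.ordConnected
  -- An end point in `M` lifts to an end point in `X`. By maximality of the lift its interval is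
  -- then unbounded, so that `σ` itself has an end point.
  have hnotop : ¬ ∃ y, Tendsto (p ∘ (c ∘ θ)) atTop (𝓝 y) := by
    rintro ⟨y, hy⟩
    obtain ⟨z, -, hz⟩ := exists_tendsto_of_covering hp (fun S hS => by
      obtain ⟨a, ha⟩ := mem_atTop_sets.1 hS
      exact ⟨Ici a, Ici_mem_atTop a, fun b hb => ha b hb, isPreconnected_Ici,
        hcc.continuousOn⟩) hy
    have h1 : Tendsto (σ ∘ θ) atTop (𝓝 (D z)) :=
      hDc ▸ (hD.isLocalHomeomorph.continuous.tendsto z).comp hz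
    exact hσ.atTop (D z)
      ((tendsto_map'_iff.2 h1).mono_left (map_atTop_of_interval hmono hord (htop z hz)))
  have hnobot : ¬ ∃ y, Tendsto (p ∘ (c ∘ θ)) atBot (𝓝 y) := by
    rintro ⟨y, hy⟩
    obtain ⟨z, -, hz⟩ := exists_tendsto_of_covering hp (fun S hS => by
      obtain ⟨a, ha⟩ := mem_atBot_sets.1 hS
      exact ⟨Iic a, Iic_mem_atBot a, fun b hb => ha b hb, isPreconnected_Iic,
        hcc.continuousOn⟩) hy
    have h1 : Tendsto (σ ∘ θ) atBot (𝓝 (D z)) :=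
      hDc ▸ (hD.isLocalHomeomorph.continuous.tendsto z).comp hz
    exact hσ.atBot (D z)
      ((tendsto_map'_iff.2 h1).mono_left (map_atBot_of_interval hmono hord (hbot z hz)))
  have hderiv : ∀ s, deriv (σ ∘ θ) s = deriv θ s • deriv σ (θ s) := fun s =>
    deriv.scomp s (hσ.contDiff.contDiffAt.differentiableAt (by simp))
      (hθ.contDiffAt.differentiableAt (by simp))
  obtain ⟨s, hs, hs'⟩ := hD.existsUnique_mem hTc hT0 hT hS hcc
    (hDc ▸ hσ.contDiff.comp hθ) (fun s => by
      rw [hDc, hderiv, adsForm_smul_self, show D ((c ∘ θ) s) = σ (θ s) from hc.lift _ (hmem s)]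
      exact mul_nonpos_of_nonneg_of_nonpos (sq_nonneg _) (hσ.causal _))
    (fun s => by
      rw [hDc, hderiv]
      exact smul_ne_zero (hθ' s).ne' (hσ.deriv_ne _)) hnotop hnobot
  refine ⟨θ s, ⟨hmem s, hs⟩, ?_⟩
  rintro t ⟨ht, htS⟩
  rw [← hrange] at ht
  obtain ⟨r, rfl⟩ := ht
  rw [hs' r htS]

end

/-! ### Spacelike surfaces are local graphs -/

/-- The point of the universal anti-de Sitter space above `a`, at time `t`. -/
def pt (a : ℝ × ℝ) (t : ℝ) : E3 := !₂[a.1, a.2, t]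

/-- The projection to the `(x₁, x₂)`-plane. -/
def proj (x : E3) : ℝ × ℝ := (x 0, x 1)

@[simp] lemma pt_zero (a : ℝ × ℝ) (t : ℝ) : pt a t 0 = a.1 := rfl
@[simp] lemma pt_one (a : ℝ × ℝ) (t : ℝ) : pt a t 1 = a.2 := rfl
@[simp] lemma pt_two (a : ℝ × ℝ) (t : ℝ) : pt a t 2 = t := rfl
@[simp] lemma proj_pt (a : ℝ × ℝ) (t : ℝ) : proj (pt a t) = a := rfl

@[simp] lemma pt_proj (x : E3) : pt (proj x) (x 2) = x := by
  ext i
  fin_cases i <;> rfl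

/-- The linear isomorphism between `ℝ² × ℝ` and `ℝ³`. -/
def ptL : ((ℝ × ℝ) × ℝ) →L[ℝ] E3 :=
  LinearMap.toContinuousLinearMap
    { toFun := fun z => pt z.1 z.2
      map_add' := fun z w => by ext i; fin_cases i <;> simp [pt]
      map_smul' := fun c z => by ext i; fin_cases i <;> simp [pt] }

lemma ptL_apply (z : (ℝ × ℝ) × ℝ) : ptL z = pt z.1 z.2 := rfl

lemma contDiff_pt {n : WithTop ℕ∞} : ContDiff ℝ n fun z : (ℝ × ℝ) × ℝ => pt z.1 z.2 :=
  ptL.contDiff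

lemma continuous_pt : Continuous fun z : (ℝ × ℝ) × ℝ => pt z.1 z.2 := ptL.continuous

lemma continuous_proj : Continuous proj := by
  unfold proj; fun_prop

/-- A function of class `C¹` on an open set of the plane, whose graph is spacelike. -/
structure IsSpacelikeGraphOn (f : ℝ × ℝ → ℝ) (B : Set (ℝ × ℝ)) : Prop where
  contDiffOn : ContDiffOn ℝ 1 f B
  pos : ∀ a ∈ B, ∀ q : ℝ × ℝ, q ≠ 0 →
    0 < adsForm (pt a (f a)) (pt q (fderiv ℝ f a q)) (pt q (fderiv ℝ f a q))

lemma hasFDerivAt_graph {f : ℝ × ℝ → ℝ} {a : ℝ × ℝ} (hf : DifferentiableAt ℝ f a) :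
    HasFDerivAt (fun b => pt b (f b))
      (ptL.comp ((ContinuousLinearMap.id ℝ (ℝ × ℝ)).prod (fderiv ℝ f a))) a :=
  ptL.hasFDerivAt.comp a ((hasFDerivAt_id a).prodMk hf.hasFDerivAt)

/-- A regular level set with spacelike tangent planes is locally the graph of a function of
`(x₁, x₂)`, because its tangent planes do not contain the direction of time. -/
lemma exists_local_graph {H : E3 → ℝ} {V : Set E3} (hV : IsOpen V) (hH : ContDiffOn ℝ 1 H V)
    {z : E3} (hz : z ∈ V) (hz0 : H z = 0)
    (hpos : ∀ y ∈ V, H y = 0 → ∀ v : E3, v ≠ 0 → fderiv ℝ H y v = 0 → 0 < adsForm y v v) :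
    ∃ (B : Set (ℝ × ℝ)) (g : ℝ × ℝ → ℝ) (W : Set E3), IsOpen B ∧ IsConnected B ∧ proj z ∈ B ∧
      g (proj z) = z 2 ∧ IsSpacelikeGraphOn g B ∧ (∀ a ∈ B, pt a (g a) ∈ V ∧ H (pt a (g a)) = 0) ∧
      W ∈ 𝓝 z ∧ ∀ y ∈ W, H y = 0 → proj y ∈ B ∧ y = pt (proj y) (g (proj y)) := by
  set K : (ℝ × ℝ) × ℝ → ℝ := fun w => H (pt w.1 w.2) with hK
  set w₀ : (ℝ × ℝ) × ℝ := (proj z, z 2) with hw₀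
  have hzw : pt w₀.1 w₀.2 = z := pt_proj z
  have hHz : ContDiffAt ℝ 1 H (pt w₀.1 w₀.2) := hzw.symm ▸ hH.contDiffAt (hV.mem_nhds hz)
  have hKc : ContDiffAt ℝ 1 K w₀ := hHz.comp w₀ contDiff_pt.contDiffAt
  have hKd : fderiv ℝ K w₀ = (fderiv ℝ H z).comp ptL := by
    have h1 := (hHz.differentiableAt (by simp)).hasFDerivAt.comp w₀ (ptL.hasFDerivAt (x := w₀))
    rw [hzw] at h1
    exact h1.fderiv
  -- The direction of time is timelike, hence not tangent to the level set: the implicit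
  -- function theorem applies.
  have ht : fderiv ℝ H z (pt 0 1) ≠ 0 := by
    intro h
    have h1 := hpos z hz hz0 (pt 0 1) (fun h0 => by
      have := congrArg (fun v : E3 => v 2) h0
      simp at this) h
    rw [adsForm_time _ _ _ rfl rfl] at h1
    have := radiusSq_pos z
    simp at h1
    linarith
  have hinv : (fderiv ℝ K w₀ ∘L ContinuousLinearMap.inr ℝ (ℝ × ℝ) ℝ).IsInvertible := by
    refine ⟨ContinuousLinearEquiv.unitsEquivAut ℝ (Units.mk0 _ ht), ?_⟩
    ext
    rw [hKd]
    simp [ptL_apply]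
  set g := hKc.implicitFunction (by simp) hinv with hg
  have hg0 : g w₀.1 = w₀.2 := hKc.implicitFunction_apply_self (by simp) hinv
  have hgc : ContDiffAt ℝ 1 g w₀.1 := hKc.contDiffAt_implicitFunction (by simp) hinv
  have hK0 : K w₀ = 0 := by simp only [hK]; rw [hzw, hz0]
  have e1 : ∀ᶠ a in 𝓝 w₀.1, K (a, g a) = 0 :=
    hK0 ▸ hKc.eventually_apply_implicitFunction (by simp) hinv
  have e2 : ∀ᶠ w in 𝓝 w₀, K w = 0 ↔ g w.1 = w.2 := by
    have := hKc.eventually_apply_eq_iff_implicitFunction (by simp) hinv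
    rwa [hK0] at this
  have e3 : ∀ᶠ a in 𝓝 w₀.1, ContDiffAt ℝ 1 g a := hgc.eventually (by simp)
  have e4 : ∀ᶠ a in 𝓝 w₀.1, pt a (g a) ∈ V := by
    have hcont : ContinuousAt (fun a => pt a (g a)) w₀.1 :=
      continuous_pt.continuousAt.comp (f := fun a => (a, g a))
        (continuousAt_id.prodMk hgc.continuousAt)
    refine hcont (hV.mem_nhds ?_)
    beta_reduce
    rw [hg0, hzw]
    exact hz
  obtain ⟨ε, hε, hball⟩ := Metric.eventually_nhds_iff_ball.1 (e1.and (e3.and e4))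
  have hd : ∀ a ∈ Metric.ball w₀.1 ε, DifferentiableAt ℝ g a := fun a ha =>
    (hball a ha).2.1.differentiableAt (by simp)
  refine ⟨Metric.ball w₀.1 ε, g, {y | (K (proj y, y 2) = 0 ↔ g (proj y) = y 2) ∧
    proj y ∈ Metric.ball w₀.1 ε}, Metric.isOpen_ball, (convex_ball w₀.1 ε).isConnected ⟨_, Metric.mem_ball_self hε⟩,
    Metric.mem_ball_self hε, hg0,
    ⟨fun a ha => (hball a ha).2.1.contDiffWithinAt, fun a ha q hq => ?_⟩,
    fun a ha => ⟨(hball a ha).2.2, (hball a ha).1⟩, ?_, ?_⟩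
  · refine hpos _ (hball a ha).2.2 (hball a ha).1 _ ?_ ?_
    · intro h
      apply hq
      have h0 := congrArg (fun v : E3 => v 0) h
      have h1 := congrArg (fun v : E3 => v 1) h
      exact Prod.ext h0 h1
    -- `H` vanishes on the graph, and its differential on the tangent planes of the graph.
    · have hHa := ((hH.contDiffAt (hV.mem_nhds (hball a ha).2.2)).differentiableAt
        (by simp)).hasFDerivAt
      have h1 := hHa.comp a (hasFDerivAt_graph (hd a ha))
      have h2 : (H ∘ fun b => pt b (g b)) =ᶠ[𝓝 a] fun _ => 0 := by
        filter_upwards [Metric.isOpen_ball.mem_nhds ha] with b hb using (hball b hb).1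
      have h3 := h1.fderiv
      rw [h2.fderiv_eq] at h3
      have h4 := congrArg (fun L : (ℝ × ℝ) →L[ℝ] ℝ => L q) h3
      simpa [ptL_apply] using h4.symm
  · have hc : ContinuousAt (fun y : E3 => (proj y, y 2)) z :=
      (continuous_proj.prodMk (by fun_prop)).continuousAt
    exact (hc.eventually e2).and
      (continuous_proj.continuousAt (Metric.ball_mem_nhds _ hε))
  · rintro y ⟨hy1, hy2⟩ hy0
    refine ⟨hy2, ?_⟩
    have : g (proj y) = y 2 := hy1.1 (by simpa [hK] using hy0)
    rw [this, pt_proj]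

section

variable {M : AdSSpacetime.{u}} {X : Type*} [TopologicalSpace X] {p : X → M} {D : X → E3}

/-- The preimage of a spacelike surface is locally a section of the projection of the developing map
to the `(x₁, x₂)`-plane, which develops to a spacelike graph. -/
lemma IsDeveloped.exists_local_graph (hD : IsDeveloped M p D) {S : Set M}
    (hS : M.IsSpacelikeSurface S) {x : X} (hx : p x ∈ S) :
    ∃ (B : Set (ℝ × ℝ)) (g : ℝ × ℝ → ℝ) (η : ℝ × ℝ → X) (W : Set X), IsOpen B ∧ IsConnected B ∧
      proj (D x) ∈ B ∧ IsSpacelikeGraphOn g B ∧ ContinuousOn η B ∧ η (proj (D x)) = x ∧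
      (∀ a ∈ B, D (η a) = pt a (g a) ∧ p (η a) ∈ S) ∧
      W ∈ 𝓝 x ∧ ∀ y ∈ W, p y ∈ S → proj (D y) ∈ B ∧ y = η (proj (D y)) := by
  obtain ⟨e, ψ, hxe, heD, hψ, hpψ⟩ := hD.exists_local_model x
  obtain ⟨U, h, hU, hxU, hh, hSU, hpos⟩ := hS _ hx
  have hψc : ContinuousOn ψ e.target := hψ.1.contMDiffOn.continuousOn
  -- In the local model of `M` near `p x`, the surface is the zero set of `h ∘ ψ`.
  set V := e.target ∩ ψ ⁻¹' U with hVdef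
  have hV : IsOpen V := hψc.isOpen_inter_preimage e.open_target hU
  have hiff : ∀ y ∈ V, h (ψ y) = 0 ↔ ψ y ∈ S := by
    intro y hy
    have : ψ y ∈ S ∩ U ↔ ψ y ∈ {y ∈ U | h y = 0} := by rw [hSU]
    constructor
    · intro h0
      exact (this.2 ⟨hy.2, h0⟩).1
    · intro h0
      exact (this.1 ⟨h0, hy.2⟩).2
  have hHc : ContDiffOn ℝ 1 (h ∘ ψ) V := by
    rw [← contMDiffOn_iff_contDiffOn]
    refine hh.comp ((hψ.1.contMDiffOn.mono inter_subset_left).of_le (by simp)) ?_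
    exact inter_subset_right
  have hz : D x ∈ V := by
    refine ⟨heD hxe ▸ e.map_source hxe, ?_⟩
    change ψ (D x) ∈ U
    rw [← hpψ x hxe]
    exact hxU
  have hz0 : (h ∘ ψ) (D x) = 0 := by
    refine (hiff _ hz).2 ?_
    rw [← hpψ x hxe]
    exact hx
  obtain ⟨B, g, W, hB, hBc, hzB, hgz, hg, hgV, hW, hWg⟩ :=
    AdS.exists_local_graph hV hHc hz hz0 (by
      intro y hy hy0 v hv hdv
      have hyS : ψ y ∈ S ∩ U := ⟨(hiff y hy).1 hy0, hy.2⟩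
      have hψd := hψ.mdifferentiableAt hy.1
      have hhd : MDifferentiableAt 𝓘(ℝ, E3) 𝓘(ℝ, ℝ) h (ψ y) :=
        (hh.contMDiffAt (hU.mem_nhds hy.2)).mdifferentiableAt (by simp)
      have h1 := mfderiv_comp y hhd hψd
      have h2 := (hpos _ hyS).2 (mfderiv 𝓘(ℝ, E3) 𝓘(ℝ, E3) ψ y v)
      have h3 := form_mder hψ hy.1 v v
      refine h3 ▸ h2 ?_ ?_
      · intro h0
        have h0' : mder ψ y v = 0 := h0
        apply hv
        refine eq_zero_of_adsForm (x := y) fun w => ?_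
        rw [← form_mder hψ hy.1, h0']
        exact LinearMap.map_zero₂ (M.metric (ψ y)) _
      · rw [← mfderiv_eq_fderiv, h1] at hdv
        exact hdv)
  have hmem : ∀ a ∈ B, pt a (g a) ∈ e.target := fun a ha => (hgV a ha).1.1
  have hDe : ∀ y ∈ e.target, D (e.symm y) = y := fun y hy => by
    rw [heD (e.map_target hy), e.right_inv hy]
  refine ⟨B, g, fun a => e.symm (pt a (g a)), e.source ∩ D ⁻¹' (W ∩ V), hB, hBc, hzB, hg, ?_, ?_, ?_,
    ?_, ?_⟩
  · refine e.continuousOn_symm.comp ?_ hmem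
    exact continuous_pt.comp_continuousOn (continuousOn_id.prodMk hg.contDiffOn.continuousOn)
  · beta_reduce
    rw [hgz, pt_proj, heD hxe, e.left_inv hxe]
  · intro a ha
    refine ⟨hDe _ (hmem a ha), ?_⟩
    rw [hpψ _ (e.map_target (hmem a ha)), hDe _ (hmem a ha)]
    exact (hiff _ (hgV a ha).1).1 (hgV a ha).2
  · exact inter_mem (e.open_source.mem_nhds hxe)
      (hD.isLocalHomeomorph.continuous.continuousAt (inter_mem hW (hV.mem_nhds hz)))
  · rintro y ⟨hye, hyW, hyV⟩ hyS
    have h0 : (h ∘ ψ) (D y) = 0 := (hiff _ hyV).2 (hpψ y hye ▸ hyS)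
    obtain ⟨h1, h2⟩ := hWg _ hyW h0
    refine ⟨h1, ?_⟩
    beta_reduce
    rw [← h2, heD hye, e.left_inv hye]

end

/-! ### Spherical distances to boundary points -/

/-- The spherical distance between the point of the hemisphere below `x` and the point `(v, 0)` of
its boundary, for a unit vector `v`. -/
def boundaryAngle (v : ℝ × ℝ) (x : E3) : ℝ :=
  Real.arccos ((x 0 * v.1 + x 1 * v.2) / √(radiusSq x))

/-- The length `√(1 + (x × v)²)`: the distance from the origin to the lift of the line of direction
`v` through `x` to the plane `z = 1`. -/
def lineDist (v : ℝ × ℝ) (x : E3) : ℝ := √(1 + (x 0 * v.2 - x 1 * v.1) ^ 2)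

lemma lineDist_pos (v : ℝ × ℝ) (x : E3) : 0 < lineDist v x := Real.sqrt_pos.2 (by positivity)

lemma lineDist_sq (v : ℝ × ℝ) (x : E3) :
    lineDist v x ^ 2 = 1 + (x 0 * v.2 - x 1 * v.1) ^ 2 := Real.sq_sqrt (by positivity)

/-- Pythagoras, along the line of direction `v` through `x` and orthogonally to it. -/
lemma radiusSq_eq_add_sq {v : ℝ × ℝ} (hv : v.1 ^ 2 + v.2 ^ 2 = 1) (x : E3) :
    radiusSq x = (x 0 * v.1 + x 1 * v.2) ^ 2 + lineDist v x ^ 2 := by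
  rw [lineDist_sq, radiusSq]
  linear_combination (-(x 0 ^ 2 + x 1 ^ 2)) * hv

/-- The gradient of the distance to the boundary point `(v, 0)`, for the spacelike metric, is the
multiple `-v / lineDist v` of the direction `v`. -/
lemma hasDerivAt_boundaryAngle {v : ℝ × ℝ} (hv : v.1 ^ 2 + v.2 ^ 2 = 1) {c : ℝ → E3} {w : E3}
    {s : ℝ} (hc : HasDerivAt c w s) :
    HasDerivAt (fun s => boundaryAngle v (c s))
      (-(spaceForm (c s) w (pt v 0) / lineDist v (c s))) s := by
  have hci : ∀ i : Fin 3, HasDerivAt (fun s => c s i) (w i) s := by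
    intro i
    exact (EuclideanSpace.proj (𝕜 := ℝ) i : E3 →L[ℝ] ℝ).hasFDerivAt.comp_hasDerivAt s hc
  have hr := radiusSq_pos (c s)
  have hr0 : √(radiusSq (c s)) ≠ 0 := (Real.sqrt_pos.2 hr).ne'
  have hrs := Real.sq_sqrt hr.le
  have h1 : HasDerivAt (fun s => c s 0 * v.1 + c s 1 * v.2) (w 0 * v.1 + w 1 * v.2) s :=
    ((hci 0).mul_const _).add ((hci 1).mul_const _)
  have h2 : HasDerivAt (fun s => √(radiusSq (c s)))
      ((c s 0 * w 0 + c s 1 * w 1) / √(radiusSq (c s))) s := by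
    have h0 := ((((hci 0).pow 2).const_add 1).add ((hci 1).pow 2)).sqrt hr.ne'
    refine h0.congr_deriv ?_
    change _ / (2 * √(radiusSq (c s))) = _
    field_simp
    simp
    ring
  have h3 := h1.div h2 hr0
  set y := (c s 0 * v.1 + c s 1 * v.2) / √(radiusSq (c s)) with hy
  have hk := lineDist_pos v (c s)
  have hrk := radiusSq_eq_add_sq hv (c s)
  have hone : 1 - y ^ 2 = (lineDist v (c s) / √(radiusSq (c s))) ^ 2 := by
    rw [hy]
    field_simp
    rw [hrs]
    linear_combination hrk
  have hlt : 0 < 1 - y ^ 2 := by rw [hone]; positivity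
  have h4 := (Real.hasDerivAt_arccos (x := y) (fun h => by rw [h] at hlt; norm_num at hlt)
    (fun h => by rw [h] at hlt; norm_num at hlt)).comp s h3
  refine h4.congr_deriv ?_
  rw [hone, Real.sqrt_sq (by positivity)]
  simp only [spaceForm, pt_zero, pt_one]
  have hid : radiusSq (c s) = 1 + c s 0 ^ 2 + c s 1 ^ 2 := rfl
  generalize lineDist v (c s) = k at *
  generalize hS : √(radiusSq (c s)) = r at *
  rw [← hrs]
  have hr2 : r ^ 2 = 1 + c s 0 ^ 2 + c s 1 ^ 2 := by rw [hrs, hid]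
  field_simp
  linear_combination (-(w 0 * v.1 + w 1 * v.2)) * hr2

/-- The distance to a boundary point varies at most as fast as the spherical length, which is the
length for `spaceForm` divided by `√radiusSq`. -/
lemma sq_spaceForm_div_le {v : ℝ × ℝ} (hv : v.1 ^ 2 + v.2 ^ 2 = 1) (x w : E3) :
    (spaceForm x w (pt v 0) / lineDist v x) ^ 2 ≤ spaceForm x w w / radiusSq x := by
  have h1 := spaceForm_cauchySchwarz x w (pt v 0)
  have hr := radiusSq_pos x
  have hk := lineDist_pos v x
  have h2 : spaceForm x (pt v 0) (pt v 0) = lineDist v x ^ 2 / radiusSq x := by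
    rw [lineDist_sq, spaceForm]
    simp only [pt_zero, pt_one]
    congr 1
    linear_combination hv
  rw [h2] at h1
  rw [div_pow, div_le_iff₀ (by positivity)]
  calc _ ≤ _ := h1
    _ = _ := by ring

/-- The distance to a boundary point varies along a causal curve at most as fast as time. -/
lemma abs_spaceForm_div_le_of_causal {v : ℝ × ℝ} (hv : v.1 ^ 2 + v.2 ^ 2 = 1) {x w : E3}
    (hw : adsForm x w w ≤ 0) : |spaceForm x w (pt v 0) / lineDist v x| ≤ |w 2| := by
  have hr := radiusSq_pos x
  refine sq_le_sq.1 ((sq_spaceForm_div_le hv x w).trans ?_)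
  rw [div_le_iff₀ hr]
  unfold adsForm at hw
  linarith

/-- A spacelike function varies strictly less than the distance to a boundary point along the line
that ends at this point. -/
lemma abs_fderiv_lt_of_spacelike {f : ℝ × ℝ → ℝ} {B : Set (ℝ × ℝ)} (hf : IsSpacelikeGraphOn f B)
    {a v : ℝ × ℝ} (ha : a ∈ B) (hv : v.1 ^ 2 + v.2 ^ 2 = 1) (t : ℝ) :
    |fderiv ℝ f a v| < spaceForm (pt a t) (pt v 0) (pt v 0) / lineDist v (pt a t) := by
  have hv0 : v ≠ 0 := by
    rintro rfl
    norm_num at hv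
  have h := hf.pos a ha v hv0
  have hr := radiusSq_pos (pt a t)
  have hk := lineDist_pos v (pt a t)
  have h2 : spaceForm (pt a t) (pt v 0) (pt v 0) = lineDist v (pt a t) ^ 2 / radiusSq (pt a t) := by
    rw [lineDist_sq, spaceForm]
    simp only [pt_zero, pt_one]
    congr 1
    linear_combination hv
  have h3 : adsForm (pt a (f a)) (pt v (fderiv ℝ f a v)) (pt v (fderiv ℝ f a v)) =
      spaceForm (pt a t) (pt v 0) (pt v 0) - radiusSq (pt a t) * (fderiv ℝ f a v) ^ 2 := by
    simp only [adsForm, spaceForm, radiusSq, pt_zero, pt_one, pt_two]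
    ring
  rw [h3, h2] at h
  rw [h2]
  generalize lineDist v (pt a t) = k at *
  generalize radiusSq (pt a t) = r at *
  have h4 : k ^ 2 / r / k = k / r := by field_simp
  rw [h4]
  refine abs_lt_of_sq_lt_sq ?_ (by positivity)
  rw [div_pow, lt_div_iff₀ (by positivity)]
  have h5 : r * fderiv ℝ f a v ^ 2 < k ^ 2 / r := by linarith
  rw [lt_div_iff₀ hr] at h5
  linarith

/-- A spacelike function varies along a causal curve at most as fast as time. -/
lemma abs_fderiv_le_of_causal {f : ℝ × ℝ → ℝ} {B : Set (ℝ × ℝ)} (hf : IsSpacelikeGraphOn f B)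
    {x w : E3} (hx : proj x ∈ B) (hw : adsForm x w w ≤ 0) :
    |fderiv ℝ f (proj x) (proj w)| ≤ |w 2| := by
  have hr := radiusSq_pos x
  by_cases h0 : proj w = 0
  · rw [h0, map_zero, abs_zero]
    exact abs_nonneg _
  have h := hf.pos _ hx _ h0
  have h3 : adsForm (pt (proj x) (f (proj x))) (pt (proj w) (fderiv ℝ f (proj x) (proj w)))
      (pt (proj w) (fderiv ℝ f (proj x) (proj w))) =
      spaceForm x w w - radiusSq x * fderiv ℝ f (proj x) (proj w) ^ 2 := by
    simp only [adsForm, spaceForm, radiusSq, pt_zero, pt_one, pt_two, proj]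
    ring
  rw [h3] at h
  unfold adsForm at hw
  refine sq_le_sq.1 ?_
  have : radiusSq x * fderiv ℝ f (proj x) (proj w) ^ 2 ≤ radiusSq x * w 2 ^ 2 := by nlinarith
  exact le_of_mul_le_mul_left this hr

/-! ### Lines -/

/-- The straight line of the plane through `a` in the direction `v`, at time zero. -/
def line (a v : ℝ × ℝ) (τ : ℝ) : E3 := pt (a + τ • v) 0

lemma hasDerivAt_line (a v : ℝ × ℝ) (τ : ℝ) : HasDerivAt (line a v) (pt v 0) τ := by
  have h1 : HasDerivAt (fun τ : ℝ => a + τ • v) v τ := by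
    simpa using ((hasDerivAt_id' τ).smul_const v).const_add a
  have h2 := ptL.hasFDerivAt.comp_hasDerivAt τ (h1.prodMk (hasDerivAt_const τ (0 : ℝ)))
  exact h2

lemma boundaryAngle_proj (v : ℝ × ℝ) (x : E3) (t : ℝ) :
    boundaryAngle v (pt (proj x) t) = boundaryAngle v x := rfl

section

variable {f : ℝ × ℝ → ℝ} (hf : IsSpacelikeGraphOn f univ) {v : ℝ × ℝ} (hv : v.1 ^ 2 + v.2 ^ 2 = 1)
include hf

lemma IsSpacelikeGraphOn.differentiable : Differentiable ℝ f :=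
  (contDiffOn_univ.1 hf.contDiffOn).differentiable (by simp)

lemma IsSpacelikeGraphOn.continuous : Continuous f :=
  (contDiffOn_univ.1 hf.contDiffOn).continuous

lemma IsSpacelikeGraphOn.hasDerivAt_line (a : ℝ × ℝ) (τ : ℝ) :
    HasDerivAt (fun τ : ℝ => f (a + τ • v)) (fderiv ℝ f (a + τ • v) v) τ := by
  have h1 : HasDerivAt (fun τ : ℝ => a + τ • v) v τ := by
    simpa using ((hasDerivAt_id' τ).smul_const v).const_add a
  exact (hf.differentiable _).hasFDerivAt.comp_hasDerivAt τ h1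

include hv

/-- Along the line that ends at a boundary point, a spacelike function varies strictly less than the
distance to this boundary point decreases. -/
lemma IsSpacelikeGraphOn.strictAnti_add (a : ℝ × ℝ) {ε : ℝ} (hε : |ε| = 1) :
    StrictAnti fun τ : ℝ => ε * f (a + τ • v) + boundaryAngle v (line a v τ) := by
  refine strictAnti_of_deriv_neg fun τ => ?_
  have key : HasDerivAt (fun τ : ℝ => ε * f (a + τ • v) + boundaryAngle v (line a v τ)) _ τ :=
    ((hf.hasDerivAt_line a τ).const_mul ε).add
      (hasDerivAt_boundaryAngle hv (AdS.hasDerivAt_line a v τ))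
  rw [key.deriv]
  have h := abs_fderiv_lt_of_spacelike hf (mem_univ (a + τ • v)) hv 0
  have h2 : |ε * fderiv ℝ f (a + τ • v) v| = |fderiv ℝ f (a + τ • v) v| := by
    rw [abs_mul, hε, one_mul]
  have h3 := le_abs_self (ε * fderiv ℝ f (a + τ • v) v)
  unfold line
  linarith

end

/-! ### The conformal embedding -/

lemma toEin_fst (x : E3) : ((toEin x).1 : EuclideanSpace ℝ (Fin 3)) =
    (√(radiusSq x))⁻¹ • !₂[x 0, x 1, 1] := rfl

lemma toEin_snd (x : E3) : (toEin x).2 = x 2 := rfl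

lemma toEin_fst_pt (a : ℝ × ℝ) (t t' : ℝ) : (toEin (pt a t)).1 = (toEin (pt a t')).1 := rfl

lemma continuous_toEin : Continuous toEin := by
  unfold toEin
  refine Continuous.prodMk (Continuous.subtype_mk ?_ _) (by fun_prop)
  have h : Continuous fun x : E3 => √(radiusSq x) := (contDiff_radius (n := 0)).continuous
  refine (h.inv₀ fun x => (Real.sqrt_pos.2 (radiusSq_pos x)).ne').smul ?_
  refine (PiLp.continuous_toLp 2 _).comp (continuous_pi fun i => ?_)
  fin_cases i
  · exact (by fun_prop : Continuous fun x : E3 => x 0)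
  · exact (by fun_prop : Continuous fun x : E3 => x 1)
  · exact continuous_const

/-- The point `(v, 0)` of the boundary of the hemisphere. -/
def IsBoundaryDirection (q : Metric.sphere (0 : EuclideanSpace ℝ (Fin 3)) 1) (v : ℝ × ℝ) : Prop :=
  v.1 ^ 2 + v.2 ^ 2 = 1 ∧ (q : EuclideanSpace ℝ (Fin 3)) = !₂[v.1, v.2, 0]

lemma exists_boundaryDirection {q : Metric.sphere (0 : EuclideanSpace ℝ (Fin 3)) 1}
    (hq : (q : EuclideanSpace ℝ (Fin 3)) 2 = 0) : ∃ v, IsBoundaryDirection q v := by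
  refine ⟨((q : EuclideanSpace ℝ (Fin 3)) 0, (q : EuclideanSpace ℝ (Fin 3)) 1), ?_, ?_⟩
  · have h := mem_sphere_zero_iff_norm.1 q.2
    rw [EuclideanSpace.norm_eq, Real.sqrt_eq_one] at h
    simpa [Fin.sum_univ_three, hq] using h
  · ext i
    fin_cases i
    · rfl
    · rfl
    · exact hq

lemma IsBoundaryDirection.angle_eq {q : Metric.sphere (0 : EuclideanSpace ℝ (Fin 3)) 1}
    {v : ℝ × ℝ} (h : IsBoundaryDirection q v) (x : E3) :
    InnerProductGeometry.angle ((toEin x).1 : EuclideanSpace ℝ (Fin 3)) q = boundaryAngle v x := by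
  rw [InnerProductGeometry.angle, mem_sphere_zero_iff_norm.1 (toEin x).1.2,
    mem_sphere_zero_iff_norm.1 q.2, h.2, toEin_fst, boundaryAngle]
  congr 1
  simp [PiLp.inner_apply, Fin.sum_univ_three]
  ring

/-! ### Entire spacelike graphs -/

/-- The graph of a function of `(x₁, x₂)` in the universal anti-de Sitter space. -/
def graph (f : ℝ × ℝ → ℝ) : Set E3 := {x | x 2 = f (proj x)}

lemma pt_mem_graph (f : ℝ × ℝ → ℝ) (a : ℝ × ℝ) : pt a (f a) ∈ graph f := rfl

/-- The invisible domain from the boundary at infinity of a graph. -/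
def graphDomain (f : ℝ × ℝ → ℝ) : Set E3 := invisibleDomain (boundaryAtInfinity (graph f))

lemma mem_graphDomain {f : ℝ × ℝ → ℝ} {x : E3} : x ∈ graphDomain f ↔
    ∀ q ∈ boundaryAtInfinity (graph f), ¬ CausallyRelated (toEin x) q := Iff.rfl

/-- The central projection to the hemisphere of the point `a` of the plane `z = 1`. -/
abbrev sph (a : ℝ × ℝ) : EuclideanSpace ℝ (Fin 3) := (toEin (pt a 0)).1

lemma exists_unit_direction {a b : ℝ × ℝ} (h : a ≠ b) :
    ∃ (v : ℝ × ℝ) (d : ℝ), v.1 ^ 2 + v.2 ^ 2 = 1 ∧ 0 < d ∧ b = a + d • v := by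
  set n := (b.1 - a.1) ^ 2 + (b.2 - a.2) ^ 2 with hn
  have hpos : 0 < n := by
    by_contra hle
    push Not at hle
    have h1 : b.1 - a.1 = 0 := by nlinarith [sq_nonneg (b.1 - a.1), sq_nonneg (b.2 - a.2)]
    have h2 : b.2 - a.2 = 0 := by nlinarith [sq_nonneg (b.1 - a.1), sq_nonneg (b.2 - a.2)]
    exact h (Prod.ext (by linarith) (by linarith))
  have hd := Real.sqrt_pos.2 hpos
  have hs := Real.sq_sqrt hpos.le
  refine ⟨((b.1 - a.1) / √n, (b.2 - a.2) / √n), √n, ?_, hd, ?_⟩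
  · simp only [div_pow, hs]
    rw [← add_div, ← hn, div_self hpos.ne']
  · ext
    · simp only [Prod.fst_add, Prod.smul_fst, smul_eq_mul]
      field_simp
      ring
    · simp only [Prod.snd_add, Prod.smul_snd, smul_eq_mul]
      field_simp
      ring

lemma exists_boundaryPoint {v : ℝ × ℝ} (hv : v.1 ^ 2 + v.2 ^ 2 = 1) :
    ∃ q, IsBoundaryDirection q v := by
  refine ⟨⟨!₂[v.1, v.2, 0], ?_⟩, hv, rfl⟩
  rw [mem_sphere_zero_iff_norm, EuclideanSpace.norm_eq, Real.sqrt_eq_one]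
  simpa [Fin.sum_univ_three] using hv

section

variable {f : ℝ × ℝ → ℝ} (hf : IsSpacelikeGraphOn f univ)
include hf

/-- An entire spacelike graph is the graph of a function that contracts spherical distances. -/
lemma IsSpacelikeGraphOn.abs_sub_le_angle (a b : ℝ × ℝ) :
    |f a - f b| ≤ InnerProductGeometry.angle (sph a) (sph b) := by
  by_cases hab : a = b
  · rw [hab, sub_self, abs_zero]
    exact InnerProductGeometry.angle_nonneg _ _
  obtain ⟨v, d, hv, hd, rfl⟩ := exists_unit_direction hab
  obtain ⟨q, hq⟩ := exists_boundaryPoint hv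
  have h1 := hf.strictAnti_add hv a (ε := 1) (by simp) hd
  have h2 := hf.strictAnti_add hv a (ε := -1) (by simp) hd
  have h3 := InnerProductGeometry.angle_le_angle_add_angle (sph a) (sph (a + d • v)) q
  rw [hq.angle_eq, hq.angle_eq] at h3
  simp only [line, zero_smul, add_zero] at h1 h2
  rw [abs_le]
  constructor <;> linarith

lemma IsSpacelikeGraphOn.abs_sub_le_pi (a b : ℝ × ℝ) : |f a - f b| ≤ Real.pi :=
  (hf.abs_sub_le_angle a b).trans (InnerProductGeometry.angle_le_pi _ _)

lemma IsSpacelikeGraphOn.abs_sub_le_angle_of_mem_closure {q : Ein}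
    (hq : q ∈ closure (toEin '' graph f)) (a : ℝ × ℝ) :
    |f a - q.2| ≤ InnerProductGeometry.angle (sph a) q.1 := by
  have hcl : IsClosed {q : Ein | |f a - q.2| ≤ InnerProductGeometry.angle (sph a) q.1} := by
    refine isClosed_le (by fun_prop) ?_
    rw [continuous_iff_continuousAt]
    intro q
    have h0 : ∀ y : Metric.sphere (0 : EuclideanSpace ℝ (Fin 3)) 1,
        (y : EuclideanSpace ℝ (Fin 3)) ≠ 0 := fun y hy => by
      have := mem_sphere_zero_iff_norm.1 y.2
      rw [hy, norm_zero] at this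
      exact zero_ne_one this
    exact (InnerProductGeometry.continuousAt_angle (x := (sph a, (q.1 : EuclideanSpace ℝ (Fin 3))))
      (h0 _) (h0 _)).comp (f := fun q : Ein => (sph a, (q.1 : EuclideanSpace ℝ (Fin 3))))
      (by fun_prop)
  refine closure_minimal ?_ hcl hq
  rintro _ ⟨x, hx, rfl⟩
  change |f a - x 2| ≤ _
  rw [show x 2 = f (proj x) from hx]
  exact hf.abs_sub_le_angle a (proj x)

/-- A spacelike graph is strictly invisible from its boundary at infinity. -/
lemma IsSpacelikeGraphOn.abs_sub_lt_boundaryAngle {q : Ein}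
    (hq : q ∈ closure (toEin '' graph f)) {v : ℝ × ℝ} (hv : IsBoundaryDirection q.1 v) (x : E3) :
    |f (proj x) - q.2| < boundaryAngle v x := by
  have h1 := hf.strictAnti_add hv.1 (proj x) (ε := 1) (by simp) one_pos
  have h2 := hf.strictAnti_add hv.1 (proj x) (ε := -1) (by simp) one_pos
  have h3 := hf.abs_sub_le_angle_of_mem_closure hq (proj x + (1 : ℝ) • v)
  rw [hv.angle_eq] at h3
  simp only [line, zero_smul, add_zero, boundaryAngle_proj] at h1 h2
  rw [abs_le] at h3
  rw [abs_lt]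
  constructor <;> linarith

lemma IsSpacelikeGraphOn.graph_subset : graph f ⊆ graphDomain f := by
  intro x hx q hq
  obtain ⟨v, hv⟩ := exists_boundaryDirection hq.2
  rw [CausallyRelated, hv.angle_eq, not_le, toEin_snd, show x 2 = f (proj x) from hx]
  exact hf.abs_sub_lt_boundaryAngle hq.1 hv x

/-- A null line towards a boundary point that is causally related to its starting point misses the
graph. -/
lemma IsSpacelikeGraphOn.exists_null_line {x : E3} (hx : x ∉ graphDomain f) :
    ∃ σ, IsUnorientedCausal σ ∧ σ 0 = x ∧ ∀ s, σ s ∉ graph f := by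
  rw [mem_graphDomain] at hx
  push Not at hx
  obtain ⟨q, hq, hcr⟩ := hx
  obtain ⟨v, hv⟩ := exists_boundaryDirection hq.2
  rw [CausallyRelated, hv.angle_eq, toEin_snd] at hcr
  -- The sign `ε` is the direction of time from `x` to `q`.
  obtain ⟨ε, hε, hεs⟩ : ∃ ε : ℝ, |ε| = 1 ∧ |x 2 - q.2| = ε * (q.2 - x 2) := by
    rcases le_total (x 2) q.2 with h | h
    · exact ⟨1, by simp, by rw [abs_of_nonpos (by linarith)]; ring⟩
    · exact ⟨-1, by simp, by rw [abs_of_nonneg (by linarith)]; ring⟩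
  have hε2 : ε * ε = 1 := by rw [← abs_mul_abs_self, hε, one_mul]
  set a := proj x with ha
  -- Time varies along the line as much as the distance to `q` decreases.
  set σ : ℝ → E3 := fun τ => pt (a + τ • v)
    (x 2 + ε * (boundaryAngle v x - boundaryAngle v (line a v τ))) with hσ
  have hder : ∀ τ, HasDerivAt σ (pt v (ε * (spaceForm (line a v τ) (pt v 0) (pt v 0) /
      lineDist v (line a v τ)))) τ := by
    intro τ
    have h1 : HasDerivAt (fun τ : ℝ => a + τ • v) v τ := by
      simpa using ((hasDerivAt_id' τ).smul_const v).const_add a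
    have h2 := (((hasDerivAt_boundaryAngle hv.1 (AdS.hasDerivAt_line a v τ)).const_sub
      (boundaryAngle v x)).const_mul ε).const_add (x 2)
    have h3 := ptL.hasFDerivAt.comp_hasDerivAt τ (h1.prodMk h2)
    simp only [neg_neg] at h3
    exact h3
  have hlc : Continuous (line a v) :=
    continuous_iff_continuousAt.2 fun τ => (AdS.hasDerivAt_line a v τ).continuousAt
  refine ⟨σ, ⟨?_, ?_, ?_, ?_, ?_⟩, ?_, ?_⟩
  · rw [contDiff_one_iff_deriv]
    refine ⟨fun τ => (hder τ).differentiableAt, ?_⟩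
    rw [show deriv σ = _ from funext fun τ => (hder τ).deriv]
    have hr : Continuous fun τ => radiusSq (line a v τ) := by
      unfold radiusSq
      fun_prop
    have hk : Continuous fun τ => lineDist v (line a v τ) := by
      unfold lineDist
      fun_prop
    have hs : Continuous fun τ => spaceForm (line a v τ) (pt v 0) (pt v 0) := by
      unfold spaceForm
      refine Continuous.div ?_ hr fun τ => (radiusSq_pos _).ne'
      fun_prop
    exact continuous_pt.comp (f := fun τ => (v, ε * (spaceForm (line a v τ) (pt v 0) (pt v 0) /
      lineDist v (line a v τ)))) (continuous_const.prodMk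
      (continuous_const.mul (hs.div hk fun τ => (lineDist_pos _ _).ne')))
  · intro τ
    rw [(hder τ).deriv]
    have h2 : spaceForm (line a v τ) (pt v 0) (pt v 0) =
        lineDist v (line a v τ) ^ 2 / radiusSq (line a v τ) := by
      rw [lineDist_sq, spaceForm]
      simp only [pt_zero, pt_one]
      congr 1
      linear_combination hv.1
    have hk := lineDist_pos v (line a v τ)
    have hr := radiusSq_pos (line a v τ)
    have h3 : ∀ z, adsForm (σ τ) (pt v z) (pt v z) = spaceForm (line a v τ) (pt v 0) (pt v 0)
        - radiusSq (line a v τ) * (z * z) := fun z => rfl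
    rw [h3, h2]
    refine le_of_eq ?_
    generalize lineDist v (line a v τ) = k at *
    generalize radiusSq (line a v τ) = r at *
    -- The vector is null.
    have h4 : ε * (k ^ 2 / r / k) * (ε * (k ^ 2 / r / k)) = k ^ 2 / r ^ 2 := by
      field_simp
      linear_combination hε2
    rw [h4]
    field_simp
    ring
  · intro τ h0
    rw [(hder τ).deriv] at h0
    have h1 : v.1 = 0 := congrArg (fun y : E3 => y 0) h0
    have h2 : v.2 = 0 := congrArg (fun y : E3 => y 1) h0
    have := hv.1
    rw [h1, h2] at this
    norm_num at this
  · intro y hy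
    have h1 : Tendsto (fun τ => σ τ 0 * v.1 + σ τ 1 * v.2) atTop (𝓝 (y 0 * v.1 + y 1 * v.2)) :=
      ((by fun_prop : Continuous fun y : E3 => y 0 * v.1 + y 1 * v.2).tendsto y).comp hy
    refine not_tendsto_nhds_of_tendsto_atTop ?_ _ h1
    have h2 : (fun τ => σ τ 0 * v.1 + σ τ 1 * v.2) = fun τ => (a.1 * v.1 + a.2 * v.2) + τ := by
      funext τ
      simp only [hσ, pt_zero, pt_one, Prod.fst_add, Prod.snd_add, Prod.smul_fst, Prod.smul_snd,
        smul_eq_mul]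
      linear_combination τ * hv.1
    rw [h2]
    exact tendsto_atTop_add_const_left _ _ tendsto_id
  · intro y hy
    have h1 : Tendsto (fun τ => σ τ 0 * v.1 + σ τ 1 * v.2) atBot (𝓝 (y 0 * v.1 + y 1 * v.2)) :=
      ((by fun_prop : Continuous fun y : E3 => y 0 * v.1 + y 1 * v.2).tendsto y).comp hy
    refine not_tendsto_nhds_of_tendsto_atBot ?_ _ h1
    have h2 : (fun τ => σ τ 0 * v.1 + σ τ 1 * v.2) = fun τ => (a.1 * v.1 + a.2 * v.2) + τ := by
      funext τ
      simp only [hσ, pt_zero, pt_one, Prod.fst_add, Prod.snd_add, Prod.smul_fst, Prod.smul_snd,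
        smul_eq_mul]
      linear_combination τ * hv.1
    rw [h2]
    exact tendsto_atBot_add_const_left _ _ tendsto_id
  · have h1 : boundaryAngle v (line a v 0) = boundaryAngle v x := by
      simp only [line, zero_smul, add_zero]
      rfl
    change pt (a + (0 : ℝ) • v) (x 2 + ε * (boundaryAngle v x - boundaryAngle v (line a v 0))) = x
    rw [h1, sub_self, mul_zero, add_zero, zero_smul, add_zero, ha, pt_proj]
  · intro τ hτ
    -- On the line the time to `q` stays at least the distance to `q`, unlike on the graph.
    have h1 : x 2 + ε * (boundaryAngle v x - boundaryAngle v (line a v τ)) = f (a + τ • v) := hτ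
    have h2 := hf.abs_sub_lt_boundaryAngle hq.1 hv (line a v τ)
    rw [show proj (line a v τ) = a + τ • v from rfl, ← h1] at h2
    have h3 : |x 2 + ε * (boundaryAngle v x - boundaryAngle v (line a v τ)) - q.2| =
        |ε * (x 2 - q.2) + (boundaryAngle v x - boundaryAngle v (line a v τ))| := by
      rw [show |x 2 + ε * (boundaryAngle v x -
        boundaryAngle v (line a v τ)) - q.2| = |ε| * |x 2 + ε * (boundaryAngle v x -
        boundaryAngle v (line a v τ)) - q.2| by rw [hε, one_mul], ← abs_mul]
      congr 1
      linear_combination (boundaryAngle v x - boundaryAngle v (line a v τ)) * hε2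
    rw [h3] at h2
    have h4 := (abs_lt.1 h2).1
    rw [hεs] at hcr
    linarith

end

/-! ### Causal curves in the domain of a spacelike graph -/

lemma exists_tendsto_of_monotone_bddAbove {g : ℝ → ℝ} (hg : Monotone g) {K : ℝ}
    (hK : ∀ s, g s ≤ K) : ∃ l, Tendsto g atTop (𝓝 l) :=
  ⟨_, tendsto_atTop_ciSup hg ⟨K, by rintro _ ⟨s, rfl⟩; exact hK s⟩⟩

lemma abs_div_radius_le {v : ℝ × ℝ} (hv : v.1 ^ 2 + v.2 ^ 2 = 1) (x : E3) :
    |(x 0 * v.1 + x 1 * v.2) / √(radiusSq x)| ≤ 1 := by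
  have hr := Real.sqrt_pos.2 (radiusSq_pos x)
  rw [abs_div, abs_of_pos hr, div_le_one hr]
  refine Real.le_sqrt_of_sq_le ?_
  rw [sq_abs, radiusSq_eq_add_sq hv x]
  nlinarith [sq_nonneg (lineDist v x)]

lemma IsUnorientedCausal.reverse {c : ℝ → E3} (hc : IsUnorientedCausal c) :
    IsUnorientedCausal fun s => c (-s) := by
  have hd : ∀ s, deriv (fun s => c (-s)) s = (-1 : ℝ) • deriv c (-s) := fun s => by
    rw [deriv_comp_neg, neg_one_smul]
  refine ⟨hc.contDiff.comp contDiff_neg, fun s => ?_, fun s => ?_, fun y hy => ?_, fun y hy => ?_⟩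
  · rw [hd, adsForm_smul_self]
    simpa using hc.causal (-s)
  · rw [hd]
    simpa using hc.deriv_ne (-s)
  · refine hc.atBot y ((hy.comp tendsto_neg_atBot_atTop).congr fun s => ?_)
    simp
  · refine hc.atTop y ((hy.comp tendsto_neg_atTop_atBot).congr fun s => ?_)
    simp

/-- A causal curve that runs towards a spacelike graph without reaching it ends at a boundary point
of the graph. -/
lemma IsSpacelikeGraphOn.not_mem_of_causal {f : ℝ × ℝ → ℝ} (hf : IsSpacelikeGraphOn f univ)
    {c : ℝ → E3} (hc : IsUnorientedCausal c) {ε : ℝ} (hε : |ε| = 1)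
    (htime : ∀ s, 0 < ε * deriv c s 2) (hmiss : ∀ s, 0 < ε * (f (proj (c s)) - c s 2)) :
    c 0 ∉ graphDomain f := by
  have hε2 : ε * ε = 1 := by rw [← abs_mul_abs_self, hε, one_mul]
  have hcd : ∀ s, HasDerivAt c (deriv c s) s := fun s =>
    (hc.contDiff.contDiffAt.differentiableAt (by simp)).hasDerivAt
  set τ : ℝ → ℝ := fun s => ε * c s 2 with hτ
  have hτd : ∀ s, HasDerivAt τ (ε * deriv c s 2) s := fun s =>
    ((EuclideanSpace.proj (𝕜 := ℝ) (2 : Fin 3) : E3 →L[ℝ] ℝ).hasFDerivAt.comp_hasDerivAt s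
      (hcd s)).const_mul ε
  have habs : ∀ s, |deriv c s 2| = ε * deriv c s 2 := fun s => by
    rw [← one_mul |_|, ← hε, ← abs_mul, abs_of_pos (htime s)]
  have hτm : Monotone τ := monotone_of_deriv_nonneg (fun s => (hτd s).differentiableAt) fun s => by
    rw [(hτd s).deriv]
    exact (htime s).le
  have hτK : ∀ s, τ s ≤ ε * f 0 + Real.pi := by
    intro s
    have h1 := hmiss s
    have h2 := hf.abs_sub_le_pi (proj (c s)) 0
    have h3 : ε * (f (proj (c s)) - f 0) ≤ Real.pi := by
      refine (le_abs_self _).trans ?_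
      rwa [abs_mul, hε, one_mul]
    simp only [hτ]
    linarith
  -- Time is monotone, and bounded by the oscillation of `f`.
  obtain ⟨τ', hτ'⟩ := exists_tendsto_of_monotone_bddAbove hτm hτK
  -- The distances to boundary points converge.
  have hmono : ∀ v : ℝ × ℝ, v.1 ^ 2 + v.2 ^ 2 = 1 →
      Monotone fun s => boundaryAngle v (c s) + τ s := by
    intro v hv
    have hd : ∀ s, HasDerivAt (fun s => boundaryAngle v (c s) + τ s) _ s := fun s =>
      (hasDerivAt_boundaryAngle hv (hcd s)).add (hτd s)
    refine monotone_of_deriv_nonneg (fun s => (hd s).differentiableAt) fun s => ?_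
    rw [(hd s).deriv]
    have h1 := abs_spaceForm_div_le_of_causal hv (hc.causal s)
    rw [habs] at h1
    have h2 := (abs_le.1 h1).2
    linarith
  have hangle : ∀ v : ℝ × ℝ, v.1 ^ 2 + v.2 ^ 2 = 1 →
      ∃ l, Tendsto (fun s => (c s 0 * v.1 + c s 1 * v.2) / √(radiusSq (c s))) atTop (𝓝 l) := by
    intro v hv
    obtain ⟨l, hl⟩ := exists_tendsto_of_monotone_bddAbove (hmono v hv)
      (K := Real.pi + (ε * f 0 + Real.pi)) fun s => add_le_add (Real.arccos_le_pi _) (hτK s)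
    have h1 : Tendsto (fun s => boundaryAngle v (c s)) atTop (𝓝 (l - τ')) :=
      (hl.sub hτ').congr fun s => by ring
    refine ⟨Real.cos (l - τ'), ((Real.continuous_cos.tendsto _).comp h1).congr fun s => ?_⟩
    have h2 := abs_le.1 (abs_div_radius_le hv (c s))
    exact Real.cos_arccos h2.1 h2.2
  obtain ⟨y₀, hy₀⟩ := hangle (1, 0) (by norm_num)
  obtain ⟨y₁, hy₁⟩ := hangle (0, 1) (by norm_num)
  simp only [mul_one, mul_zero, add_zero, zero_add] at hy₀ hy₁
  have hr : ∀ s, 0 < √(radiusSq (c s)) := fun s => Real.sqrt_pos.2 (radiusSq_pos _)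
  have hζ : Tendsto (fun s => (√(radiusSq (c s)))⁻¹ ^ 2) atTop (𝓝 (1 - y₀ ^ 2 - y₁ ^ 2)) := by
    refine ((tendsto_const_nhds.sub (hy₀.pow 2)).sub (hy₁.pow 2)).congr fun s => ?_
    have h1 := Real.sq_sqrt (radiusSq_pos (c s)).le
    have h2 := hr s
    have h3 : √(radiusSq (c s)) ^ 2 = 1 + c s 0 ^ 2 + c s 1 ^ 2 := by rw [h1, radiusSq]
    field_simp
    linear_combination h3
  have hζ0 : 0 ≤ 1 - y₀ ^ 2 - y₁ ^ 2 := ge_of_tendsto' hζ fun s => sq_nonneg _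
  have hinv : Tendsto (fun s => (√(radiusSq (c s)))⁻¹) atTop (𝓝 √(1 - y₀ ^ 2 - y₁ ^ 2)) :=
    ((Real.continuous_sqrt.tendsto _).comp hζ).congr fun s =>
      Real.sqrt_sq (inv_nonneg.2 (hr s).le)
  rcases hζ0.eq_or_lt with h0 | hpos
  swap
  · -- The curve converges in the open hemisphere.
    exfalso
    have hne : √(1 - y₀ ^ 2 - y₁ ^ 2) ≠ 0 := (Real.sqrt_pos.2 hpos).ne'
    have hlim : ∀ (i : Fin 3) (y : ℝ), Tendsto (fun s => c s i / √(radiusSq (c s))) atTop (𝓝 y) →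
        Tendsto (fun s => c s i) atTop (𝓝 (y / √(1 - y₀ ^ 2 - y₁ ^ 2))) := by
      intro i y hy
      refine (hy.div hinv hne).congr fun s => ?_
      have := hr s
      simp only [Pi.div_apply]
      field_simp
    have h2 : Tendsto (fun s => c s 2) atTop (𝓝 (ε * τ')) :=
      (hτ'.const_mul ε).congr fun s => by
        simp only [hτ]
        linear_combination (c s 2) * hε2
    have h3 := (continuous_pt.tendsto ((_, _), _)).comp
      (((hlim 0 y₀ hy₀).prodMk_nhds (hlim 1 y₁ hy₁)).prodMk_nhds h2)
    refine hc.atTop _ (h3.congr fun s => ?_)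
    exact pt_proj (c s)
  -- The curve converges to a boundary point.
  set v : ℝ × ℝ := (y₀, y₁) with hvdef
  have hv : v.1 ^ 2 + v.2 ^ 2 = 1 := by
    change y₀ ^ 2 + y₁ ^ 2 = 1
    linarith
  rw [← h0, Real.sqrt_zero] at hinv
  have hα : Tendsto (fun s => boundaryAngle v (c s)) atTop (𝓝 0) := by
    have h1 : Tendsto (fun s => (c s 0 * v.1 + c s 1 * v.2) / √(radiusSq (c s))) atTop (𝓝 1) := by
      have := (hy₀.mul_const y₀).add (hy₁.mul_const y₁)
      rw [show y₀ * y₀ + y₁ * y₁ = 1 by linarith] at this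
      refine this.congr fun s => ?_
      simp only [hvdef]
      ring
    have := (Real.continuous_arccos.tendsto 1).comp h1
    rwa [Real.arccos_one] at this
  -- The values of `f` along the curve converge too: their variation is controlled by time.
  have hfm : Monotone fun s => τ s - ε * f (proj (c s)) := by
    have hpd : ∀ s, HasDerivAt (fun s => proj (c s)) (proj (deriv c s)) s := fun s =>
      ((EuclideanSpace.proj (𝕜 := ℝ) (0 : Fin 3) : E3 →L[ℝ] ℝ).hasFDerivAt.comp_hasDerivAt s
      (hcd s)).prodMk ((EuclideanSpace.proj (𝕜 := ℝ) (1 : Fin 3) :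
        E3 →L[ℝ] ℝ).hasFDerivAt.comp_hasDerivAt s (hcd s))
    have hd : ∀ s, HasDerivAt (fun s => τ s - ε * f (proj (c s)))
        (ε * deriv c s 2 - ε * fderiv ℝ f (proj (c s)) (proj (deriv c s))) s := fun s =>
      (hτd s).sub (((hf.differentiable _).hasFDerivAt.comp_hasDerivAt s (hpd s)).const_mul ε)
    refine monotone_of_deriv_nonneg (fun s => (hd s).differentiableAt) fun s => ?_
    rw [(hd s).deriv]
    have h1 := abs_fderiv_le_of_causal hf (mem_univ (proj (c s))) (hc.causal s)
    rw [habs, ← one_mul |_|, ← hε, ← abs_mul] at h1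
    have h2 := (abs_le.1 h1).2
    linarith
  have hf0 : ∀ s, τ s - ε * f (proj (c s)) ≤ 0 := fun s => by
    have := hmiss s
    simp only [hτ]
    linarith
  obtain ⟨l, hl⟩ := exists_tendsto_of_monotone_bddAbove hfm hf0
  have hl0 : l ≤ 0 := le_of_tendsto' hl hf0
  have hflim : Tendsto (fun s => f (proj (c s))) atTop (𝓝 (ε * (τ' - l))) :=
    ((hτ'.sub hl).const_mul ε).congr fun s => by
      linear_combination f (proj (c s)) * hε2
  obtain ⟨q, hq⟩ := exists_boundaryPoint hv
  have hmem : ((q, ε * (τ' - l)) : Ein) ∈ boundaryAtInfinity (graph f) := by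
    refine ⟨?_, by change (q : EuclideanSpace ℝ (Fin 3)) 2 = 0; rw [hq.2]; simp⟩
    have hlim : Tendsto (fun s => toEin (pt (proj (c s)) (f (proj (c s))))) atTop
        (𝓝 (q, ε * (τ' - l))) := by
      refine Tendsto.prodMk_nhds (tendsto_subtype_rng.2 ?_) hflim
      rw [hq.2]
      have h1 := ((PiLp.continuous_toLp 2 (fun _ : Fin 3 => ℝ)).tendsto ![y₀, y₁, 0]).comp
        (f := fun s => ![c s 0 / √(radiusSq (c s)), c s 1 / √(radiusSq (c s)),
          (√(radiusSq (c s)))⁻¹]) (x := atTop) (by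
          rw [tendsto_pi_nhds]
          intro i
          fin_cases i
          · exact hy₀
          · exact hy₁
          · exact hinv)
      refine h1.congr fun s => ?_
      change _ = (√(radiusSq (c s)))⁻¹ • !₂[c s 0, c s 1, 1]
      ext i
      fin_cases i
      · simp [div_eq_inv_mul]
      · simp [div_eq_inv_mul]
      · simp
    exact mem_closure_of_tendsto hlim (Eventually.of_forall fun s => ⟨_, pt_mem_graph f _, rfl⟩)
  intro hE
  refine hE _ hmem ?_
  rw [CausallyRelated, hq.angle_eq, toEin_snd]
  -- From `c 0` to the limit, time varies at least as much as the distance to the limit, and the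
  -- boundary point of the graph lies beyond the limit of the curve.
  have h1 : boundaryAngle v (c 0) + τ 0 ≤ 0 + τ' :=
    ge_of_tendsto (hα.add hτ') ((eventually_ge_atTop 0).mono fun s hs => hmono v hv hs)
  have h2 : ε * (ε * (τ' - l) - c 0 2) ≤ |c 0 2 - ε * (τ' - l)| := by
    refine (le_abs_self _).trans ?_
    rw [abs_mul, hε, one_mul, abs_sub_comm]
  have h3 : ε * (ε * (τ' - l) - c 0 2) = τ' - l - τ 0 := by
    simp only [hτ]
    linear_combination (τ' - l) * hε2
  linarith

/-- The invisible domain from the boundary of an entire spacelike graph is its domain of dependence: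
the set of points such that all inextendible causal curves through them meet the graph. -/
lemma IsSpacelikeGraphOn.mem_graphDomain_iff {f : ℝ × ℝ → ℝ} (hf : IsSpacelikeGraphOn f univ)
    {x : E3} : x ∈ graphDomain f ↔
      ∀ σ, IsUnorientedCausal σ → σ 0 = x → ∃ s, σ s ∈ graph f := by
  constructor
  swap
  · intro h
    by_contra hx
    obtain ⟨σ, hσ, hσ0, hmiss⟩ := hf.exists_null_line hx
    obtain ⟨s, hs⟩ := h σ hσ hσ0
    exact hmiss s hs
  rintro hx c hc rfl
  by_contra! hmiss
  have hcc := hc.contDiff.continuous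
  have hd : Continuous (deriv c) := (contDiff_one_iff_deriv.1 hc.contDiff).2
  have h1 := exists_sign (f := fun s => deriv c s 2) (by fun_prop)
    fun s => time_ne_zero_of_causal (hc.causal s) (hc.deriv_ne s)
  have h2 := exists_sign (f := fun s => f (proj (c s)) - c s 2)
    ((hf.continuous.comp (continuous_proj.comp hcc)).sub (by fun_prop))
    fun s => fun h => hmiss s (by rw [sub_eq_zero] at h; exact h.symm)
  have hrev : ∀ s, deriv (fun s => c (-s)) s 2 = - deriv c (-s) 2 := fun s => by
    rw [deriv_comp_neg]; rfl
  -- According to the direction of time along the curve and to the side of the graph on which it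
  -- lies, the curve or the reversed curve runs towards the graph.
  rcases h1 with h1 | h1 <;> rcases h2 with h2 | h2
  · exact hf.not_mem_of_causal hc (ε := 1) (by simp) (by simpa using h1) (by simpa using h2) hx
  · refine hf.not_mem_of_causal hc.reverse (ε := -1) (by simp) (fun s => ?_) (fun s => ?_)
      (by simpa using hx)
    · rw [hrev]
      linarith [h1 (-s)]
    · linarith [h2 (-s)]
  · refine hf.not_mem_of_causal hc.reverse (ε := 1) (by simp) (fun s => ?_) (fun s => ?_)
      (by simpa using hx)
    · rw [hrev]
      linarith [h1 (-s)]
    · linarith [h2 (-s)]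
  · refine hf.not_mem_of_causal hc (ε := -1) (by simp) (fun s => ?_) (fun s => ?_) hx
    · linarith [h1 s]
    · linarith [h2 s]

section

variable {f : ℝ × ℝ → ℝ} (hf : IsSpacelikeGraphOn f univ)
include hf

lemma IsSpacelikeGraphOn.isCompact_boundary : IsCompact (boundaryAtInfinity (graph f)) := by
  have h : IsCompact ((univ : Set (Metric.sphere (0 : EuclideanSpace ℝ (Fin 3)) 1)) ×ˢ
      Icc (f 0 - Real.pi) (f 0 + Real.pi)) := isCompact_univ.prod isCompact_Icc
  refine h.of_isClosed_subset (isClosed_closure.inter ?_) ?_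
  · exact isClosed_eq (by fun_prop) continuous_const
  · rintro q ⟨hq, -⟩
    have h1 := (hf.abs_sub_le_angle_of_mem_closure hq 0).trans (InnerProductGeometry.angle_le_pi _ _)
    rw [abs_le] at h1
    exact ⟨mem_univ _, by linarith, by linarith⟩

lemma IsSpacelikeGraphOn.isOpen_graphDomain : IsOpen (graphDomain f) := by
  rw [isOpen_iff_mem_nhds]
  intro x hx
  have h := hf.isCompact_boundary.eventually_forall_of_forall_eventually (x₀ := x)
    (P := fun y q => ¬ CausallyRelated (toEin y) q) fun q hq => by
      have hang : Continuous fun z : E3 × Ein => InnerProductGeometry.angle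
          ((toEin z.1).1 : EuclideanSpace ℝ (Fin 3)) z.2.1 := by
        rw [continuous_iff_continuousAt]
        intro z
        have h0 : ∀ y : Metric.sphere (0 : EuclideanSpace ℝ (Fin 3)) 1,
            (y : EuclideanSpace ℝ (Fin 3)) ≠ 0 := fun y hy => by
          have := mem_sphere_zero_iff_norm.1 y.2
          rw [hy, norm_zero] at this
          exact zero_ne_one this
        have hc := continuous_toEin
        exact (InnerProductGeometry.continuousAt_angle
          (x := (((toEin z.1).1 : EuclideanSpace ℝ (Fin 3)), (z.2.1 : EuclideanSpace ℝ (Fin 3))))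
          (h0 _) (h0 _)).comp (f := fun z : E3 × Ein =>
            (((toEin z.1).1 : EuclideanSpace ℝ (Fin 3)), (z.2.1 : EuclideanSpace ℝ (Fin 3))))
          (((continuous_subtype_val.comp (continuous_fst.comp (hc.comp continuous_fst))).prodMk
            (by fun_prop)).continuousAt)
      have hopen : IsOpen {z : E3 × Ein | ¬ CausallyRelated (toEin z.1) z.2} := by
        simp only [CausallyRelated, not_le, toEin_snd]
        exact isOpen_lt (by fun_prop) hang
      exact hopen.mem_nhds (hx q hq)
  exact h

omit hf in
/-- The domain of a graph is a union of vertical intervals. -/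
lemma mem_graphDomain_of_uIcc {a : ℝ × ℝ} {t t' s : ℝ} (ht : pt a t ∈ graphDomain f)
    (ht' : pt a t' ∈ graphDomain f) (hs : s ∈ uIcc t t') : pt a s ∈ graphDomain f := by
  intro q hq
  have h1 := ht q hq
  have h2 := ht' q hq
  rw [CausallyRelated, not_le, toEin_snd, pt_two] at h1 h2 ⊢
  rw [toEin_fst_pt a t s] at h1
  rw [toEin_fst_pt a t' s] at h2
  refine lt_of_le_of_lt ?_ (max_lt h1 h2)
  obtain ⟨h3, h4⟩ := hs
  rcases le_total t t' with h | h
  · rw [inf_eq_left.2 h] at h3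
    rw [sup_eq_right.2 h] at h4
    exact abs_le_max_abs_abs (by linarith) (by linarith)
  · rw [inf_eq_right.2 h] at h3
    rw [sup_eq_left.2 h] at h4
    rw [max_comm]
    exact abs_le_max_abs_abs (by linarith) (by linarith)

lemma IsSpacelikeGraphOn.isConnected_graphDomain : IsConnected (graphDomain f) := by
  have hgraph : ∀ a, pt a (f a) ∈ graphDomain f := fun a => hf.graph_subset (pt_mem_graph f a)
  have hc : Continuous fun a => pt a (f a) := continuous_pt.comp (continuous_id.prodMk hf.continuous)
  refine ⟨⟨_, hgraph 0⟩, isPreconnected_of_forall (pt 0 (f 0)) fun x hx => ?_⟩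
  -- Join `x` to the graph, which is connected, by a vertical segment.
  refine ⟨range (fun a => pt a (f a)) ∪ (fun t => pt (proj x) t) '' uIcc (x 2) (f (proj x)),
    union_subset ?_ ?_, Or.inl ⟨0, rfl⟩, Or.inr ⟨x 2, left_mem_uIcc, pt_proj x⟩, ?_⟩
  · rintro _ ⟨a, rfl⟩
    exact hgraph a
  · rintro _ ⟨t, ht, rfl⟩
    exact mem_graphDomain_of_uIcc (by rwa [pt_proj]) (hgraph (proj x)) ht
  · refine IsPreconnected.union (pt (proj x) (f (proj x))) ⟨proj x, rfl⟩
      ⟨f (proj x), right_mem_uIcc, rfl⟩ (isPreconnected_range hc) ?_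
    refine isPreconnected_uIcc.image _ (Continuous.continuousOn ?_)
    exact continuous_pt.comp (continuous_const.prodMk continuous_id)

end

/-! ### Vertical lines and Cauchy surfaces -/

lemma isUnorientedCausal_vertical (x : E3) :
    IsUnorientedCausal fun s => pt (proj x) (x 2 + s) := by
  have hd : ∀ s, HasDerivAt (fun s => pt (proj x) (x 2 + s)) (pt 0 1) s := fun s =>
    ptL.hasFDerivAt.comp_hasDerivAt s ((hasDerivAt_const s (proj x)).prodMk
      ((hasDerivAt_id' s).const_add (x 2)))
  have hcoord : Continuous fun y : E3 => y 2 := by fun_prop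
  refine ⟨?_, fun s => ?_, fun s => ?_, fun y hy => ?_, fun y hy => ?_⟩
  · exact contDiff_pt.comp (contDiff_const.prodMk (contDiff_const.add contDiff_id))
  · rw [(hd s).deriv, adsForm_time _ _ _ rfl rfl]
    have := radiusSq_pos (pt (proj x) (x 2 + s))
    simpa using this.le
  · rw [(hd s).deriv]
    intro h
    have := congrArg (fun v : E3 => v 2) h
    simp at this
  · exact not_tendsto_nhds_of_tendsto_atTop
      (tendsto_atTop_add_const_left _ (x 2) tendsto_id) _ ((hcoord.tendsto y).comp hy)
  · exact not_tendsto_nhds_of_tendsto_atBot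
      (tendsto_atBot_add_const_left _ (x 2) tendsto_id) _ ((hcoord.tendsto y).comp hy)

section

variable {X : Type*} [TopologicalSpace X] {D : X → E3}

/-- Two points are joined by a lift of a vertical segment. -/
def VertJoined (D : X → E3) (x y : X) : Prop :=
  proj (D x) = proj (D y) ∧ ∃ c : ℝ → X, ContinuousOn c (uIcc (D x 2) (D y 2)) ∧
    (∀ t ∈ uIcc (D x 2) (D y 2), D (c t) = pt (proj (D x)) t) ∧ c (D x 2) = x ∧ c (D y 2) = y

lemma VertJoined.refl (D : X → E3) (x : X) : VertJoined D x x := by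
  refine ⟨rfl, fun _ => x, continuousOn_const, fun t ht => ?_, rfl, rfl⟩
  rw [uIcc_self, mem_singleton_iff] at ht
  rw [ht, pt_proj]

/-- Lifts of a vertical segment with the same end are equal, hence so are their origins. -/
lemma VertJoined.unique_left [T2Space X] (hD : IsLocalHomeomorph D) {x x' y : X}
    (h : VertJoined D x y) (h' : VertJoined D x' y) (hxx' : D x = D x') : x = x' := by
  obtain ⟨h1, c, hc, hl, hx, hy⟩ := h
  obtain ⟨h1', c', hc', hl', hx', hy'⟩ := h'
  rw [← hxx'] at hc' hl' hx'
  have := (T2Space.isSeparatedMap D).eqOn_of_comp_eqOn hD.isLocallyInjective isPreconnected_uIcc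
    hc hc' (fun t ht => by simp [hl t ht, hl' t ht]) right_mem_uIcc (hy.trans hy'.symm)
  rw [← hx, ← hx', this left_mem_uIcc]

/-- Vertical segments can be moved: their lifts are compact sets on which the developing map is
injective, so that it is injective on a neighborhood. -/
lemma VertJoined.eventually [T2Space X] (hD : IsLocalHomeomorph D) {x y : X}
    (h : VertJoined D x y) {η : ℝ × ℝ → X} {g : ℝ × ℝ → ℝ} (hη : ContinuousAt η (proj (D x)))
    (hg : ContinuousAt g (proj (D x))) (hηy : η (proj (D x)) = y)
    (hηg : ∀ᶠ a in 𝓝 (proj (D x)), D (η a) = pt a (g a)) :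
    ∀ᶠ z in 𝓝 x, VertJoined D z (η (proj (D z))) := by
  have : Nonempty X := ⟨x⟩
  obtain ⟨h1, c, hc, hl, hx, hy⟩ := h
  set K := c '' uIcc (D x 2) (D y 2) with hK
  have hKc : IsCompact K := isCompact_uIcc.image_of_continuousOn hc
  have hinj : InjOn D K := by
    rintro _ ⟨t, ht, rfl⟩ _ ⟨t', ht', rfl⟩ h
    rw [hl t ht, hl t' ht'] at h
    have : t = t' := congrArg (fun z : E3 => z 2) h
    rw [this]
  obtain ⟨V, hV, hVinj⟩ := hinj.exists_mem_nhdsSet hKc (fun x _ => hD.continuous.continuousAt)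
    fun x _ => by
      obtain ⟨U, hU, hxU, hUinj⟩ := hD.isLocallyInjective x
      exact ⟨U, hU.mem_nhds hxU, hUinj⟩
  -- On a neighborhood `V'` of the lifted segment, `D` has an inverse.
  obtain ⟨V', hV'o, hKV', hV'V⟩ := mem_nhdsSet_iff_exists.1 hV
  have hV'inj : InjOn D V' := hVinj.mono hV'V
  let e : OpenPartialHomeomorph X E3 := OpenPartialHomeomorph.ofContinuousOpen
    (hV'inj.toPartialEquiv D V') hD.continuous.continuousOn hD.isOpenMap hV'o
  have hes : e.source = V' := rfl
  have het : e.target = D '' V' := rfl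
  have heD : ∀ z, e z = D z := fun _ => rfl
  have hDe : ∀ z ∈ e.target, D (e.symm z) = z := fun z hz => e.right_inv hz
  have hDc : Continuous D := hD.continuous
  -- The segment from `D z` to `D (η (proj (D z)))`, and its interpolation.
  let seg : X → ℝ → E3 := fun z s =>
    pt (proj (D z)) ((1 - s) * D z 2 + s * g (proj (D z)))
  have hgy : g (proj (D x)) = D y 2 := by
    have := hηg.self_of_nhds
    rw [hηy] at this
    rw [this]
    rfl
  have hpc : ContinuousAt (fun z => proj (D z)) x := (continuous_proj.comp hDc).continuousAt
  have hseg : ∀ᶠ z in 𝓝 x, ∀ s ∈ Icc (0 : ℝ) 1, seg z s ∈ e.target := by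
    refine isCompact_Icc.eventually_forall_of_forall_eventually
      (P := fun z s => seg z s ∈ e.target) fun s hs => ?_
    have hcont : ContinuousAt (fun w : X × ℝ => seg w.1 w.2) (x, s) := by
      have h1 : ContinuousAt (fun w : X × ℝ => g (proj (D w.1))) (x, s) :=
        ContinuousAt.comp (f := fun w : X × ℝ => proj (D w.1)) (x := (x, s)) hg
          (ContinuousAt.comp (f := fun w : X × ℝ => w.1) (x := (x, s)) hpc continuousAt_fst)
      have h2 : ContinuousAt (fun w : X × ℝ => (1 - w.2) * D w.1 2) (x, s) := by
        fun_prop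
      have h3 : ContinuousAt (fun w : X × ℝ => proj (D w.1)) (x, s) :=
        ContinuousAt.comp (f := fun w : X × ℝ => w.1) (x := (x, s)) hpc continuousAt_fst
      exact continuous_pt.continuousAt.comp (f := fun w : X × ℝ => (proj (D w.1),
        (1 - w.2) * D w.1 2 + w.2 * g (proj (D w.1)))) (h3.prodMk (h2.add
          (continuousAt_snd.mul h1)))
    refine hcont (e.open_target.mem_nhds ?_)
    have ht : (1 - s) * D x 2 + s * D y 2 ∈ uIcc (D x 2) (D y 2) := by
      rw [← segment_eq_uIcc]
      exact ⟨1 - s, s, by linarith [hs.2], hs.1, by ring, by simp⟩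
    change pt (proj (D x)) ((1 - s) * D x 2 + s * g (proj (D x))) ∈ D '' V'
    rw [hgy, ← hl _ ht]
    exact ⟨_, hKV' ⟨_, ht, rfl⟩, rfl⟩
  have hxV : x ∈ V' := hKV' ⟨_, left_mem_uIcc, hx⟩
  have hyV : η (proj (D x)) ∈ V' := hηy ▸ hKV' ⟨_, right_mem_uIcc, hy⟩
  filter_upwards [hseg, hV'o.mem_nhds hxV, hpc.eventually hηg,
    (ContinuousAt.comp (f := fun z => proj (D z)) hη hpc) (hV'o.mem_nhds hyV)] with z hz hzV hzg hzη
  have hzη' : η (proj (D z)) ∈ V' := hzη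
  have h2 : D (η (proj (D z))) 2 = g (proj (D z)) := by rw [hzg, pt_two]
  have hmem : ∀ t ∈ uIcc (D z 2) (D (η (proj (D z))) 2), pt (proj (D z)) t ∈ e.target := by
    intro t ht
    rw [h2, ← segment_eq_uIcc] at ht
    obtain ⟨α, β, hα, hβ, hαβ, rfl⟩ := ht
    have := hz β ⟨hβ, by linarith⟩
    change pt (proj (D z)) ((1 - β) * D z 2 + β * g (proj (D z))) ∈ e.target at this
    rwa [show 1 - β = α by linarith] at this
  refine ⟨by rw [hzg, proj_pt], fun t => e.symm (pt (proj (D z)) t), ?_, fun t ht => hDe _ (hmem t ht),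
    ?_, ?_⟩
  · exact e.continuousOn_symm.comp
      (continuous_pt.comp (continuous_const.prodMk continuous_id)).continuousOn hmem
  · simp only [pt_proj]
    exact e.left_inv hzV
  · have h3 : pt (proj (D z)) (D (η (proj (D z))) 2) = D (η (proj (D z))) := by rw [h2, hzg]
    simp only [h3]
    exact e.left_inv hzη'

end

section

variable {M : AdSSpacetime.{u}} {X : Type*} [TopologicalSpace X] [T2Space X] {p : X → M}
  {D : X → E3}

/-- The vertical line through a point is a causal curve, and its maximal lift meets the preimage of
a Cauchy surface exactly once. -/
lemma IsDeveloped.existsUnique_vertJoined (hD : IsDeveloped M p D) (hp : IsCoveringMap p)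
    {S : Set M} (hS : M.IsCauchySurface S) (x : X) :
    ∃ y, (p y ∈ S ∧ VertJoined D x y) ∧ ∀ z, p z ∈ S → VertJoined D x z → z = y := by
  obtain ⟨J, c, hJ, hc, hmax, s, ⟨hsJ, hsS⟩, huniq⟩ :=
    hD.exists_lift_existsUnique_mem hp hS (isUnorientedCausal_vertical (D x)) (x := x)
      (by simp)
  have hsub : uIcc 0 s ⊆ J := hc.ordConnected.uIcc_subset hc.zero_mem hsJ
  have hDs : D (c s) = pt (proj (D x)) (D x 2 + s) := hc.lift s hsJ
  refine ⟨c s, ⟨hsS, by rw [hDs, proj_pt], fun t => c (t - D x 2), ?_, ?_, ?_, ?_⟩, ?_⟩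
  · refine hc.continuousOn.comp (by fun_prop) fun t ht => hsub ?_
    rw [hDs, pt_two] at ht
    rw [mem_uIcc] at ht ⊢
    rcases ht with ht | ht
    · exact Or.inl ⟨by linarith [ht.1], by linarith [ht.2]⟩
    · exact Or.inr ⟨by linarith [ht.1], by linarith [ht.2]⟩
  · intro t ht
    have : t - D x 2 ∈ J := by
      apply hsub
      rw [hDs, pt_two] at ht
      rw [mem_uIcc] at ht ⊢
      rcases ht with ht | ht
      · exact Or.inl ⟨by linarith [ht.1], by linarith [ht.2]⟩
      · exact Or.inr ⟨by linarith [ht.1], by linarith [ht.2]⟩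
    rw [hc.lift _ this]
    congr 1
    ring
  · simp only [sub_self, hc.zero]
  · simp only [hDs, pt_two, add_sub_cancel_left]
  · rintro z hzS ⟨h1, d, hd, hdl, hdx, hdz⟩
    set b := D z 2 - D x 2 with hb
    have hin : ∀ t ∈ uIcc 0 b, D x 2 + t ∈ uIcc (D x 2) (D z 2) := by
      intro t ht
      rw [mem_uIcc] at ht ⊢
      rcases ht with ht | ht
      · exact Or.inl ⟨by linarith [ht.1], by linarith [ht.2]⟩
      · exact Or.inr ⟨by linarith [ht.1], by linarith [ht.2]⟩
    have hlift : IsCurveLift D (fun s => pt (proj (D x)) (D x 2 + s)) x (uIcc 0 b)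
        fun t => d (D x 2 + t) :=
      ⟨ordConnected_uIcc, left_mem_uIcc, hd.comp (by fun_prop) hin, by rw [add_zero, hdx],
        fun t ht => hdl _ (hin t ht)⟩
    have hbJ := hmax b _ hlift
    have heq : c b = z := by
      rw [hc.eqOn hD.isLocalHomeomorph hlift ⟨hbJ, right_mem_uIcc⟩]
      simp only [hb, add_sub_cancel, hdz]
    rw [← heq, huniq b ⟨hbJ, by rwa [heq]⟩]

/-- The flow along vertical lines retracts a developed space to the preimage of a Cauchy surface. -/
lemma IsDeveloped.exists_retraction (hD : IsDeveloped M p D) (hp : IsCoveringMap p)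
    {S : Set M} (hS : M.IsCauchySurface S) :
    ∃ A : X → X, Continuous A ∧ (∀ x, p (A x) ∈ S) ∧ (∀ x, VertJoined D x (A x)) ∧
      ∀ x z, p z ∈ S → VertJoined D x z → z = A x := by
  choose A hA hAu using hD.existsUnique_vertJoined hp hS
  refine ⟨A, continuous_iff_continuousAt.2 fun x => ?_, fun x => (hA x).1, fun x => (hA x).2, hAu⟩
  obtain ⟨B, g, η, W, hB, -, hxB, hg, hη, hηx, hηg, -⟩ := hD.exists_local_graph hS.1 (hA x).1
  rw [← (hA x).2.1] at hxB hηx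
  have hBn := hB.mem_nhds hxB
  have hc : ContinuousAt (fun z => proj (D z)) x :=
    (continuous_proj.comp hD.isLocalHomeomorph.continuous).continuousAt
  have hev := (hA x).2.eventually hD.isLocalHomeomorph (hη.continuousAt hBn)
    (hg.contDiffOn.continuousOn.continuousAt hBn) hηx
    (by filter_upwards [hBn] with a ha using (hηg a ha).1)
  have heq : A =ᶠ[𝓝 x] fun z => η (proj (D z)) := by
    filter_upwards [hev, hc hBn] with z hz hzB
    exact (hAu z _ (hηg _ hzB).2 hz).symm
  exact (ContinuousAt.comp (f := fun z => proj (D z)) (hη.continuousAt hBn) hc).congr heq.symm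

/-- If the preimage of a Cauchy surface has a section over the whole plane, then it develops to an
entire spacelike graph, and the developing map is injective, with values in the domain of the
graph. -/
lemma IsDeveloped.exists_graph [ConnectedSpace X] (hD : IsDeveloped M p D) (hp : IsCoveringMap p)
    {S : Set M} (hS : M.IsCauchySurface S) {s : ℝ × ℝ → X} (hs : Continuous s)
    (hsD : ∀ a, proj (D (s a)) = a) (hsS : ∀ a, p (s a) ∈ S) :
    ∃ f, IsSpacelikeGraphOn f univ ∧ (∀ a, D (s a) = pt a (f a)) ∧ D '' (p ⁻¹' S) = graph f ∧
      Function.Injective D ∧ (∀ x, VertJoined D x (s (proj (D x)))) ∧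
      range D ⊆ graphDomain f := by
  obtain ⟨A, hAc, hAS, hAv, hAu⟩ := hD.exists_retraction hp hS
  have hDc := hD.isLocalHomeomorph.continuous
  set f : ℝ × ℝ → ℝ := fun a => D (s a) 2 with hf
  have hDs : ∀ a, D (s a) = pt a (f a) := by
    intro a
    rw [← pt_proj (D (s a)), hsD]
  -- The image of the section is open and closed in the preimage of the Cauchy surface.
  have hA : ∀ x, A x = s (proj (D x)) := by
    have hcl : IsClosed {x | A x = s (proj (D x))} :=
      isClosed_eq hAc (hs.comp (continuous_proj.comp hDc))
    have hop : IsOpen {x | A x = s (proj (D x))} := by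
      rw [isOpen_iff_mem_nhds]
      intro x hx
      obtain ⟨B, g, η, W, hB, -, hxB, hg, hη, hηx, hηg, hW, hWη⟩ :=
        hD.exists_local_graph hS.1 (hAS x)
      have h1 : ∀ᶠ z in 𝓝 x, A z ∈ W := hAc.continuousAt hW
      have h2 : ∀ᶠ z in 𝓝 x, s (proj (D z)) ∈ W :=
        (hs.comp (continuous_proj.comp hDc)).continuousAt
          (by rw [show A x = s (proj (D x)) from hx] at hW; exact hW)
      filter_upwards [h1, h2] with z hz1 hz2
      have e1 := (hWη _ hz1 (hAS z)).2
      have e2 := (hWη _ hz2 (hsS _)).2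
      rw [hsD] at e2
      rw [← (hAv z).1] at e1
      exact e1.trans e2.symm
    have hne : ({x | A x = s (proj (D x))} : Set X).Nonempty := by
      refine ⟨s 0, ?_⟩
      change A (s 0) = s (proj (D (s 0)))
      rw [hsD]
      exact (hAu _ _ (hsS 0) (VertJoined.refl D _)).symm
    have := IsClopen.eq_univ ⟨hcl, hop⟩ hne
    exact fun x => (this.symm ▸ mem_univ x : x ∈ {x | A x = s (proj (D x))})
  have hvert : ∀ x, VertJoined D x (s (proj (D x))) := fun x => hA x ▸ hAv x
  have himage : D '' (p ⁻¹' S) = graph f := by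
    ext z
    constructor
    · rintro ⟨x, hx, rfl⟩
      have h1 := hAu x x hx (VertJoined.refl D x)
      rw [hA] at h1
      have h2 := hDs (proj (D x))
      rw [← h1] at h2
      have := congrArg (fun z : E3 => z 2) h2
      exact this
    · intro hz
      refine ⟨s (proj z), hsS _, ?_⟩
      rw [hDs, ← show z 2 = f (proj z) from hz, pt_proj]
  have hfg : IsSpacelikeGraphOn f univ := by
    have hloc : ∀ a, ∃ (B : Set (ℝ × ℝ)) (g : ℝ × ℝ → ℝ), IsOpen B ∧ a ∈ B ∧
        IsSpacelikeGraphOn g B ∧ f =ᶠ[𝓝 a] g := by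
      intro a
      obtain ⟨B, g, η, W, hB, -, hxB, hg, -, -, hηg, hW, hWη⟩ :=
        hD.exists_local_graph hS.1 (hsS a)
      rw [hsD] at hxB
      refine ⟨B, g, hB, hxB, hg, ?_⟩
      filter_upwards [hs.continuousAt hW, hB.mem_nhds hxB] with b hb hbB
      have h1 := (hWη _ hb (hsS b)).2
      rw [hsD] at h1
      change D (s b) 2 = g b
      rw [h1, (hηg b hbB).1, pt_two]
    refine ⟨fun a _ => ?_, fun a _ q hq => ?_⟩
    · obtain ⟨B, g, hB, haB, hg, he⟩ := hloc a
      exact ((hg.contDiffOn.contDiffAt (hB.mem_nhds haB)).congr_of_eventuallyEq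
        he).contDiffWithinAt
    · obtain ⟨B, g, hB, haB, hg, he⟩ := hloc a
      have := hg.pos a haB q hq
      rw [he.fderiv_eq, he.self_of_nhds]
      exact this
  refine ⟨f, hfg, hDs, himage, ?_, hvert, ?_⟩
  -- Two points with the same image are joined to the same point of the section by lifts of the same
  -- vertical segment.
  · intro x x' hxx'
    have h' := hvert x'
    rw [← hxx'] at h'
    exact (hvert x).unique_left hD.isLocalHomeomorph h' hxx'
  · rintro _ ⟨x, rfl⟩
    rw [hfg.mem_graphDomain_iff]
    intro σ hσ hσ0
    -- The lift of a causal curve through `x` meets the preimage of the surface.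
    obtain ⟨J, c, -, hc, -, t, ⟨htJ, htS⟩, -⟩ :=
      hD.exists_lift_existsUnique_mem hp hS hσ hσ0.symm
    exact ⟨t, himage ▸ ⟨c t, htS, hc.lift t htJ⟩⟩

end

/-! ### Complete Cauchy surfaces develop to entire graphs -/

section

variable {M : AdSSpacetime.{u}} {X : Type*} [TopologicalSpace X] {p : X → M} {D : X → E3}

/-- The preimage of a spacelike surface is locally homeomorphic to the plane. -/
lemma IsDeveloped.isLocalHomeomorph_proj (hD : IsDeveloped M p D) {S : Set M}
    (hS : M.IsSpacelikeSurface S) :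
    IsLocalHomeomorph fun y : p ⁻¹' S => proj (D y) := by
  refine IsLocalHomeomorph.mk _ fun x => ?_
  obtain ⟨B, g, η, W, hB, -, hxB, hg, hη, hηx, hηg, hW, hWη⟩ := hD.exists_local_graph hS x.2
  obtain ⟨V, hVW, hV, hxV⟩ := mem_nhds_iff.1 hW
  classical
  let ζ : ℝ × ℝ → p ⁻¹' S := fun a => if h : a ∈ B then ⟨η a, (hηg a h).2⟩ else x
  have hζ : ∀ a ∈ B, (ζ a : X) = η a := fun a ha => by simp [ζ, ha]
  let e : OpenPartialHomeomorph (p ⁻¹' S) (ℝ × ℝ) :=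
    { toFun := fun y => proj (D y)
      invFun := ζ
      source := {y | (y : X) ∈ V}
      target := B ∩ η ⁻¹' V
      map_source' := fun y hy => by
        obtain ⟨h1, h2⟩ := hWη y (hVW hy) y.2
        refine ⟨h1, ?_⟩
        change η (proj (D y)) ∈ V
        rw [← h2]
        exact hy
      map_target' := fun a ha => by
        change (ζ a : X) ∈ V
        rw [hζ a ha.1]
        exact ha.2
      left_inv' := fun y hy => by
        obtain ⟨h1, h2⟩ := hWη y (hVW hy) y.2
        exact Subtype.ext ((hζ _ h1).trans h2.symm)
      right_inv' := fun a ha => by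
        rw [hζ a ha.1, (hηg a ha.1).1, proj_pt]
      open_source := hV.preimage continuous_subtype_val
      open_target := hη.isOpen_inter_preimage hB hV
      continuousOn_toFun := (continuous_proj.comp (hD.isLocalHomeomorph.continuous.comp
        continuous_subtype_val)).continuousOn
      continuousOn_invFun := by
        rw [continuousOn_iff_continuous_domRestrict]
        refine Continuous.subtype_mk (f := fun a : (B ∩ η ⁻¹' V : Set (ℝ × ℝ)) => η a) ?_
          (fun a => (hηg a a.2.1).2) |>.congr fun a => Subtype.ext (hζ a a.2.1).symm
        exact continuousOn_iff_continuous_domRestrict.1 (hη.mono inter_subset_left) }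
  exact ⟨e, hxV, fun y _ => rfl⟩

/-- A curve of the preimage of a spacelike surface develops to a curve as smooth as its projection
to the plane, because the surface develops locally to a graph. -/
lemma IsDeveloped.contDiffAt_of_proj (hD : IsDeveloped M p D) {S : Set M}
    (hS : M.IsSpacelikeSurface S) {c : ℝ → X} {J : Set ℝ} (hJ : IsOpen J) (hc : ContinuousOn c J)
    (hcS : ∀ s ∈ J, p (c s) ∈ S) {σ : ℝ → ℝ × ℝ} (hσ : ContDiff ℝ 1 σ)
    (hcσ : ∀ s ∈ J, proj (D (c s)) = σ s) {s : ℝ} (hs : s ∈ J) : ContDiffAt ℝ 1 (D ∘ c) s := by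
  obtain ⟨B, g, η, W, hB, -, hxB, hg, hη, hηx, hηg, hW, hWη⟩ := hD.exists_local_graph hS (hcS s hs)
  have hcs := hc.continuousAt (hJ.mem_nhds hs)
  rw [hcσ s hs] at hxB
  have h1 : ContDiffAt ℝ 1 (fun r => pt (σ r) (g (σ r))) s := by
    have h2 : ContDiffAt ℝ 1 (fun r => g (σ r)) s :=
      ContDiffAt.comp s (hg.contDiffOn.contDiffAt (hB.mem_nhds hxB)) hσ.contDiffAt
    exact contDiff_pt.contDiffAt.comp s (hσ.contDiffAt.prodMk h2)
  refine h1.congr_of_eventuallyEq ?_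
  filter_upwards [hcs hW, hJ.mem_nhds hs] with r hr hrJ
  obtain ⟨h2, h3⟩ := hWη _ hr (hcS r hrJ)
  rw [Function.comp_apply, h3, hcσ r hrJ, (hηg _ (hcσ r hrJ ▸ h2)).1]

/-- The curves of a spacelike surface that project to a straight line are not longer than their
projection, up to a constant that comes from the parametrization. -/
lemma IsDeveloped.distLT (hD : IsDeveloped M p D) {S : Set M}
    (hS : M.IsSpacelikeSurface S) {c : ℝ → X} {J : Set ℝ} (hJ : IsOpen J) (hJc : J.OrdConnected)
    (hc : ContinuousOn c J) (hcS : ∀ s ∈ J, p (c s) ∈ S) {a w : ℝ × ℝ}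
    (hcσ : ∀ s ∈ J, proj (D (c s)) = a + s • w) {r r' : ℝ} (hr : r ∈ J) (hr' : r' ∈ J) {ε : ℝ}
    (hε : √(w.1 ^ 2 + w.2 ^ 2) * Real.pi * |r' - r| < ε) :
    M.DistLT S (p (c r)) (p (c r')) ε := by
  -- A parametrization of the segment by the whole line, which stays in the segment.
  set θ : ℝ → ℝ := fun s => r + (r' - r) * Real.sin (Real.pi / 2 * s) ^ 2 with hθ
  have hθm : ∀ s, θ s ∈ J := by
    intro s
    refine hJc.uIcc_subset hr hr' ?_
    rw [← segment_eq_uIcc]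
    refine ⟨1 - Real.sin (Real.pi / 2 * s) ^ 2, Real.sin (Real.pi / 2 * s) ^ 2, ?_, sq_nonneg _,
      by ring, ?_⟩
    · linarith [Real.sin_sq_le_one (Real.pi / 2 * s)]
    · simp only [hθ, smul_eq_mul]
      ring
  have hθc : ContDiff ℝ 1 θ :=
    contDiff_const.add (contDiff_const.mul ((Real.contDiff_sin.comp
      (contDiff_const.mul contDiff_id)).pow 2))
  have hθd : ∀ s, HasDerivAt θ ((r' - r) * (Real.pi * (Real.sin (Real.pi / 2 * s) *
      Real.cos (Real.pi / 2 * s)))) s := by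
    intro s
    have h1 := ((((hasDerivAt_id' s).const_mul (Real.pi / 2)).sin.pow 2).const_mul
      (r' - r)).const_add r
    refine h1.congr_deriv ?_
    rw [show 2 - 1 = 1 from rfl, pow_one]
    push_cast
    ring
  have hDc : ∀ s, ContDiffAt ℝ 1 (D ∘ c ∘ θ) s := fun s =>
    (hD.contDiffAt_of_proj hS hJ hc hcS (σ := fun s => a + s • w) (by fun_prop) hcσ (hθm s)).comp s
      hθc.contDiffAt
  have hcc : ∀ s, ContinuousAt (c ∘ θ) s := fun s =>
    (hc.continuousAt (hJ.mem_nhds (hθm s))).comp hθc.continuous.continuousAt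
  refine ⟨p ∘ c ∘ θ, fun s => (hD.curve (hcc s) (hDc s)).1, ?_, ?_, fun s _ => hcS _ (hθm s), ?_⟩
  · simp [hθ]
  · simp [hθ]
  have hbound : ∀ s, √(M.metric ((p ∘ c ∘ θ) s) (M.velocity (p ∘ c ∘ θ) s)
      (M.velocity (p ∘ c ∘ θ) s)) ≤ √(w.1 ^ 2 + w.2 ^ 2) * Real.pi * |r' - r| := by
    intro s
    have h1 := (hD.curve (hcc s) (hDc s)).2.1
    have hd := ((hDc s).differentiableAt (by simp)).hasDerivAt
    have hi : ∀ i : Fin 3, HasDerivAt (fun s => D (c (θ s)) i) (deriv (D ∘ c ∘ θ) s i) s :=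
      fun i => (EuclideanSpace.proj (𝕜 := ℝ) i : E3 →L[ℝ] ℝ).hasFDerivAt.comp_hasDerivAt s hd
    set θ' := (r' - r) * (Real.pi * (Real.sin (Real.pi / 2 * s) *
      Real.cos (Real.pi / 2 * s))) with hθ'
    have e0 : deriv (D ∘ c ∘ θ) s 0 = θ' * w.1 := by
      refine (hi 0).unique ?_
      have : (fun s => D (c (θ s)) 0) = fun s => a.1 + θ s * w.1 := by
        funext s
        exact congrArg Prod.fst (hcσ _ (hθm s))
      rw [this]
      exact ((hθd s).mul_const _).const_add _
    have e1 : deriv (D ∘ c ∘ θ) s 1 = θ' * w.2 := by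
      refine (hi 1).unique ?_
      have : (fun s => D (c (θ s)) 1) = fun s => a.2 + θ s * w.2 := by
        funext s
        exact congrArg Prod.snd (hcσ _ (hθm s))
      rw [this]
      exact ((hθd s).mul_const _).const_add _
    have h2 := adsForm_le (D (c (θ s))) (deriv (D ∘ c ∘ θ) s)
    rw [e0, e1] at h2
    have hθ'b : |θ'| ≤ Real.pi * |r' - r| := by
      rw [hθ', abs_mul, abs_mul, abs_of_pos Real.pi_pos, abs_mul, mul_comm]
      gcongr
      have h3 := Real.abs_sin_le_one (Real.pi / 2 * s)
      have h4 := Real.abs_cos_le_one (Real.pi / 2 * s)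
      have h5 := abs_nonneg (Real.cos (Real.pi / 2 * s))
      calc Real.pi * (|Real.sin (Real.pi / 2 * s)| * |Real.cos (Real.pi / 2 * s)|)
          ≤ Real.pi * (1 * 1) := by gcongr
        _ = Real.pi := by ring
    refine (Real.sqrt_le_sqrt (h1.trans_le h2)).trans ?_
    rw [show (θ' * w.1) ^ 2 + (θ' * w.2) ^ 2 = (w.1 ^ 2 + w.2 ^ 2) * θ' ^ 2 by ring,
      Real.sqrt_mul (by positivity), Real.sqrt_sq_eq_abs, mul_assoc]
    gcongr
  refine lt_of_le_of_lt ?_ hε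
  have h := intervalIntegral.norm_integral_le_of_norm_le_const (a := 0) (b := 1)
    (f := fun s => √(M.metric ((p ∘ c ∘ θ) s) (M.velocity (p ∘ c ∘ θ) s)
      (M.velocity (p ∘ c ∘ θ) s))) (C := √(w.1 ^ 2 + w.2 ^ 2) * Real.pi * |r' - r|) (by
        intro s _
        rw [Real.norm_of_nonneg (Real.sqrt_nonneg _)]
        exact hbound s)
  rw [sub_zero, abs_one, mul_one] at h
  exact (le_abs_self _).trans h

/-- A Lipschitz curve of a complete surface has a limit at each end point of its domain. -/
lemma tendsto_of_complete {M : AdSSpacetime.{u}} {S : Set M} (hS : M.IsCompleteSurface S)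
    {k : ℝ → M} {J : Set ℝ} {L b : ℝ} (hb : b ∈ closure J) (hkS : ∀ s ∈ J, k s ∈ S)
    (hk : ∀ r ∈ J, ∀ r' ∈ J, ∀ ε, L * |r' - r| < ε → M.DistLT S (k r) (k r') ε) :
    ∃ y ∈ S, Tendsto k (𝓝[J] b) (𝓝 y) := by
  have hseq : ∀ u : ℕ → ℝ, (∀ n, u n ∈ J) → Tendsto u atTop (𝓝 b) →
      ∃ y ∈ S, Tendsto (k ∘ u) atTop (𝓝 y) := by
    intro u huJ hu
    refine hS (k ∘ u) (fun n => hkS _ (huJ n)) fun ε hε => ?_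
    have hcauchy := hu.cauchySeq
    obtain ⟨n₀, hn₀⟩ := Metric.cauchySeq_iff.1 hcauchy (ε / (|L| + 1)) (by positivity)
    refine ⟨n₀, fun m hm n hn => hk _ (huJ m) _ (huJ n) ε ?_⟩
    have h1 := hn₀ n hn m hm
    rw [Real.dist_eq, lt_div_iff₀ (by positivity)] at h1
    have h2 : L * |u n - u m| ≤ |L| * |u n - u m| := by
      gcongr
      exact le_abs_self L
    nlinarith [abs_nonneg (u n - u m)]
  obtain ⟨u, huJ, hu⟩ := mem_closure_iff_seq_limit.1 hb
  obtain ⟨y, hyS, hy⟩ := hseq u huJ hu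
  refine ⟨y, hyS, tendsto_of_seq_tendsto fun w hw => ?_⟩
  -- Interleave an arbitrary sequence with the sequence `u`.
  classical
  have hwJ : ∀ᶠ n in atTop, w n ∈ J := hw self_mem_nhdsWithin
  set w' : ℕ → ℝ := fun n => if w n ∈ J then w n else u n with hw'
  have hw'J : ∀ n, w' n ∈ J := by
    intro n
    by_cases h : w n ∈ J
    · simp [hw', h]
    · simpa [hw', h] using huJ n
  have hww' : w' =ᶠ[atTop] w := by
    filter_upwards [hwJ] with n hn
    simp [hw', hn]
  have hw'b : Tendsto w' atTop (𝓝 b) :=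
    (hw.mono_right nhdsWithin_le_nhds).congr' hww'.symm
  set z : ℕ → ℝ := fun n => if Even n then u (n / 2) else w' (n / 2) with hz
  have hdiv : Tendsto (fun n : ℕ => n / 2) atTop atTop :=
    Nat.tendsto_div_const_atTop (by norm_num)
  have hzb : Tendsto z atTop (𝓝 b) :=
    Tendsto.if' (hu.comp hdiv) (hw'b.comp hdiv)
  obtain ⟨y', -, hy'⟩ := hseq z (fun n => by
    by_cases h : Even n
    · simpa [hz, h] using huJ _
    · simpa [hz, h] using hw'J _) hzb
  have h1 : Tendsto (fun n : ℕ => 2 * n) atTop atTop :=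
    tendsto_id.const_mul_atTop' (by norm_num)
  have h2 : Tendsto (fun n : ℕ => 2 * n + 1) atTop atTop := (tendsto_add_atTop_nat 1).comp h1
  have e1 : y' = y := by
    refine tendsto_nhds_unique (hy'.comp h1) (hy.congr fun n => ?_)
    simp [hz]
  have e2 : Tendsto (k ∘ w') atTop (𝓝 y') := by
    refine (hy'.comp h2).congr fun n => ?_
    have h3 : ¬ Even (2 * n + 1) := by simp
    have h4 : (2 * n + 1) / 2 = n := by omega
    simp [hz, h4]
  rw [← e1]
  refine e2.congr' ?_
  filter_upwards [hww'] with n hn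
  simp [hn]

/-- Straight lines of the plane lift to the preimage of a complete surface. -/
lemma IsDeveloped.exists_line_lift [T2Space X] (hD : IsDeveloped M p D) (hp : IsCoveringMap p)
    {S : Set M} (hS : M.IsSpacelikeSurface S) (hcomp : M.IsCompleteSurface S) (x : p ⁻¹' S)
    (w : ℝ × ℝ) : ∃ c : ℝ → p ⁻¹' S, Continuous c ∧ c 0 = x ∧
      ∀ s, proj (D (c s)) = proj (D x) + s • w := by
  have hσ : Continuous fun s : ℝ => proj (D x) + s • w := by fun_prop
  obtain ⟨J, c, hJ, hc, hmax, -⟩ := exists_maximal_lift (hD.isLocalHomeomorph_proj hS) hσ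
    (x := x) (by simp)
  have hcX : ContinuousOn (fun s => (c s : X)) J :=
    continuous_subtype_val.comp_continuousOn hc.continuousOn
  suffices hJu : J = univ by
    rw [hJu] at hc
    exact ⟨c, continuousOn_univ.1 hc.continuousOn, hc.zero, fun s => hc.lift s (mem_univ s)⟩
  refine IsClopen.eq_univ ⟨isClosed_of_closure_subset fun b hb => ?_, hJ⟩ ⟨0, hc.zero_mem⟩
  -- Completeness gives a limit in `S` at an end point `b`, which lifts to `X`, against maximality.
  by_contra hbJ
  obtain ⟨y, hyS, hy⟩ := tendsto_of_complete hcomp (k := fun s => p (c s)) hb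
    (fun s _ => (c s).2) fun r hr r' hr' ε hε =>
      hD.distLT hS hJ hc.ordConnected hcX (fun s _ => (c s).2) hc.lift hr hr' hε
  have hne : (𝓝[J] b).NeBot := mem_closure_iff_nhdsWithin_neBot.1 hb
  obtain ⟨z, hzy, hz⟩ := exists_tendsto_of_covering hp (c := fun s => (c s : X)) (fun V hV => by
    obtain ⟨ε, hε, hV⟩ := Metric.mem_nhdsWithin_iff.1 hV
    refine ⟨Metric.ball b ε ∩ J, inter_mem (mem_nhdsWithin_of_mem_nhds
      (Metric.ball_mem_nhds b hε)) self_mem_nhdsWithin, hV, ?_, hcX.mono inter_subset_right⟩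
    refine OrdConnected.isPreconnected (OrdConnected.inter ?_ hc.ordConnected)
    exact (convex_ball b ε).ordConnected) hy
  refine hmax b hb hbJ ⟨z, show p z ∈ S from hzy ▸ hyS⟩ ?_
  exact tendsto_subtype_rng.2 hz

/-- The developed preimage of a complete Cauchy surface has a section over the whole plane. -/
lemma IsDeveloped.exists_section [T2Space X] [Nonempty X] (hD : IsDeveloped M p D)
    (hp : IsCoveringMap p) {S : Set M} (hS : M.IsCauchySurface S) (hcomp : M.IsCompleteSurface S) :
    ∃ s : ℝ × ℝ → X, Continuous s ∧ (∀ a, proj (D (s a)) = a) ∧ ∀ a, p (s a) ∈ S := by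
  obtain ⟨y, ⟨hyS, -⟩, -⟩ := hD.existsUnique_vertJoined hp hS (Classical.arbitrary X)
  set x : p ⁻¹' S := ⟨y, hyS⟩
  choose c hc hc0 hcl using hD.exists_line_lift hp hS.1 hcomp x
  have hsep : IsSeparatedMap fun y : p ⁻¹' S => proj (D y) := T2Space.isSeparatedMap _
  -- The lifts of the half-lines from a base point depend continuously on the direction.
  have h := (hD.isLocalHomeomorph_proj hS.1).continuous_lift hsep
    (A := ℝ × ℝ) ⟨fun z : unitInterval × (ℝ × ℝ) => proj (D x) + (z.1 : ℝ) • z.2, by fun_prop⟩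
    (g := fun z => c z.2 z.1) (funext fun z => hcl z.2 z.1)
    (by
      have : (fun a => c a ((0 : unitInterval) : ℝ)) = fun _ => x := funext fun a => hc0 a
      exact this ▸ continuous_const)
    fun a => (hc a).comp continuous_subtype_val
  refine ⟨fun a => c (a - proj (D x)) 1, ?_, fun a => ?_, fun a => (c _ 1).2⟩
  · have h1 : Continuous fun a : ℝ × ℝ => ((1 : unitInterval), a - proj (D x)) := by fun_prop
    exact continuous_subtype_val.comp (h.comp h1)
  · rw [hcl]
    simp

end

/-! ### Boundaries of graphs, and their isometries -/

/-- A half-line of the plane ends at the boundary point given by its direction. -/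
lemma tendsto_toEin_line {q : Metric.sphere (0 : EuclideanSpace ℝ (Fin 3)) 1} {v : ℝ × ℝ}
    (hv : IsBoundaryDirection q v) :
    Tendsto (fun τ : ℝ => (toEin (line 0 v τ)).1) atTop (𝓝 q) ∧
      Tendsto (fun τ : ℝ => boundaryAngle v (line 0 v τ)) atTop (𝓝 0) := by
  have hrad : ∀ τ, radiusSq (line 0 v τ) = 1 + τ ^ 2 := fun τ => by
    simp only [radiusSq, line, pt_zero, pt_one, zero_add, Prod.smul_fst, Prod.smul_snd, smul_eq_mul]
    linear_combination τ ^ 2 * hv.1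
  have hinv : Tendsto (fun τ : ℝ => (√(1 + τ ^ 2))⁻¹) atTop (𝓝 0) := by
    refine tendsto_inv_atTop_zero.comp (tendsto_atTop_mono (fun τ => ?_) tendsto_id)
    exact Real.le_sqrt_of_sq_le (by simp)
  have hdiv : Tendsto (fun τ : ℝ => τ / √(1 + τ ^ 2)) atTop (𝓝 1) := by
    have h1 : Tendsto (fun τ : ℝ => √(1 - (√(1 + τ ^ 2))⁻¹ ^ 2)) atTop (𝓝 √(1 - 0 ^ 2)) :=
      (Real.continuous_sqrt.tendsto _).comp (tendsto_const_nhds.sub (hinv.pow 2))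
    rw [show √(1 - 0 ^ 2) = (1 : ℝ) by simp] at h1
    refine h1.congr' ?_
    filter_upwards [eventually_ge_atTop 0] with τ hτ
    have hs := Real.sq_sqrt (show (0 : ℝ) ≤ 1 + τ ^ 2 by positivity)
    have hp : 0 < √(1 + τ ^ 2) := Real.sqrt_pos.2 (by positivity)
    rw [show 1 - (√(1 + τ ^ 2))⁻¹ ^ 2 = (τ / √(1 + τ ^ 2)) ^ 2 by
      field_simp
      rw [hs]
      ring, Real.sqrt_sq (by positivity)]
  constructor
  · refine tendsto_subtype_rng.2 ?_
    rw [hv.2]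
    have h1 := ((PiLp.continuous_toLp 2 (fun _ : Fin 3 => ℝ)).tendsto ![1 * v.1, 1 * v.2, 0]).comp
      (f := fun τ : ℝ => ![τ / √(1 + τ ^ 2) * v.1, τ / √(1 + τ ^ 2) * v.2, (√(1 + τ ^ 2))⁻¹])
      (x := atTop) (by
        rw [tendsto_pi_nhds]
        intro i
        fin_cases i
        · exact hdiv.mul_const _
        · exact hdiv.mul_const _
        · exact hinv)
    rw [one_mul, one_mul] at h1
    refine h1.congr fun τ => ?_
    rw [toEin_fst, hrad]
    ext i
    fin_cases i
    · simp [line, div_eq_inv_mul, mul_assoc]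
    · simp [line, div_eq_inv_mul, mul_assoc]
    · simp
  · have h1 := (Real.continuous_arccos.tendsto 1).comp hdiv
    rw [Real.arccos_one] at h1
    refine h1.congr fun τ => ?_
    rw [boundaryAngle, hrad, Function.comp_apply]
    congr 2
    simp only [line, pt_zero, pt_one, zero_add, Prod.smul_fst, Prod.smul_snd, smul_eq_mul]
    linear_combination (-τ) * hv.1

/-- A graph in the domain of another one has the same points at infinity. -/
lemma boundaryAtInfinity_subset {f f' : ℝ × ℝ → ℝ}
    (h : graph f' ⊆ graphDomain f) :
    boundaryAtInfinity (graph f) ⊆ boundaryAtInfinity (graph f') := by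
  intro q hq
  obtain ⟨v, hv⟩ := exists_boundaryDirection hq.2
  obtain ⟨h1, h2⟩ := tendsto_toEin_line hv
  refine ⟨mem_closure_of_tendsto (b := atTop)
    (f := fun τ : ℝ => toEin (pt (proj (line 0 v τ)) (f' (proj (line 0 v τ)))))
    (Tendsto.prodMk_nhds h1 ?_) (Eventually.of_forall fun τ => ⟨_, pt_mem_graph f' _, rfl⟩), hq.2⟩
  have h3 : ∀ τ : ℝ, |f' (proj (line 0 v τ)) - q.2| ≤ boundaryAngle v (line 0 v τ) := by
    intro τ
    have h4 := h (pt_mem_graph f' (proj (line 0 v τ))) q hq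
    rw [CausallyRelated, hv.angle_eq, not_le] at h4
    exact h4.le
  refine tendsto_iff_dist_tendsto_zero.2 (squeeze_zero (fun τ => dist_nonneg) (fun τ => ?_) h2)
  exact h3 τ

/-- Two entire graphs have the same domain as soon as each lies in the domain of the other. -/
lemma graphDomain_eq {f f' : ℝ × ℝ → ℝ} (h : graph f' ⊆ graphDomain f)
    (h' : graph f ⊆ graphDomain f') : graphDomain f = graphDomain f' := by
  unfold graphDomain
  rw [(boundaryAtInfinity_subset h).antisymm (boundaryAtInfinity_subset h')]

lemma IsUnorientedCausal.map {σ : ℝ → E3} (hσ : IsUnorientedCausal σ) {g : E3 ≃ₜ E3}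
    (hg : IsLinearLift g) : IsUnorientedCausal (g ∘ σ) := by
  have hd : ∀ s, deriv (g ∘ σ) s = fderiv ℝ g (σ s) (deriv σ s) := fun s =>
    fderiv_comp_deriv s ((hg.contDiff g.continuous (n := 1)).contDiffAt.differentiableAt (by simp))
      (hσ.contDiff.contDiffAt.differentiableAt (by simp))
  have hlim : ∀ (l : Filter ℝ) y, Tendsto (g ∘ σ) l (𝓝 y) → Tendsto σ l (𝓝 (g.symm y)) := by
    intro l y hy
    refine ((g.symm.continuous.tendsto y).comp hy).congr fun s => ?_
    simp
  refine ⟨(hg.contDiff g.continuous).comp hσ.contDiff, fun s => ?_, fun s h => ?_,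
    fun y hy => hσ.atTop _ (hlim _ _ hy), fun y hy => hσ.atBot _ (hlim _ _ hy)⟩
  · rw [hd, Function.comp_apply, hg.adsForm_fderiv g.continuous]
    exact hσ.causal s
  · rw [hd] at h
    refine hσ.deriv_ne s (eq_zero_of_adsForm (x := σ s) fun w => ?_)
    rw [← hg.adsForm_fderiv g.continuous, h]
    simp [adsForm, spaceForm]

/-- An isometry that preserves a spacelike graph preserves its domain of dependence. -/
lemma IsSpacelikeGraphOn.map_mem_graphDomain {f : ℝ × ℝ → ℝ} (hf : IsSpacelikeGraphOn f univ)
    {g : E3 ≃ₜ E3} (hg : IsLinearLift g) (hgf : ∀ x ∈ graph f, g x ∈ graph f) {x : E3}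
    (hx : x ∈ graphDomain f) : g x ∈ graphDomain f := by
  rw [hf.mem_graphDomain_iff] at hx ⊢
  intro σ hσ hσ0
  obtain ⟨s, hs⟩ := hx _ (hσ.map hg.symm) (by rw [Function.comp_apply, hσ0, g.symm_apply_apply])
  exact ⟨s, g.apply_symm_apply (σ s) ▸ hgf _ hs⟩

/-- A causal curve moves away from a boundary point at most as fast as time. -/
lemma IsUnorientedCausal.abs_boundaryAngle_sub_le {σ : ℝ → E3} (hσ : IsUnorientedCausal σ)
    {v : ℝ × ℝ} (hv : v.1 ^ 2 + v.2 ^ 2 = 1) (s s' : ℝ) :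
    |boundaryAngle v (σ s) - boundaryAngle v (σ s')| ≤ |σ s 2 - σ s' 2| := by
  have hσd : ∀ s, HasDerivAt σ (deriv σ s) s := fun s =>
    (hσ.contDiff.contDiffAt.differentiableAt (by simp)).hasDerivAt
  have htd : ∀ s, HasDerivAt (fun s => σ s 2) (deriv σ s 2) s := fun s =>
    (EuclideanSpace.proj (𝕜 := ℝ) (2 : Fin 3) : E3 →L[ℝ] ℝ).hasFDerivAt.comp_hasDerivAt s (hσd s)
  have hd : Continuous (deriv σ) := (contDiff_one_iff_deriv.1 hσ.contDiff).2
  obtain ⟨ε, hε, hpos⟩ : ∃ ε : ℝ, |ε| = 1 ∧ ∀ s, 0 < ε * deriv σ s 2 := by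
    rcases exists_sign (f := fun s => deriv σ s 2) (by fun_prop)
      fun s => time_ne_zero_of_causal (hσ.causal s) (hσ.deriv_ne s) with h | h
    · exact ⟨1, by simp, fun s => by simpa using h s⟩
    · exact ⟨-1, by simp, fun s => by linarith [h s]⟩
  have habs : ∀ s, |deriv σ s 2| = ε * deriv σ s 2 := fun s => by
    rw [← one_mul |_|, ← hε, ← abs_mul, abs_of_pos (hpos s)]
  have hmono : ∀ δ : ℝ, |δ| = 1 → Monotone fun s => ε * σ s 2 + δ * boundaryAngle v (σ s) := by
    intro δ hδ
    have hd : ∀ s, HasDerivAt (fun s => ε * σ s 2 + δ * boundaryAngle v (σ s)) _ s := fun s =>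
      ((htd s).const_mul ε).add ((hasDerivAt_boundaryAngle hv (hσd s)).const_mul δ)
    refine monotone_of_deriv_nonneg (fun s => (hd s).differentiableAt) fun s => ?_
    rw [(hd s).deriv]
    have h1 := abs_spaceForm_div_le_of_causal hv (hσ.causal s)
    rw [habs, ← one_mul |_|, ← hδ, ← abs_mul] at h1
    have h2 := (abs_le.1 h1).2
    linarith
  wlog hss : s' ≤ s generalizing s s'
  · rw [abs_sub_comm, abs_sub_comm (σ s 2)]
    exact this s' s (le_of_not_ge hss)
  have h1 := hmono 1 (by simp) hss
  have h2 := hmono (-1) (by simp) hss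
  have h3 : ε * (σ s 2 - σ s' 2) ≤ |σ s 2 - σ s' 2| := by
    refine (le_abs_self _).trans ?_
    rw [abs_mul, hε, one_mul]
  refine le_trans ?_ h3
  rw [abs_le]
  constructor <;> linarith

/-- The points of a spacelike graph that are causally related to a compact set of its domain lie
over a bounded set: otherwise they would accumulate at a boundary point, that would be causally
related to a point of the compact set. -/
lemma IsSpacelikeGraphOn.exists_bound {f : ℝ × ℝ → ℝ} (hf : IsSpacelikeGraphOn f univ)
    {K : Set E3} (hK : IsCompact K) (hKE : K ⊆ graphDomain f) :
    ∃ R, ∀ x ∈ graph f, ∀ k ∈ K, (∀ v : ℝ × ℝ, v.1 ^ 2 + v.2 ^ 2 = 1 →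
      |boundaryAngle v x - boundaryAngle v k| ≤ |x 2 - k 2|) → ‖proj x‖ ≤ R := by
  by_contra! hcon
  choose x hxf k hk hv hR using fun n : ℕ => hcon n
  -- Extract a subsequence along which the points of `K` and the images in `𝕊² × ℝ` converge.
  have hcomp : IsCompact (K ×ˢ ((univ : Set (Metric.sphere (0 : EuclideanSpace ℝ (Fin 3)) 1)) ×ˢ
      Icc (f 0 - Real.pi) (f 0 + Real.pi))) := hK.prod (isCompact_univ.prod isCompact_Icc)
  obtain ⟨⟨k', q⟩, ⟨hk', -⟩, φ, hφ, hlim⟩ := hcomp.tendsto_subseq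
    (x := fun n => (k n, toEin (x n))) fun n => by
      refine ⟨hk n, mem_univ _, ?_⟩
      change x n 2 ∈ _
      have h1 := hf.abs_sub_le_pi (proj (x n)) 0
      rw [show x n 2 = f (proj (x n)) from hxf n]
      rw [abs_le] at h1
      exact ⟨by linarith, by linarith⟩
  have hlk : Tendsto (fun n => k (φ n)) atTop (𝓝 k') := (continuous_fst.tendsto _).comp hlim
  have hlq : Tendsto (fun n => toEin (x (φ n))) atTop (𝓝 q) := (continuous_snd.tendsto _).comp hlim
  have hq2 : (q.1 : EuclideanSpace ℝ (Fin 3)) 2 = 0 := by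
    have h1 : Tendsto (fun n => ((toEin (x (φ n))).1 : EuclideanSpace ℝ (Fin 3)) 2) atTop
        (𝓝 ((q.1 : EuclideanSpace ℝ (Fin 3)) 2)) :=
      ((by fun_prop : Continuous fun q : Ein => (q.1 : EuclideanSpace ℝ (Fin 3)) 2).tendsto _).comp
        hlq
    refine tendsto_nhds_unique h1 ?_
    have h2 : Tendsto (fun n => ((φ n : ℕ) : ℝ)⁻¹) atTop (𝓝 0) :=
      tendsto_inv_atTop_zero.comp (tendsto_natCast_atTop_atTop.comp hφ.tendsto_atTop)
    refine squeeze_zero' (Eventually.of_forall fun n => ?_) ?_ h2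
    · rw [toEin_fst]
      simp
    · filter_upwards [hφ.tendsto_atTop.eventually_gt_atTop 0] with n hn
      rw [toEin_fst]
      simp only [PiLp.smul_apply, smul_eq_mul]
      change (√(radiusSq (x (φ n))))⁻¹ * 1 ≤ _
      rw [mul_one]
      have hn' : (0 : ℝ) < φ n := by exact_mod_cast hn
      refine inv_anti₀ hn' ((hR (φ n)).le.trans ?_)
      rw [Prod.norm_def]
      refine max_le ?_ ?_
      · refine Real.abs_le_sqrt ?_
        simp only [radiusSq, proj]
        nlinarith [sq_nonneg (x (φ n) 1)]
      · refine Real.abs_le_sqrt ?_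
        simp only [radiusSq, proj]
        nlinarith [sq_nonneg (x (φ n) 0)]
  have hqb : q ∈ boundaryAtInfinity (graph f) :=
    ⟨mem_closure_of_tendsto hlq (Eventually.of_forall fun n => ⟨_, hxf _, rfl⟩), hq2⟩
  obtain ⟨v, hvq⟩ := exists_boundaryDirection hq2
  refine hKE hk' q hqb ?_
  rw [CausallyRelated, hvq.angle_eq, toEin_snd]
  have hα : ∀ y : E3, boundaryAngle v y =
      Real.arccos (inner ℝ ((toEin y).1 : EuclideanSpace ℝ (Fin 3)) q.1) := by
    intro y
    rw [← hvq.angle_eq, InnerProductGeometry.angle, mem_sphere_zero_iff_norm.1 (toEin y).1.2,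
      mem_sphere_zero_iff_norm.1 q.1.2, mul_one, div_one]
  have h1 : Tendsto (fun n => boundaryAngle v (x (φ n))) atTop (𝓝 0) := by
    have h2 : Tendsto (fun n => Real.arccos (inner ℝ ((toEin (x (φ n))).1 :
        EuclideanSpace ℝ (Fin 3)) q.1)) atTop
        (𝓝 (Real.arccos (inner ℝ (q.1 : EuclideanSpace ℝ (Fin 3)) q.1))) := by
      have h3 : Continuous fun q' : Ein => Real.arccos (inner ℝ (q'.1 :
          EuclideanSpace ℝ (Fin 3)) q.1) :=
        Real.continuous_arccos.comp (by fun_prop)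
      exact (h3.tendsto q).comp hlq
    rw [real_inner_self_eq_norm_sq, mem_sphere_zero_iff_norm.1 q.1.2, one_pow,
      Real.arccos_one] at h2
    exact h2.congr fun n => (hα _).symm
  have h4 : Tendsto (fun n => boundaryAngle v (k (φ n))) atTop (𝓝 (boundaryAngle v k')) := by
    have h3 : Continuous (boundaryAngle v) := by
      rw [show boundaryAngle v = _ from funext hα]
      have := continuous_toEin
      exact Real.continuous_arccos.comp ((continuous_subtype_val.comp
        (continuous_fst.comp this)).inner continuous_const)
    exact (h3.tendsto _).comp hlk
  have h5 : Tendsto (fun n => x (φ n) 2) atTop (𝓝 q.2) := (continuous_snd.tendsto _).comp hlq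
  have h6 : Tendsto (fun n => k (φ n) 2) atTop (𝓝 (k' 2)) :=
    ((by fun_prop : Continuous fun y : E3 => y 2).tendsto _).comp hlk
  have h7 := le_of_tendsto_of_tendsto' (h1.sub h4).abs (h5.sub h6).abs
    fun n => hv (φ n) v hvq.1
  rw [zero_sub, abs_neg, abs_sub_comm] at h7
  exact (le_abs_self _).trans h7

/-! ### Isometries that preserve the direction of time -/

/-- The isometry `g` sends the future to the future. -/
def PreservesFuture (g : E3 → E3) : Prop := ∀ y, 0 < fderiv ℝ g y (pt 0 1) 2

lemma adsForm_pt_time_neg (y : E3) : adsForm y (pt 0 1) (pt 0 1) < 0 := by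
  rw [adsForm_time _ _ _ rfl rfl]
  have := radiusSq_pos y
  simpa using this

lemma pt_time_ne_zero : pt 0 1 ≠ 0 := fun h => by
  have := congrArg (fun v : E3 => v 2) h
  simp at this

lemma IsLinearLift.fderiv_ne_zero {g : E3 → E3} (hg : IsLinearLift g) (hc : Continuous g) {y w : E3}
    (hw : w ≠ 0) : fderiv ℝ g y w ≠ 0 := by
  intro h
  refine hw (eq_zero_of_adsForm (x := y) fun z => ?_)
  rw [← hg.adsForm_fderiv hc, h]
  simp [adsForm, spaceForm]

lemma PreservesFuture.time_pos {g : E3 → E3} (hgf : PreservesFuture g) (hg : IsLinearLift g)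
    (hc : Continuous g) {y w : E3} (hw : adsForm y w w ≤ 0) (hw2 : 0 < w 2) :
    0 < fderiv ℝ g y w 2 := by
  have hw0 : w ≠ 0 := by
    rintro rfl
    simp at hw2
  have h1 := adsForm_mul_time_neg hw hw0 (adsForm_pt_time_neg y)
  rw [pt_two, mul_one] at h1
  have h2 := adsForm_mul_time_neg (x := g y) (v := fderiv ℝ g y w) (w := fderiv ℝ g y (pt 0 1))
    (by rwa [hg.adsForm_fderiv hc]) (hg.fderiv_ne_zero hc hw0)
    (by rw [hg.adsForm_fderiv hc]; exact adsForm_pt_time_neg y)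
  rw [hg.adsForm_fderiv hc] at h2
  have h3 : adsForm y w (pt 0 1) < 0 := by
    by_contra h
    push Not at h
    exact absurd h1 (not_lt.2 (mul_nonneg h hw2.le))
  have h4 := pos_of_mul_neg_right h2 h3.le
  exact pos_of_mul_pos_left h4 (hgf y).le

/-- An isometry that preserves the direction of time of a single timelike vector preserves the
future, by connectedness. -/
lemma preservesFuture_of_exists {g : E3 → E3} (hg : IsLinearLift g) (hc : Continuous g) {y w : E3}
    (hw : adsForm y w w < 0) (hpos : 0 < w 2 * fderiv ℝ g y w 2) : PreservesFuture g := by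
  have hw0 : w ≠ 0 := by
    rintro rfl
    simp at hpos
  have hcont : Continuous fun y => fderiv ℝ g y (pt 0 1) 2 := by
    have h := ((hg.contDiff hc (n := 1)).continuous_fderiv (by simp)).clm_apply
      (continuous_const (y := pt 0 1))
    fun_prop
  rcases exists_sign hcont fun y => time_ne_zero_of_causal
    (by rw [hg.adsForm_fderiv hc]; exact (adsForm_pt_time_neg y).le)
    (hg.fderiv_ne_zero hc pt_time_ne_zero) with h | h
  · exact h
  exfalso
  have h1 := adsForm_mul_time_neg hw.le hw0 (adsForm_pt_time_neg y)
  rw [pt_two, mul_one] at h1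
  have h2 := adsForm_mul_time_neg (x := g y) (v := fderiv ℝ g y w) (w := fderiv ℝ g y (pt 0 1))
    (by rw [hg.adsForm_fderiv hc]; exact hw.le) (hg.fderiv_ne_zero hc hw0)
    (by rw [hg.adsForm_fderiv hc]; exact adsForm_pt_time_neg y)
  rw [hg.adsForm_fderiv hc] at h2
  have h3 := h y
  have h4 := mul_pos_of_neg_of_neg h1 h2
  have h5 : 0 < (adsForm y w (pt 0 1)) ^ 2 * (w 2 * fderiv ℝ g y w 2) := by
    refine mul_pos ?_ hpos
    have : adsForm y w (pt 0 1) ≠ 0 := fun h => by rw [h] at h1; simp at h1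
    positivity
  nlinarith

/-! ### Fixed points of isometries of finite order -/

/-- A future-preserving isometry of finite order with a fixed point `x` fixes pointwise a timelike
geodesic through `x`: it fixes the sum of the images of a timelike vector by its iterates. -/
lemma exists_fixed_geodesic {g : E3 ≃ₜ E3} (hg : IsLinearLift g) (hgf : PreservesFuture g) {x : E3}
    (hx : g x = x) {n : ℕ} (hn : 0 < n) (hgn : ∀ y, g^[n] y = y) :
    ∃ σ, IsUnorientedCausal σ ∧ σ 0 = x ∧ ∀ s, g (σ s) = σ s := by
  have hgd : ∀ y, DifferentiableAt ℝ g y := fun y =>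
    (hg.contDiff g.continuous (n := 1)).contDiffAt.differentiableAt (by simp)
  set L := fderiv ℝ g x with hL
  have hLn : L ^ n = 1 := by
    have h1 := (hgd x).hasFDerivAt.iterate hx n
    have h2 : g^[n] = id := funext hgn
    rw [h2] at h1
    exact h1.unique (hasFDerivAt_id x)
  have hLt : ∀ i, adsForm x ((L ^ i) (pt 0 1)) ((L ^ i) (pt 0 1)) < 0 ∧
      0 < (L ^ i) (pt 0 1) 2 := by
    intro i
    induction i with
    | zero => exact ⟨adsForm_pt_time_neg x, by simp⟩
    | succ i ih =>
      rw [pow_succ', mul_apply_eq_comp]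
      have h1 := hg.adsForm_fderiv g.continuous x ((L ^ i) (pt 0 1)) ((L ^ i) (pt 0 1))
      rw [hx] at h1
      exact ⟨h1.trans_lt ih.1, hgf.time_pos hg g.continuous ih.1.le ih.2⟩
  have hadd : ∀ v w : E3, (adsForm x v v < 0 ∧ 0 < v 2) → (adsForm x w w < 0 ∧ 0 < w 2) →
      (adsForm x (v + w) (v + w) < 0 ∧ 0 < (v + w) 2) := by
    rintro v w ⟨hv, hv2⟩ ⟨hw, hw2⟩
    have hv0 : v ≠ 0 := by
      rintro rfl
      simp at hv2
    have h1 := adsForm_mul_time_neg hv.le hv0 hw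
    have h2 : adsForm x v w < 0 := by
      by_contra h
      push Not at h
      exact absurd h1 (not_lt.2 (mul_nonneg h (mul_pos hv2 hw2).le))
    refine ⟨?_, by simpa using add_pos hv2 hw2⟩
    rw [adsForm_add_left, adsForm_comm x v, adsForm_comm x w, adsForm_add_left, adsForm_add_left,
      adsForm_comm x w v]
    linarith
  -- The sum of the images of a future timelike vector is timelike and fixed.
  set u := ∑ i ∈ Finset.range n, (L ^ i) (pt 0 1) with hu
  have hut : adsForm x u u < 0 ∧ 0 < u 2 := by
    rw [hu]
    exact Finset.sum_induction_nonempty _ (fun v => adsForm x v v < 0 ∧ 0 < v 2) hadd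
      ⟨0, Finset.mem_range.2 hn⟩ fun i _ => hLt i
  have hLu : L u = u := by
    have h1 : L u = ∑ i ∈ Finset.range n, (L ^ (i + 1)) (pt 0 1) := by
      rw [hu, map_sum]
      refine Finset.sum_congr rfl fun i _ => ?_
      rw [pow_succ', mul_apply_eq_comp]
    have h2 := Finset.sum_range_succ' (fun i => (L ^ i) (pt 0 1)) n
    rw [Finset.sum_range_succ, hLn, pow_zero] at h2
    rw [h1]
    exact (add_right_cancel h2).symm
  -- The geodesic `cos s P + sin s U` of the quadric, and its lift.
  set c := √(-adsForm x u u) with hc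
  have hcpos : 0 < c := Real.sqrt_pos.2 (by linarith [hut.1])
  have hcsq : c ^ 2 = -adsForm x u u := Real.sq_sqrt (by linarith [hut.1])
  set P := cover x with hP
  set U := fderiv ℝ cover x (c⁻¹ • u) with hU
  have hPP : Q P P = -1 := Q_cover x
  have hPU : Q P U = 0 := Q_cover_fderiv x _
  have hUU : Q U U = -1 := by
    rw [hU, Q_fderiv_cover, adsForm_smul_self]
    field_simp
    linarith
  set τ : ℝ → Fin 4 → ℝ := fun s => Real.cos s • P + Real.sin s • U with hτ
  have hτc : ContDiff ℝ 1 τ :=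
    (Real.contDiff_cos.smul contDiff_const).add (Real.contDiff_sin.smul contDiff_const)
  have hQ : ∀ a b : ℝ, Q (a • P + b • U) (a • P + b • U) = -(a ^ 2 + b ^ 2) := by
    intro a b
    have hUP : Q U P = 0 := by rw [Q_comm, hPU]
    simp only [map_add, map_smul, LinearMap.add_apply, LinearMap.smul_apply, hPP, hPU, hUU, hUP,
      smul_eq_mul]
    ring
  obtain ⟨σ, hσ, hσ0, hστ⟩ := exists_cover_lift τ hτc.continuous
    (fun s => by rw [hτ, hQ, Real.cos_sq_add_sin_sq]) (a := 0) (y := x) (by simp [hτ, hP])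
  have hσs : ContDiff ℝ 1 σ := contDiff_iff_contDiffAt.2 fun s =>
    contDiffAt_of_cover hσ.continuousAt (by simp only [hστ]; exact hτc.contDiffAt)
  have hderiv : ∀ s, adsForm (σ s) (deriv σ s) (deriv σ s) = -1 := by
    intro s
    have h1 : HasDerivAt τ (-Real.sin s • P + Real.cos s • U) s :=
      ((Real.hasDerivAt_cos s).smul_const P).add ((Real.hasDerivAt_sin s).smul_const U)
    have h2 : HasDerivAt (fun s => cover (σ s)) (fderiv ℝ cover (σ s) (deriv σ s)) s :=
      (cover_differentiable (σ s)).hasFDerivAt.comp_hasDerivAt s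
        (hσs.contDiffAt.differentiableAt (by simp)).hasDerivAt
    simp only [hστ] at h2
    rw [← Q_fderiv_cover, h2.unique h1, hQ]
    linarith [Real.sin_sq_add_cos_sq s, neg_sq (Real.sin s)]
  obtain ⟨A, hA, hgA⟩ := hg
  have hAP : A P = P := by rw [hP, ← hgA, hx]
  have hAU : A U = U := by
    have h1 : ∀ v, A (fderiv ℝ cover x v) = fderiv ℝ cover (g x) (L v) := by
      intro v
      rw [hL, ← fderiv_cover_comp (hgd x)]
      simp only [hgA]
      rw [fderiv_linear_cover]
    rw [hU, h1, hx, map_smul L, hLu]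
  -- Along a sequence of times that differ by `π`, the geodesic takes the values `P` and `-P`.
  have hlim : ∀ (l : Filter ℝ) (k : ℕ → ℝ), Tendsto k atTop l → (∀ n, τ (k n) = (-1 : ℝ) ^ n • P) →
      ∀ y, ¬ Tendsto σ l (𝓝 y) := by
    intro l k hk hkτ y hy
    have h1 : Tendsto (fun n => τ (k n)) atTop (𝓝 (cover y)) := by
      simp only [← hστ]
      exact ((contDiff_cover (n := 0)).continuous.tendsto y).comp (hy.comp hk)
    have h2 : Tendsto (fun n : ℕ => 2 * n) atTop atTop := tendsto_id.const_mul_atTop' (by norm_num)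
    have h3 := h1.comp h2
    have h4 := h1.comp ((tendsto_add_atTop_nat 1).comp h2)
    simp only [Function.comp_def, hkτ] at h3 h4
    have e3 : cover y = P := tendsto_nhds_unique h3 (by simp)
    have e4 : cover y = -P := tendsto_nhds_unique h4 (by simp [pow_succ])
    have e5 : P = 0 := by
      rw [e3] at e4
      exact self_eq_neg.1 e4
    rw [e5] at hPP
    simp at hPP
  refine ⟨σ, ⟨hσs, fun s => by rw [hderiv]; norm_num, fun s h => ?_, ?_, ?_⟩, hσ0, fun s => ?_⟩
  · have := hderiv s
    rw [h] at this
    simp [adsForm, spaceForm] at this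
  · refine hlim atTop (fun n => n * Real.pi) ?_ fun n => ?_
    · exact tendsto_natCast_atTop_atTop.atTop_mul_const Real.pi_pos
    · simp only [hτ, Real.sin_nat_mul_pi, zero_smul, add_zero, Real.cos_nat_mul_pi]
  · refine hlim atBot (fun n => -(n * Real.pi)) ?_ fun n => ?_
    · exact tendsto_neg_atTop_atBot.comp (tendsto_natCast_atTop_atTop.atTop_mul_const Real.pi_pos)
    · simp only [hτ, Real.sin_neg, Real.cos_neg, Real.sin_nat_mul_pi, neg_zero, zero_smul, add_zero,
        Real.cos_nat_mul_pi]
  · exact eqOn_of_cover_eqOn isPreconnected_univ (g.continuous.comp hσ).continuousOn hσ.continuousOn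
      (fun s _ => by simp [hgA, hστ, hτ, hAP, hAU]) (mem_univ 0)
      (by simp [hσ0, hx]) (mem_univ s)

/-! ### Deck transformations -/

section

variable {X B : Type*} [TopologicalSpace X] [T2Space X] [TopologicalSpace B] {p : X → B}

/-- A deck transformation is determined by the image of one point. -/
lemma deck_eq_of_apply_eq [PreconnectedSpace X] (hp : IsLocalHomeomorph p) {γ γ' : X ≃ₜ X}
    (hγ : ∀ x, p (γ x) = p x) (hγ' : ∀ x, p (γ' x) = p x) {x : X} (h : γ x = γ' x) : γ = γ' := by
  ext y
  exact (T2Space.isSeparatedMap p).eqOn_of_comp_eqOn hp.isLocallyInjective isPreconnected_univ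
    γ.continuous.continuousOn γ'.continuous.continuousOn (fun z _ => by simp [hγ, hγ'])
    (mem_univ x) h (mem_univ y)

/-- The deck transformations act properly discontinuously. -/
lemma finite_deck [PreconnectedSpace X] [LocallyConnectedSpace X] [T2Space B]
    (hp : IsLocalHomeomorph p) {C : Set X} (hC : IsCompact C) :
    {γ : X ≃ₜ X | (∀ x, p (γ x) = p x) ∧ ∃ x ∈ C, γ x ∈ C}.Finite := by
  have key : {γ : X ≃ₜ X | (∀ x, p (γ x) = p x) ∧ ∃ z ∈ C ×ˢ C, γ z.1 = z.2}.Finite := by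
    -- By compactness of `C × C`, it is enough to find near each pair `(x, y)` a product of
    -- neighborhoods such that finitely many deck transformations relate its factors.
    refine (hC.prod hC).induction_on
      (p := fun A => {γ : X ≃ₜ X | (∀ x, p (γ x) = p x) ∧ ∃ z ∈ A, γ z.1 = z.2}.Finite)
      (by simp) ?_ ?_ ?_
    · intro A A' hAA' hA'
      exact hA'.subset fun γ ⟨h1, z, hz, h2⟩ => ⟨h1, z, hAA' hz, h2⟩
    · intro A A' hA hA'
      refine (hA.union hA').subset ?_
      rintro γ ⟨h1, z, hz | hz, h2⟩
      · exact Or.inl ⟨h1, z, hz, h2⟩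
      · exact Or.inr ⟨h1, z, hz, h2⟩
    rintro ⟨x, y⟩ -
    by_cases hxy : p x = p y
    swap
    -- Over distinct points no deck transformation relates disjoint preimages.
    · obtain ⟨U, V, hU, hV, hxU, hyV, hUV⟩ := t2_separation hxy
      refine ⟨(p ⁻¹' U) ×ˢ (p ⁻¹' V), mem_nhdsWithin_of_mem_nhds (prod_mem_nhds
        (hp.continuous.continuousAt (hU.mem_nhds hxU))
        (hp.continuous.continuousAt (hV.mem_nhds hyV))), ?_⟩
      convert! finite_empty
      rw [eq_empty_iff_forall_notMem]
      rintro γ ⟨h1, ⟨z, w⟩, ⟨hz, hw⟩, h2⟩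
      refine disjoint_left.1 hUV hz ?_
      change γ z = w at h2
      change p w ∈ V at hw
      rwa [← h2, h1] at hw
    -- Over the same point, a deck transformation that relates a connected neighborhood of `x` to a
    -- sheet through `y` is the local section of this sheet, so that there is at most one.
    obtain ⟨e, hye, rfl⟩ := hp y
    have hxe : x ∈ e ⁻¹' e.target := by
      change e x ∈ e.target
      rw [hxy]
      exact e.map_source hye
    obtain ⟨U, ⟨hU, hxU, hUc⟩, hUe⟩ := (LocallyConnectedSpace.open_connected_basis x).mem_iff.1
      ((e.open_target.preimage hp.continuous).mem_nhds hxe)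
    refine ⟨U ×ˢ e.source, mem_nhdsWithin_of_mem_nhds (prod_mem_nhds (hU.mem_nhds hxU)
      (e.open_source.mem_nhds hye)), Set.Subsingleton.finite ?_⟩
    have huniq : ∀ γ : X ≃ₜ X, (∀ x, e (γ x) = e x) → (∃ z ∈ U ×ˢ e.source, γ z.1 = z.2) →
        γ x = e.symm (e x) := by
      rintro γ h1 ⟨⟨z, w⟩, ⟨hz, hw⟩, h2⟩
      change γ z = w at h2
      change w ∈ e.source at hw
      refine (T2Space.isSeparatedMap e).eqOn_of_comp_eqOn hp.isLocallyInjective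
        hUc.isPreconnected γ.continuous.continuousOn
        (e.continuousOn_symm.comp hp.continuous.continuousOn hUe) (fun u hu => ?_) hz ?_ hxU
      · simp [h1, e.right_inv (hUe hu)]
      · rw [Function.comp_apply, ← h1, e.left_inv (by rwa [h2])]
    rintro γ ⟨h1, h2⟩ γ' ⟨h1', h2'⟩
    exact deck_eq_of_apply_eq hp h1 h1' ((huniq γ h1 h2).trans (huniq γ' h1' h2').symm)
  refine key.subset ?_
  rintro γ ⟨h1, x, hx, h2⟩
  exact ⟨h1, (x, γ x), ⟨hx, h2⟩, rfl⟩

end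

/-! ### The action of the holonomy group -/

section

variable {M' : AdSSpacetime.{v}} {M : AdSSpacetime.{u}} {p : M' → M} {D : M' → E3}

lemma isDeveloped_of_covering (hp : IsUniversalCovering p)
    (hD : IsLocalIsometryOn M'.metric modelMetric D univ) : IsDeveloped M p D := by
  refine ⟨hp.covering.isLocalHomeomorph, fun x => ?_⟩
  obtain ⟨Φ, hx, -, hpΦ, -, hΦ⟩ := hp.isometry.exists_inverse isOpen_univ (mem_univ x)
  refine ⟨Φ.target, D ∘ Φ.symm, Φ.open_target, hpΦ hx ▸ Φ.map_source hx,
    hD.comp hΦ fun _ _ => mem_univ _, ?_⟩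
  filter_upwards [Φ.open_source.mem_nhds hx] with y hy
  rw [Function.comp_apply, hpΦ hy, Φ.left_inv hy]

lemma isDeveloped_id (hD : IsLocalIsometryOn M'.metric modelMetric D univ) :
    IsDeveloped M' id D :=
  ⟨(Homeomorph.refl M').isLocalHomeomorph, fun _ => ⟨univ, D, isOpen_univ, mem_univ _, hD,
    Eventually.of_forall fun _ => rfl⟩⟩

lemma isCoveringMap_id {X : Type*} [TopologicalSpace X] : IsCoveringMap (id : X → X) := by
  refine IsCoveringMap.mk _ (fun _ => PUnit.{1})
    (fun _ => { toOpenPartialHomeomorph := (Homeomorph.prodPUnit.{_, 0} X).symm.toOpenPartialHomeomorph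
                baseSet := univ
                open_baseSet := isOpen_univ
                source_eq := rfl
                target_eq := by simp
                proj_toFun := fun _ _ => rfl }) fun x => mem_univ x

/-- The global isometries of the universal anti-de Sitter space are lifts of linear maps. -/
lemma isLinearLift_of_isometry {g : E3 → E3} (hg : IsLocalIsometryOn modelMetric modelMetric g univ) :
    IsLinearLift g := by
  obtain ⟨k, hk, hgk⟩ := exists_isometry_extension isOpen_univ isPreconnected_univ hg univ_nonempty
  rwa [show g = k from funext fun x => hgk (mem_univ x)]

/-- The holonomy of a deck transformation preserves the direction of time. -/
lemma IsDeveloped.preservesFuture {X : Type*} [TopologicalSpace X] [PreconnectedSpace X]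
    [Nonempty X] {p : X → M} {D : X → E3} (hD : IsDeveloped M p D) {γ : X ≃ₜ X}
    (hγ : ∀ x, p (γ x) = p x) {g : E3 ≃ₜ E3} (hg : IsLinearLift g)
    (hγg : ∀ x, D (γ x) = g (D x)) : PreservesFuture g := by
  obtain ⟨T, hTc, hT0, hT⟩ := hD.exists_time
  obtain ⟨x⟩ := ‹Nonempty X›
  obtain ⟨U, φ, hU, hxU, hφ, hev⟩ := hD.chart x
  have hgi := hg.isLocalIsometryOn univ
  have h1 := hT x U φ hU hxU hφ hev
  have h2 := hT (γ x) U (g ∘ φ) hU (by rwa [hγ]) (hgi.comp hφ fun _ _ => mem_univ _) (by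
    have h3 : ∀ᶠ y in 𝓝 (γ x), γ.symm y ∈ {z | D z = φ (p z)} := by
      refine γ.symm.continuous.continuousAt ?_
      rw [γ.symm_apply_apply]
      exact hev
    filter_upwards [h3] with y hy
    have h4 : D (γ.symm y) = φ (p (γ.symm y)) := hy
    have h5 := hγg (γ.symm y)
    have h6 := hγ (γ.symm y)
    rw [γ.apply_symm_apply] at h5 h6
    rw [h5, h4, Function.comp_apply, h6])
  rw [hγ] at h2
  rw [mder_comp (hgi.mdifferentiableAt (mem_univ _)) (hφ.mdifferentiableAt hxU),
    mder_eq_fderiv] at h2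
  refine preservesFuture_of_exists hg g.continuous (y := φ (p x))
    (w := mder φ (p x) (timeVec M (p x))) ?_ ?_
  · rw [adsForm_mder hφ hxU]
    exact form_time M _
  · rw [← h1, ← h2]
    rcases exists_sign hTc hT0 with h | h
    · exact mul_pos (h _) (h _)
    · exact mul_pos_of_neg_of_neg (h _) (h _)

/-- A vertical segment shows that the point of a graph above or below `x` is causally related to
`x`, in a way that is invariant under isometries. -/
lemma abs_boundaryAngle_sub_le_of_vertical {g : E3 ≃ₜ E3} (hg : IsLinearLift g) (x : E3) (t : ℝ)
    {v : ℝ × ℝ} (hv : v.1 ^ 2 + v.2 ^ 2 = 1) :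
    |boundaryAngle v (g (pt (proj x) t)) - boundaryAngle v (g x)| ≤
      |g (pt (proj x) t) 2 - g x 2| := by
  have h := ((isUnorientedCausal_vertical x).map hg).abs_boundaryAngle_sub_le hv (t - x 2) 0
  simpa using h

/-- The holonomy group of a spacetime acts freely and properly discontinuously on the domain of a
surface that develops to an entire spacelike graph. -/
lemma actsFreelyProperlyOn {ρ : deckGroup p →* (universalAdS ≃ₜ universalAdS)}
    (hp : IsUniversalCovering p) (hD : IsDevelopingPair p D ρ) {S : Set M} {f : ℝ × ℝ → ℝ}
    (hf : IsSpacelikeGraphOn f univ) {s : ℝ × ℝ → M'} (hs : Continuous s)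
    (hsD : ∀ a, D (s a) = pt a (f a)) (hDS : D '' (p ⁻¹' S) = graph f)
    (hinj : Function.Injective D) : ActsFreelyProperlyOn ρ.range (graphDomain f) := by
  have hdev := isDeveloped_of_covering hp hD.developing
  have hloc := hp.covering.isLocalHomeomorph
  have hlin : ∀ γ, IsLinearLift (ρ γ) := fun γ => isLinearLift_of_isometry (hD.holonomy γ)
  have hgraph : ∀ γ, ∀ x ∈ graph f, ρ γ x ∈ graph f := by
    intro γ x hx
    rw [← hDS] at hx ⊢
    obtain ⟨y, hy, rfl⟩ := hx
    refine ⟨γ.1 y, ?_, hD.equivariant γ y⟩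
    change p (γ.1 y) ∈ S
    rw [γ.2 y]
    exact hy
  have hmaps : ∀ γ, ∀ x ∈ graphDomain f, ρ γ x ∈ graphDomain f := fun γ x hx =>
    hf.map_mem_graphDomain (g := ρ γ) (hlin γ) (hgraph γ) hx
  have hinvapp : ∀ (γ : deckGroup p) (x : E3), ρ γ (ρ γ⁻¹ x) = x := by
    intro γ x
    have h1 : ρ γ * ρ γ⁻¹ = 1 := by rw [← map_mul, mul_inv_cancel, map_one]
    exact DFunLike.congr_fun h1 x
  have hproper : ∀ K ⊆ graphDomain f, IsCompact K →
      {γ | γ ∈ ρ.range ∧ (γ '' K ∩ K).Nonempty}.Finite := by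
    intro K hKE hK
    obtain ⟨R, hR⟩ := hf.exists_bound hK hKE
    have : LocallyConnectedSpace M' := ChartedSpace.locallyConnectedSpace E3 M'
    -- The deck transformations involved move some point of this compact set to another one.
    have hC : IsCompact (s '' Metric.closedBall 0 R) :=
      (isCompact_closedBall 0 R).image hs
    have hfin := finite_deck hloc hC
    have hfin' : {γ : deckGroup p | ∃ x ∈ s '' Metric.closedBall 0 R,
        γ.1 x ∈ s '' Metric.closedBall 0 R}.Finite := by
      refine Set.Finite.of_finite_image (f := Subtype.val) (hfin.subset ?_)
        Subtype.val_injective.injOn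
      rintro _ ⟨γ, hγ, rfl⟩
      exact ⟨γ.2, hγ⟩
    refine (hfin'.image ρ).subset ?_
    rintro _ ⟨⟨γ, rfl⟩, k', ⟨k, hk, hkk'⟩, hk'⟩
    refine ⟨γ, ?_, rfl⟩
    -- The point of the graph on the vertical line of `k`, and its image.
    set x : E3 := pt (proj k) (f (proj k)) with hx
    have hxR : ‖proj x‖ ≤ R := by
      refine hR x (pt_mem_graph f _) k hk fun v hv => ?_
      exact abs_boundaryAngle_sub_le_of_vertical (g := Homeomorph.refl E3)
        ⟨ContinuousLinearMap.id ℝ _, fun _ _ => rfl, fun _ => rfl⟩ k _ hv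
    have hgx : ρ γ x ∈ graph f := hgraph γ x (pt_mem_graph f _)
    have hgxR : ‖proj (ρ γ x)‖ ≤ R := by
      refine hR _ hgx k' hk' fun v hv => ?_
      rw [← hkk']
      exact abs_boundaryAngle_sub_le_of_vertical (g := ρ γ) (hlin γ) k _ hv
    refine ⟨s (proj k), ⟨proj k, by simpa [hx] using hxR, rfl⟩, proj (ρ γ x), by simpa using hgxR, ?_⟩
    apply hinj
    have e1 : D (γ.1 (s (proj k))) = ρ γ x := by
      rw [hD.equivariant, hsD]
    rw [e1, hsD]
    have e2 : (show E3 from ρ γ x) 2 = f (proj (ρ γ x)) := hgx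
    rw [← e2]
    exact pt_proj _
  refine ⟨?_, ?_, hproper⟩
  · rintro _ ⟨γ, rfl⟩
    refine Subset.antisymm ?_ fun x hx => ⟨ρ γ⁻¹ x, hmaps γ⁻¹ x hx, hinvapp γ x⟩
    rintro _ ⟨x, hx, rfl⟩
    exact hmaps γ x hx
  · rintro _ ⟨γ, rfl⟩ x hx hfix
    -- The stabilizer of `x` is finite.
    have hfin := hproper {x} (singleton_subset_iff.2 hx) isCompact_singleton
    have hpow : ∀ n : ℕ, (ρ γ ^ n) x = x := by
      intro n
      induction n with
      | zero => rfl
      | succ n ih =>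
        rw [pow_succ]
        change (ρ γ ^ n) (ρ γ x) = x
        rw [hfix, ih]
    have hord : IsOfFinOrder (ρ γ) := by
      rw [← finite_powers]
      refine hfin.subset ?_
      rintro _ ⟨n, rfl⟩
      exact ⟨⟨γ ^ n, map_pow ρ γ n⟩, x, ⟨x, rfl, hpow n⟩, rfl⟩
    obtain ⟨n, hn, hgn⟩ := isOfFinOrder_iff_pow_eq_one.1 hord
    have hiter : ∀ (m : ℕ) y, (ρ γ ^ m) y = (ρ γ)^[m] y := by
      intro m
      induction m with
      | zero => intro y; rfl
      | succ m ih =>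
        intro y
        rw [pow_succ, Function.iterate_succ_apply, ← ih]
        rfl
    have hfut : PreservesFuture (ρ γ) :=
      hdev.preservesFuture (g := ρ γ) γ.2 (hlin γ) (hD.equivariant γ)
    obtain ⟨σ, hσ, hσ0, hσfix⟩ := exists_fixed_geodesic (g := ρ γ) (hlin γ) hfut hfix hn
      fun y => (hiter n y).symm.trans (DFunLike.congr_fun hgn y)
    -- A fixed geodesic meets the graph at a fixed point, which is the development of a point of the
    -- covering.
    obtain ⟨r, hr⟩ := hf.mem_graphDomain_iff.1 hx σ hσ hσ0
    rw [← hDS] at hr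
    obtain ⟨y, -, hy⟩ := hr
    have hγy : γ.1 y = y := by
      apply hinj
      rw [hD.equivariant, hy]
      exact hσfix r
    have hγ1 : γ = 1 := Subtype.ext
      (deck_eq_of_apply_eq hloc γ.2 (γ' := 1) (fun _ => rfl) hγy)
    rw [hγ1, map_one]

end

/-! ### Spacetimes covered by a domain of the universal anti-de Sitter space -/

/-- Future-oriented timelike vectors of the universal anti-de Sitter space. -/
def futureCone (x : E3) : Set E3 := {v | adsForm x v v < 0 ∧ 0 < v 2}

lemma adsForm_neg_of_mem_futureCone {x v w : E3} (hv : v ∈ futureCone x) (hw : w ∈ futureCone x) :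
    adsForm x v w < 0 := by
  have hv0 : v ≠ 0 := by
    rintro rfl
    simpa using hv.2
  have h1 := adsForm_mul_time_neg hv.1.le hv0 hw.1
  by_contra h
  push Not at h
  exact absurd h1 (not_lt.2 (mul_nonneg h (mul_pos hv.2 hw.2).le))

lemma add_mem_futureCone {x v w : E3} (hv : v ∈ futureCone x) (hw : w ∈ futureCone x) :
    v + w ∈ futureCone x := by
  have h2 := adsForm_neg_of_mem_futureCone hv hw
  refine ⟨?_, by simpa using add_pos hv.2 hw.2⟩
  have h3 := hv.1
  have h4 := hw.1
  rw [adsForm_add_left, adsForm_comm x v, adsForm_comm x w, adsForm_add_left, adsForm_add_left,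
    adsForm_comm x w v]
  linarith

lemma smul_mem_futureCone {x v : E3} (hv : v ∈ futureCone x) {a : ℝ} (ha : 0 < a) :
    a • v ∈ futureCone x := by
  refine ⟨?_, by simpa using mul_pos ha hv.2⟩
  rw [adsForm_smul_self]
  exact mul_neg_of_pos_of_neg (by positivity) hv.1

lemma convex_futureCone (x : E3) : Convex ℝ (futureCone x) := by
  refine convex_iff_forall_pos.2 fun v hv w hw a b ha hb _ => ?_
  exact add_mem_futureCone (smul_mem_futureCone hv ha) (smul_mem_futureCone hw hb)

lemma modelTime_eq (x : E3) : (modelTime x : E3) = pt 0 1 := by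
  refine PiLp.ext fun i => ?_
  change (EuclideanSpace.single (2 : Fin 3) (1 : ℝ) : E3) i = pt 0 1 i
  fin_cases i <;> simp [pt]

/-- The differential of a preferred chart at its base point is the identity, by definition of the
tangent space. -/
lemma mder_chartAt {Y : Type*} [TopologicalSpace Y] [ChartedSpace E3 Y] [IsManifold 𝓘(ℝ, E3) ∞ Y]
    (y : Y) (v : E3) : mder (chartAt E3 y) y v = v := by
  have : IsManifold 𝓘(ℝ, E3) 1 Y := IsManifold.of_le (n := ∞) (by simp)
  have h := mfderiv_chartAt_eq_tangentCoordChange (I := 𝓘(ℝ, E3)) (x := y) (y := y)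
    (mem_chart_source E3 y)
  have h2 := tangentCoordChange_self (I := 𝓘(ℝ, E3)) (x := y) (z := y) (v := v)
    (mem_extChartAt_source y)
  exact (congrArg (fun L : E3 →L[ℝ] E3 => L v) h).trans h2

/-- `q` presents `Y` as a quotient of the domain `Ω` of the universal anti-de Sitter space, up to
isometries that preserve the direction of time. -/
structure IsModelQuotient {Y : Type*} [TopologicalSpace Y] (q : E3 → Y) (Ω : Set E3) : Prop where
  isOpen : IsOpen Ω
  localHomeomorph : ∀ x ∈ Ω, ∃ e : OpenPartialHomeomorph E3 Y, x ∈ e.source ∧ e.source ⊆ Ω ∧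
    ∀ z ∈ e.source, e z = q z
  surjective : ∀ y, ∃ x ∈ Ω, q x = y
  exists_isometry : ∀ x ∈ Ω, ∀ x' ∈ Ω, q x = q x' → ∃ g : E3 ≃ₜ E3, IsLinearLift g ∧
    PreservesFuture g ∧ g x = x' ∧ ∀ᶠ z in 𝓝 x, q (g z) = q z

namespace IsModelQuotient

section

variable {Y : Type u} [TopologicalSpace Y] {q : E3 → Y} {Ω : Set E3}

/-- The inverse branches of `q`. -/
def branches (q : E3 → Y) (Ω : Set E3) : Set (OpenPartialHomeomorph Y E3) :=
  {k | k.target ⊆ Ω ∧ ∀ z ∈ k.target, k.symm z = q z}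

lemma exists_branch (h : IsModelQuotient q Ω) (y : Y) : ∃ k ∈ branches q Ω, y ∈ k.source := by
  obtain ⟨x, hx, rfl⟩ := h.surjective y
  obtain ⟨e, hxe, he, heq⟩ := h.localHomeomorph x hx
  exact ⟨e.symm, ⟨he, heq⟩, heq x hxe ▸ e.map_source hxe⟩

/-- The atlas of the inverse branches of `q`. -/
@[reducible] def chartedSpace (h : IsModelQuotient q Ω) : ChartedSpace E3 Y where
  atlas := branches q Ω
  chartAt y := (h.exists_branch y).choose
  mem_chart_source y := (h.exists_branch y).choose_spec.2
  chart_mem_atlas y := (h.exists_branch y).choose_spec.1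

lemma exists_transition (h : IsModelQuotient q Ω) {k : OpenPartialHomeomorph Y E3}
    (hk : k ∈ branches q Ω) {x : E3} (hx : x ∈ Ω) (hxk : q x ∈ k.source) :
    ∃ g : E3 ≃ₜ E3, IsLinearLift g ∧ PreservesFuture g ∧ g x = k (q x) ∧
      (∀ᶠ z in 𝓝 x, k (q z) = g z) ∧ ∀ᶠ z in 𝓝 x, q z = k.symm (g z) := by
  have h1 : k (q x) ∈ k.target := k.map_source hxk
  have h2 : q x = q (k (q x)) := by rw [← hk.2 _ h1, k.left_inv hxk]
  obtain ⟨g, hg, hgf, hgx, hev⟩ := h.exists_isometry x hx _ (hk.1 h1) h2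
  have h3 : ∀ᶠ z in 𝓝 x, g z ∈ k.target := by
    refine g.continuous.continuousAt.eventually (k.open_target.mem_nhds ?_)
    rwa [hgx]
  refine ⟨g, hg, hgf, hgx, ?_, ?_⟩
  · filter_upwards [hev, h3] with z hz hz'
    rw [← hz, ← hk.2 _ hz', k.right_inv hz']
  · filter_upwards [hev, h3] with z hz hz'
    rw [← hz, ← hk.2 _ hz']

lemma isManifold (h : IsModelQuotient q Ω) :
    letI := h.chartedSpace
    IsManifold 𝓘(ℝ, E3) ∞ Y := by
  let _ := h.chartedSpace
  refine isManifold_of_contDiffOn 𝓘(ℝ, E3) ∞ Y fun k k' hk hk' => ?_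
  intro x hx
  have hx1 : x ∈ k.target := by
    have := hx.1
    simp at this
    exact this.1
  have hx2 : k.symm x ∈ k'.source := by
    have := hx.1
    simp at this
    exact this.2
  rw [hk.2 _ hx1] at hx2
  obtain ⟨g, hg, -, -, hev, -⟩ := h.exists_transition hk' (hk.1 hx1) hx2
  have h1 : (𝓘(ℝ, E3) ∘ (k.symm ≫ₕ k') ∘ 𝓘(ℝ, E3).symm) =ᶠ[𝓝 x] g := by
    filter_upwards [hev, k.open_target.mem_nhds hx1] with z hz hz'
    simp [hk.2 z hz', hz]
  exact ((hg.contDiff g.continuous).contDiffAt.congr_of_eventuallyEq h1).contDiffWithinAt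

/-- The metric of the quotient, read in the preferred charts. -/
def metric (h : IsModelQuotient q Ω) :
    letI := h.chartedSpace
    ∀ y : Y, LinearMap.BilinForm ℝ (TangentSpace 𝓘(ℝ, E3) y) :=
  letI := h.chartedSpace
  fun y => modelMetric (chartAt E3 y y)

/-- Near `x` the map `q` is the composition of an isometry and the inverse of a preferred chart. -/
lemma exists_eq_chart (h : IsModelQuotient q Ω) {x : E3} (hx : x ∈ Ω) :
    letI := h.chartedSpace
    ∃ g : E3 ≃ₜ E3, IsLinearLift g ∧ PreservesFuture g ∧ g x = chartAt E3 (q x) (q x) ∧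
      q =ᶠ[𝓝 x] (chartAt E3 (q x)).symm ∘ g := by
  let _ := h.chartedSpace
  obtain ⟨g, hg, hgf, hgx, -, hev⟩ := h.exists_transition (chart_mem_atlas E3 (q x)) hx
    (mem_chart_source E3 (q x))
  exact ⟨g, hg, hgf, hgx, hev⟩

lemma isLocalIsometryOn_chart_symm (h : IsModelQuotient q Ω) (y : Y) :
    letI := h.chartedSpace
    IsLocalIsometryOn modelMetric h.metric (chartAt E3 y).symm {chartAt E3 y y} ∧
      ∀ v, mder (chartAt E3 y).symm (chartAt E3 y y) v = v := by
  let _ := h.chartedSpace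
  have := h.isManifold
  have hld : IsLocalDiffeomorphOn 𝓘(ℝ, E3) 𝓘(ℝ, E3) ∞ (chartAt E3 y).symm {chartAt E3 y y} := by
    rintro ⟨_, rfl⟩
    exact ⟨{ toPartialEquiv := (chartAt E3 y).symm.toPartialEquiv
             open_source := (chartAt E3 y).open_target
             open_target := (chartAt E3 y).open_source
             contMDiffOn_toFun := contMDiffOn_chart_symm
             contMDiffOn_invFun := contMDiffOn_chart }, mem_chart_target E3 y, fun _ _ => rfl⟩
  have hd := (hld ⟨_, rfl⟩).mdifferentiableAt (by simp)
  have hy : (chartAt E3 y).symm (chartAt E3 y y) = y := (chartAt E3 y).left_inv (mem_chart_source E3 y)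
  have hd2 : MDifferentiableAt 𝓘(ℝ, E3) 𝓘(ℝ, E3) (chartAt E3 y) y :=
    ((contMDiffOn_chart (I := 𝓘(ℝ, E3)) (n := ∞)).contMDiffAt
      ((chartAt E3 y).open_source.mem_nhds (mem_chart_source E3 y))).mdifferentiableAt (by simp)
  -- The differential of the chart at its base point is the identity, like that of its inverse.
  have hm : ∀ v, mder (chartAt E3 y).symm (chartAt E3 y y) v = v := by
    intro v
    have h1 := mder_comp (f := (chartAt E3 y).symm) (f' := chartAt E3 y) (by rwa [hy]) hd v
    have h2 : (chartAt E3 y ∘ (chartAt E3 y).symm) =ᶠ[𝓝 (chartAt E3 y y)] id := by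
      filter_upwards [(chartAt E3 y).open_target.mem_nhds (mem_chart_target E3 y)] with z hz
        using (chartAt E3 y).right_inv hz
    rw [mder_congr h2, mder_id, hy, mder_chartAt] at h1
    exact h1.symm
  refine ⟨⟨hld, ?_⟩, hm⟩
  rintro _ rfl v w
  have h1 := metric_congr h.metric hy v w
  refine Eq.trans ?_ h1
  exact congrArg₂ (fun a b : E3 =>
    (h.metric ((chartAt E3 y).symm (chartAt E3 y y)) : LinearMap.BilinForm ℝ E3) a b) (hm v) (hm w)

lemma isLocalIsometryOn (h : IsModelQuotient q Ω) :
    letI := h.chartedSpace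
    IsLocalIsometryOn modelMetric h.metric q Ω := by
  let _ := h.chartedSpace
  refine isLocalIsometryOn_of_local fun x hx => ?_
  obtain ⟨g, hg, -, hgx, hev⟩ := h.exists_eq_chart hx
  refine ⟨{x}, _, rfl, (h.isLocalIsometryOn_chart_symm (q x)).1.comp (hg.isLocalIsometryOn {x}) ?_,
    hev⟩
  rintro _ rfl
  exact hgx

/-- Future-oriented timelike tangent vectors of the quotient. -/
def futureCone (h : IsModelQuotient q Ω) :
    letI := h.chartedSpace
    ∀ y : Y, Set (TangentSpace 𝓘(ℝ, E3) y) :=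
  letI := h.chartedSpace
  fun y => AdS.futureCone (chartAt E3 y y)

lemma mder_mem_futureCone (h : IsModelQuotient q Ω) {x : E3} (hx : x ∈ Ω) :
    letI := h.chartedSpace
    mder q x (pt 0 1) ∈ h.futureCone (q x) := by
  let _ := h.chartedSpace
  obtain ⟨g, hg, hgf, hgx, hev⟩ := h.exists_eq_chart hx
  obtain ⟨h1, h2⟩ := h.isLocalIsometryOn_chart_symm (q x)
  rw [mder_congr hev, mder_comp (by rw [hgx]; exact h1.mdifferentiableAt rfl)
    ((hg.isLocalIsometryOn univ).mdifferentiableAt (mem_univ x)), hgx, h2, mder_eq_fderiv]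
  change _ ∈ AdS.futureCone (chartAt E3 (q x) (q x))
  rw [← hgx]
  exact ⟨by rw [hg.adsForm_fderiv g.continuous]; exact adsForm_pt_time_neg x, hgf x⟩

/-- A continuous time-orientation of the quotient, built from local ones by a partition of unity. -/
lemma exists_time [T2Space Y] [SecondCountableTopology Y] (h : IsModelQuotient q Ω) :
    letI := h.chartedSpace
    haveI := h.isManifold
    ∃ τ : ∀ y : Y, TangentSpace 𝓘(ℝ, E3) y,
      Continuous (fun y => (⟨y, τ y⟩ : TangentBundle 𝓘(ℝ, E3) Y)) ∧ ∀ y, τ y ∈ h.futureCone y := by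
  let _ := h.chartedSpace
  have := h.isManifold
  have : IsManifold 𝓘(ℝ, E3) 1 Y := IsManifold.of_le (n := ∞) (by simp)
  have : LocallyCompactSpace Y := ChartedSpace.locallyCompactSpace E3 Y
  have hΩ := h.isOpen
  have hiso := h.isLocalIsometryOn
  have hloc : ∀ y : Y, ∃ U ∈ 𝓝 y, ∃ s : ∀ z : Y, TangentSpace 𝓘(ℝ, E3) z,
      ContMDiffOn 𝓘(ℝ, E3) (𝓘(ℝ, E3).prod 𝓘(ℝ, E3)) 0
        (fun z => (⟨z, s z⟩ : TangentBundle 𝓘(ℝ, E3) Y)) U ∧ ∀ z ∈ U, s z ∈ h.futureCone z := by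
    intro y
    obtain ⟨x, hx, rfl⟩ := h.surjective y
    obtain ⟨Φ, hxΦ, hΦΩ, hqΦ, -, hΦ⟩ := hiso.exists_inverse hΩ hx
    have hqs : ∀ z ∈ Φ.target, q (Φ.symm z) = z := fun z hz => by
      rw [hqΦ (Φ.map_target hz), Φ.right_inv hz]
    refine ⟨Φ.target, Φ.open_target.mem_nhds (hqΦ hxΦ ▸ Φ.map_source hxΦ),
      fun z => mder q (Φ.symm z) (pt 0 1), ?_, fun z hz => ?_⟩
    · rw [contMDiffOn_zero_iff]
      have h1 : ContinuousOn (tangentMapWithin 𝓘(ℝ, E3) 𝓘(ℝ, E3) q Ω)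
          (Bundle.TotalSpace.proj ⁻¹' Ω) :=
        hiso.1.contMDiffOn.continuousOn_tangentMapWithin (by simp) hΩ.uniqueMDiffOn
      have h2 := h1.comp (modelTime_continuous.comp_continuousOn Φ.continuousOn_symm)
        fun z hz => hΦΩ (Φ.map_target hz)
      refine h2.congr fun z hz => ?_
      have h3 : mfderivWithin 𝓘(ℝ, E3) 𝓘(ℝ, E3) q Ω (Φ.symm z) = mder q (Φ.symm z) :=
        mfderivWithin_of_isOpen hΩ (hΦΩ (Φ.map_target hz))
      have h4 : tangentMapWithin 𝓘(ℝ, E3) 𝓘(ℝ, E3) q Ω ⟨Φ.symm z, modelTime (Φ.symm z)⟩ =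
          (⟨q (Φ.symm z), mder q (Φ.symm z) (pt 0 1)⟩ : TangentBundle 𝓘(ℝ, E3) Y) := by
        unfold tangentMapWithin
        rw [h3, modelTime_eq]
        rfl
      refine Eq.trans ?_ h4.symm
      rw [hqs z hz]
    · have h1 := h.mder_mem_futureCone (hΦΩ (Φ.map_target hz))
      have h2 : h.futureCone (q (Φ.symm z)) = h.futureCone z := by rw [hqs z hz]
      rwa [h2] at h1
  obtain ⟨τ, hτ⟩ := exists_contMDiffSection_forall_mem_convex_of_local (n := 0) 𝓘(ℝ, E3)
    (F_fiber := E3) (fun y : Y => TangentSpace 𝓘(ℝ, E3) y) h.futureCone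
    (fun y => convex_futureCone _) hloc
  exact ⟨τ, τ.contMDiff.continuous, hτ⟩

/-- The quotient is a spacetime, with the metric and the time-orientation of `q`. -/
theorem exists_spacetime [T2Space Y] [SecondCountableTopology Y] (h : IsModelQuotient q Ω)
    (hΩ : IsConnected Ω) : ∃ (N : AdSSpacetime.{u}) (e : Y ≃ₜ N),
      IsLocalIsometryOn modelMetric N.metric (e ∘ q) Ω ∧
      PreservesTimeOn (M := universalAdS) (N := N) (e ∘ q) Ω := by
  let _ := h.chartedSpace
  have := h.isManifold
  obtain ⟨τ, hτc, hτ⟩ := h.exists_time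
  have hiso := h.isLocalIsometryOn
  have hconn : ConnectedSpace Y := by
    have h1 : ContinuousOn q Ω := hiso.1.contMDiffOn.continuousOn
    have h2 := hΩ.image q h1
    rw [show q '' Ω = univ from eq_univ_of_forall fun y => h.surjective y] at h2
    exact connectedSpace_iff_univ.2 h2
  have hloc : ∀ y : Y, ∃ (U : Set Y) (φ : Y → E3), IsOpen U ∧ y ∈ U ∧
      IsLocalIsometryOn h.metric modelMetric φ U := by
    intro y
    obtain ⟨x, hx, rfl⟩ := h.surjective y
    obtain ⟨Φ, hxΦ, -, hqΦ, -, hΦ⟩ := hiso.exists_inverse h.isOpen hx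
    exact ⟨Φ.target, Φ.symm, Φ.open_target, hqΦ hxΦ ▸ Φ.map_source hxΦ, hΦ⟩
  have htime : ∀ y, h.metric y (τ y) (τ y) < 0 := fun y => by
    exact (modelMetric_apply _ _ _).trans_lt (hτ y).1
  let N : AdSSpacetime.{u} :=
    { carrier := Y
      metric := h.metric
      locallyAdS := hloc
      time := τ
      time_continuous := hτc
      time_timelike := htime }
  refine ⟨N, Homeomorph.refl Y, hiso, fun x hx => ?_⟩
  have h1 := adsForm_neg_of_mem_futureCone (h.mder_mem_futureCone hx) (hτ (q x))
  rw [← modelTime_eq x] at h1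
  exact (modelMetric_apply _ _ _).trans_lt h1

end

end IsModelQuotient

/-! ### The quotient of a domain by a group of isometries -/

/-- A group of future-preserving isometries that acts freely and properly discontinuously on a
domain has a Hausdorff quotient locally modeled on the universal anti-de Sitter space. -/
lemma exists_modelQuotient {G : Subgroup (E3 ≃ₜ E3)} {E : Set E3} (hE : IsOpen E)
    (hne : E.Nonempty) (hlin : ∀ γ ∈ G, IsLinearLift γ) (hfut : ∀ γ ∈ G, PreservesFuture γ)
    (hinv : ∀ γ ∈ G, ∀ x ∈ E, γ x ∈ E) (hfree : ∀ γ ∈ G, ∀ x ∈ E, γ x = x → γ = 1)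
    (hproper : ∀ K ⊆ E, IsCompact K → {γ | γ ∈ G ∧ (γ '' K ∩ K).Nonempty}.Finite) :
    ∃ (Y : Type) (_ : TopologicalSpace Y) (_ : T2Space Y) (_ : SecondCountableTopology Y)
      (q : E3 → Y), IsModelQuotient q E ∧
      ∀ x ∈ E, ∀ y ∈ E, q x = q y ↔ ∃ γ ∈ G, γ x = y := by
  classical
  let _ : MulAction G E :=
    { smul := fun γ x => ⟨γ.1 x.1, hinv γ.1 γ.2 x.1 x.2⟩
      one_smul := fun _ => rfl
      mul_smul := fun _ _ _ => rfl }
  have hsmul : ∀ (γ : G) (x : E), ((γ • x : E) : E3) = γ.1 x.1 := fun _ _ => rfl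
  have : ContinuousConstSMul G E :=
    ⟨fun γ => (γ.1.continuous.comp continuous_subtype_val).subtype_mk _⟩
  have : IsCancelSMul G E :=
    { left_cancel' := fun γ x y h => MulAction.injective γ h
      right_cancel' := fun γ γ' x h => by
        have h1 : (γ'⁻¹ * γ) • x = x := by rw [mul_smul, h, inv_smul_smul]
        have h2 := hfree (γ'⁻¹ * γ : G) (γ'⁻¹ * γ : G).2 x x.2 (congrArg Subtype.val h1)
        exact (inv_mul_eq_one.1 (Subtype.ext h2 : γ'⁻¹ * γ = 1)).symm }
  have : LocallyCompactSpace E := hE.locallyCompactSpace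
  have : ProperlyDiscontinuousSMul G E := by
    refine ⟨fun {K L} hK hL => ?_⟩
    have h1 := hproper (Subtype.val '' (K ∪ L)) (by rintro _ ⟨x, -, rfl⟩; exact x.2)
      ((hK.union hL).image continuous_subtype_val)
    refine Set.Finite.of_finite_image (f := Subtype.val) (h1.subset ?_)
      Subtype.val_injective.injOn
    rintro _ ⟨γ, ⟨_, ⟨x, hx, rfl⟩, hy⟩, rfl⟩
    exact ⟨γ.2, γ.1 x.1, ⟨x.1, ⟨x, Or.inl hx, rfl⟩, rfl⟩, ⟨γ • x, Or.inr hy, rfl⟩⟩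
  let Y := Quotient (MulAction.orbitRel G E)
  have hquot := isQuotientCoveringMap_quotientMk_of_properlyDiscontinuousSMul (G := G) (E := E)
  obtain ⟨x₀, hx₀⟩ := hne
  -- The values of `q` outside `E` do not matter.
  let q : E3 → Y := fun x => if h : x ∈ E then Quotient.mk _ ⟨x, h⟩ else Quotient.mk _ ⟨x₀, hx₀⟩
  have hq : ∀ x : E, q x = Quotient.mk _ x := fun x => dif_pos x.2
  have hfib : ∀ x ∈ E, ∀ y ∈ E, q x = q y ↔ ∃ γ ∈ G, γ x = y := by
    intro x hx y hy
    have h1 := hq ⟨x, hx⟩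
    have h2 := hq ⟨y, hy⟩
    rw [show q x = _ from h1, show q y = _ from h2, eq_comm, Quotient.eq]
    constructor
    · rintro ⟨γ, hγ⟩
      exact ⟨γ.1, γ.2, congrArg Subtype.val hγ⟩
    · rintro ⟨γ, hγ, h⟩
      exact ⟨⟨γ, hγ⟩, Subtype.ext h⟩
  refine ⟨Y, inferInstance, t2Space_of_properlyDiscontinuousSMul_of_t2Space,
    ContinuousConstSMul.secondCountableTopology, q, ⟨hE, ?_, ?_, ?_⟩, hfib⟩
  · intro x hx
    obtain ⟨e, hxe, he⟩ := hquot.isCoveringMap.isLocalHomeomorph ⟨x, hx⟩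
    have : Nonempty E := ⟨⟨x, hx⟩⟩
    let i := hE.isOpenEmbedding_subtypeVal.toOpenPartialHomeomorph Subtype.val
    have hi : ∀ z : E, i.symm z = z := fun z =>
      i.left_inv (show z ∈ i.source by simp [i])
    refine ⟨i.symm.trans e, ?_, ?_, ?_⟩
    · rw [OpenPartialHomeomorph.trans_source]
      refine ⟨by simp [i, hx], ?_⟩
      change i.symm (⟨x, hx⟩ : E) ∈ e.source
      rwa [hi]
    · rintro z ⟨hz, -⟩
      simpa [i] using hz
    · rintro z ⟨hz, -⟩
      have hz' : z ∈ E := by simpa [i] using hz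
      change e (i.symm (⟨z, hz'⟩ : E)) = q (⟨z, hz'⟩ : E)
      rw [hi, hq, ← he]
  · intro y
    obtain ⟨x, rfl⟩ := Quotient.exists_rep y
    exact ⟨x, x.2, hq x⟩
  · intro x hx x' hx' h
    obtain ⟨γ, hγ, rfl⟩ := (hfib x hx x' hx').1 h
    refine ⟨γ, hlin γ hγ, hfut γ hγ, rfl, ?_⟩
    filter_upwards [hE.mem_nhds hx] with z hz
    exact ((hfib z hz _ (hinv γ hγ z hz)).2 ⟨γ, hγ, rfl⟩).symm

/-- The quotient spacetime of a domain by a group of isometries. -/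
lemma exists_quotientSpacetime {G : Subgroup (universalAdS ≃ₜ universalAdS)} {E : Set E3}
    (hE : IsOpen E) (hconn : IsConnected E) (hlin : ∀ γ ∈ G, IsLinearLift γ)
    (hfut : ∀ γ ∈ G, PreservesFuture γ) (hG : ActsFreelyProperlyOn G E) :
    ∃ (N : AdSSpacetime.{0}) (π : universalAdS → N), IsQuotientSpacetime G E N π := by
  obtain ⟨Y, _, _, _, q, hq, hfib⟩ := exists_modelQuotient (G := G) hE hconn.nonempty hlin hfut
    (fun γ hγ x hx => by
      have := hG.invariant γ hγ
      rw [← this]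
      exact ⟨x, hx, rfl⟩) hG.free hG.proper
  obtain ⟨N, e, hiso, htime⟩ := hq.exists_spacetime hconn
  refine ⟨N, e ∘ q, hiso, htime, ?_, fun x hx y hy => ?_⟩
  · refine eq_univ_of_forall fun y => ?_
    obtain ⟨x, hx, hxy⟩ := hq.surjective (e.symm y)
    exact ⟨x, hx, (congrArg e hxy).trans (e.apply_symm_apply y)⟩
  · exact e.injective.eq_iff.trans (hfib x hx y hy)

/-! ### The embedding -/

section

variable {M' : AdSSpacetime.{v}} {M : AdSSpacetime.{u}} {p : M' → M}

lemma surjective_of_universalCovering (hp : IsUniversalCovering p) : Function.Surjective p := by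
  intro y
  have : LocallyPathConnectedSpace M := ChartedSpace.locallyPathConnectedSpace E3 M
  have : PathConnectedSpace M := PathConnectedSpace.of_locallyPathConnectedSpace
  obtain ⟨x⟩ := M'.connected.toNonempty
  let γ := PathConnectedSpace.somePath (p x) y
  obtain ⟨Γ, hΓ, -⟩ := hp.covering.exists_path_lifts γ.toContinuousMap x (by simp)
  refine ⟨Γ 1, ?_⟩
  have := congrFun hΓ 1
  simpa using this

/-- The deck transformations act transitively on the fibers of the universal covering. -/
lemma exists_deck (hp : IsUniversalCovering p) {x y : M'} (h : p x = p y) :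
    ∃ γ : deckGroup p, γ.1 x = y := by
  have := hp.simplyConnected
  have : LocallyPathConnectedSpace M' := ChartedSpace.locallyPathConnectedSpace E3 M'
  have key : ∀ x y : M', p x = p y → ∃ F : C(M', M'), F x = y ∧ p ∘ F = p := fun x y h =>
    (hp.covering.existsUnique_continuousMap_lifts ⟨p, hp.covering.continuous⟩ x y h.symm).exists
  obtain ⟨F, hF, hpF⟩ := key x y h
  obtain ⟨F', hF', hpF'⟩ := key y x h.symm
  have hid : ∀ (A B : C(M', M')) (z : M'), A (B z) = z → p ∘ A = p → p ∘ B = p →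
      ∀ w, A (B w) = w := by
    intro A B z hz hA hB w
    refine congrFun (hp.covering.eq_of_comp_eq (g₁ := A ∘ B) (g₂ := id) (by fun_prop)
      continuous_id ?_ z hz) w
    rw [← Function.comp_assoc, hA, hB]
    rfl
  refine ⟨⟨⟨⟨F, F', hid F' F x (by rw [hF, hF']) hpF' hpF,
    hid F F' y (by rw [hF', hF]) hpF hpF'⟩, by fun_prop, by fun_prop⟩, fun z => congrFun hpF z⟩, hF⟩

/-- An injective developing map with values in `E` induces an embedding of the spacetime in the
quotient of `E` by the holonomy group. -/
lemma exists_isometricEmbedding {D : M' → universalAdS}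
    {ρ : deckGroup p →* (universalAdS ≃ₜ universalAdS)} (hp : IsUniversalCovering p)
    (hD : IsDevelopingPair p D ρ) (hinj : Function.Injective D) {E : Set universalAdS}
    (hDE : range D ⊆ E) {N : AdSSpacetime.{0}} {π : universalAdS → N}
    (hπ : IsQuotientSpacetime ρ.range E N π) : ∃ F : M → N, IsIsometricEmbedding F := by
  -- The embedding is `π ∘ D ∘ s`, where `s` is any section of `p`, continuous or not.
  obtain ⟨s, hs⟩ := (surjective_of_universalCovering hp).hasRightInverse
  have hF : ∀ x, π (D (s (p x))) = π (D x) := by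
    intro x
    obtain ⟨γ, hγ⟩ := exists_deck hp (hs (p x))
    rw [hπ.fibers _ (hDE (mem_range_self _)) _ (hDE (mem_range_self _))]
    exact ⟨ρ γ, ⟨γ, rfl⟩, by rw [← hD.equivariant, hγ]⟩
  have hiso : IsLocalIsometry (fun y => π (D (s y))) := by
    refine isLocalIsometryOn_of_local fun y _ => ?_
    obtain ⟨x, rfl⟩ := surjective_of_universalCovering hp y
    obtain ⟨Φ, hxΦ, -, hpΦ, -, hΦ⟩ := hp.isometry.exists_inverse isOpen_univ (mem_univ x)
    have hxt : p x ∈ Φ.target := hpΦ hxΦ ▸ Φ.map_source hxΦ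
    refine ⟨Φ.target, π ∘ D ∘ Φ.symm, hxt, hπ.isometry.comp
      (hD.developing.comp hΦ fun _ _ => mem_univ _) fun z _ => hDE (mem_range_self _), ?_⟩
    filter_upwards [Φ.open_target.mem_nhds hxt] with z hz
    have h1 : p (Φ.symm z) = z := by rw [hpΦ (Φ.map_target hz), Φ.right_inv hz]
    have h2 := hF (Φ.symm z)
    rwa [h1] at h2
  refine ⟨_, hiso, ?_⟩
  have hloc : IsLocalHomeomorph (fun y => π (D (s y))) := by
    rw [isLocalHomeomorph_iff_isLocalHomeomorphOn_univ]
    exact hiso.1.isLocalHomeomorphOn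
  refine (hloc.isOpenEmbedding_of_injective fun y z h => ?_).isEmbedding
  obtain ⟨_, ⟨γ, rfl⟩, hγ⟩ := (hπ.fibers _ (hDE (mem_range_self _)) _ (hDE (mem_range_self _))).1 h
  rw [← hD.equivariant] at hγ
  rw [← hs y, ← hs z, ← hinj hγ]
  exact (γ.2 _).symm

end

/-! ### Cauchy surfaces of the universal covering -/

/-- Being future-oriented can be tested on any future timelike vector. -/
lemma futureCausal_of_timelike {M : AdSSpacetime.{u}} {x : M} {v τ : E3} (hv : form M x v v ≤ 0)
    (hτ : form M x τ τ < 0) (h : form M x v τ < 0) (hτ' : form M x τ (timeVec M x) < 0) :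
    form M x v (timeVec M x) < 0 := by
  obtain ⟨U, φ, hU, hxU, hφ⟩ := M.locallyAdS x
  have ht := form_time M x
  rw [← adsForm_mder hφ hxU] at *
  have hne : ∀ {x v w : E3}, adsForm x v w < 0 → v ≠ 0 := by
    rintro x v w h rfl
    simp [adsForm, spaceForm] at h
  have h1 := adsForm_mul_time_neg hv (hne h) hτ
  have h2 := adsForm_mul_time_neg hτ.le (hne hτ) ht
  have h3 := adsForm_mul_time_neg hv (hne h) ht
  by_contra hcon
  push Not at hcon
  have h4 := pos_of_mul_neg_right h1 h.le
  have h5 := pos_of_mul_neg_right h2 hτ'.le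
  have h6 : 0 < mder φ x v 2 * mder φ x (timeVec M x) 2 := by
    have := mul_pos h4 h5
    have h7 : 0 < mder φ x τ 2 ^ 2 := by
      have : mder φ x τ 2 ≠ 0 := fun h => by simp [h] at h4
      positivity
    nlinarith
  exact absurd h3 (not_lt.2 (mul_nonneg hcon h6.le))

section

variable {M' : AdSSpacetime.{v}} {M : AdSSpacetime.{u}} {p : M' → M}

lemma IsSpacelikeSurface.preimage (hp : IsLocalIsometry p) {S : Set M}
    (hS : M.IsSpacelikeSurface S) : M'.IsSpacelikeSurface (p ⁻¹' S) := by
  intro x hx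
  obtain ⟨U, h, hU, hxU, hh, hSU, hd⟩ := hS (p x) hx
  have hpc : ContMDiff 𝓘(ℝ, E3) 𝓘(ℝ, E3) ∞ p := contMDiffOn_univ.1 hp.1.contMDiffOn
  have hp1 : ContMDiff 𝓘(ℝ, E3) 𝓘(ℝ, E3) 1 p := hpc.of_le (by simp)
  refine ⟨p ⁻¹' U, h ∘ p, hU.preimage hp1.continuous, hxU, hh.comp hp1.contMDiffOn fun _ => id,
    ?_, ?_⟩
  · ext y
    have : p y ∈ S ∩ U ↔ p y ∈ {z ∈ U | h z = 0} := by rw [hSU]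
    exact this
  · rintro y ⟨hy, hyU⟩
    obtain ⟨h1, h2⟩ := hd (p y) ⟨hy, hyU⟩
    have hdp : MDifferentiableAt 𝓘(ℝ, E3) 𝓘(ℝ, E3) p y := hp.mdifferentiableAt (mem_univ y)
    have hdh : MDifferentiableAt 𝓘(ℝ, E3) 𝓘(ℝ, ℝ) h (p y) :=
      (hh.contMDiffAt (hU.mem_nhds hyU)).mdifferentiableAt (by simp)
    have hcomp : ∀ v : E3, (mfderiv 𝓘(ℝ, E3) 𝓘(ℝ, ℝ) (h ∘ p) y : E3 →L[ℝ] ℝ) v =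
        (mfderiv 𝓘(ℝ, E3) 𝓘(ℝ, ℝ) h (p y) : E3 →L[ℝ] ℝ) (mder p y v) := fun v =>
      congrArg (fun L : E3 →L[ℝ] ℝ => L v) (mfderiv_comp y hdh hdp)
    let L := (hp.1 ⟨y, mem_univ y⟩).mfderivToContinuousLinearEquiv (by simp)
    have hL : ∀ v : E3, (L v : E3) = mder p y v := fun v => rfl
    refine ⟨fun h0 => h1 ?_, fun v hv hv0 => ?_⟩
    · refine ContinuousLinearMap.ext fun w => ?_
      obtain ⟨v, rfl⟩ := L.surjective w
      refine (hcomp v).symm.trans ?_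
      exact congrArg (fun L : E3 →L[ℝ] ℝ => L v) h0
    · have h3 := h2 (L v) (fun h => hv (L.map_eq_zero_iff.1 h)) ((hcomp v).symm.trans hv0)
      exact h3.trans_eq (hp.2 y (mem_univ y) v v)

lemma IsInextendibleCausal.map (hp : IsUniversalCovering p) {c : ℝ → M'}
    (hc : M'.IsInextendibleCausal c) : M.IsInextendibleCausal (p ∘ c) := by
  obtain ⟨h1, h2, h3, h4⟩ := hc
  have hpc : ContMDiff 𝓘(ℝ, E3) 𝓘(ℝ, E3) ∞ p := contMDiffOn_univ.1 hp.isometry.1.contMDiffOn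
  have hp1 : ContMDiff 𝓘(ℝ, E3) 𝓘(ℝ, E3) 1 p := hpc.of_le (by simp)
  have hform : ∀ (x : M') (v w : E3), form M (p x) (mder p x v) (mder p x w) = form M' x v w :=
    fun x v w => hp.isometry.2 x (mem_univ x) v w
  refine ⟨hp1.comp h1, fun s => ?_, ?_, ?_⟩
  · have hd : MDifferentiableAt 𝓘(ℝ, E3) 𝓘(ℝ, E3) p (c s) := hp.isometry.mdifferentiableAt (mem_univ _)
    have hv : M.velocity (p ∘ c) s = mder p (c s) (M'.velocity c s) := by
      have := mfderiv_comp s hd (h1.mdifferentiableAt (by simp))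
      exact congrArg (fun L : ℝ →L[ℝ] E3 => L 1) this
    obtain ⟨ha, hb⟩ := h2 s
    have ha' : form M (p (c s)) (mder p (c s) (M'.velocity c s)) (mder p (c s) (M'.velocity c s)) ≤ 0 :=
      (hform _ _ _).trans_le ha
    have hb' := futureCausal_of_timelike (τ := mder p (c s) (timeVec M' (c s))) ha'
      ((hform _ _ _).trans_lt (form_time M' _)) ((hform _ _ _).trans_lt hb)
      (hp.time (c s) (mem_univ _))
    unfold FutureCausal
    rw [hv]
    exact ⟨ha', hb'⟩
  · rintro ⟨y, hy⟩
    obtain ⟨x, -, hx⟩ := exists_tendsto_of_covering hp.covering (fun S hS => by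
      obtain ⟨a, ha⟩ := mem_atTop_sets.1 hS
      exact ⟨Ici a, Ici_mem_atTop a, ha, isPreconnected_Ici, h1.continuous.continuousOn⟩) hy
    exact h3 ⟨x, hx⟩
  · rintro ⟨y, hy⟩
    obtain ⟨x, -, hx⟩ := exists_tendsto_of_covering hp.covering (fun S hS => by
      obtain ⟨a, ha⟩ := mem_atBot_sets.1 hS
      exact ⟨Iic a, Iic_mem_atBot a, ha, isPreconnected_Iic, h1.continuous.continuousOn⟩) hy
    exact h4 ⟨x, hx⟩

lemma IsCauchySurface.preimage (hp : IsUniversalCovering p) {S : Set M}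
    (hS : M.IsCauchySurface S) : M'.IsCauchySurface (p ⁻¹' S) :=
  ⟨IsSpacelikeSurface.preimage hp.isometry hS.1, fun _ hc =>
    hS.2 _ (IsInextendibleCausal.map hp hc)⟩

/-- The developed image of any Cauchy surface of the universal covering has the same domain as
the developed preimage of a complete Cauchy surface, the holonomy group acts well on it, and the
spacetime embeds in the quotient. -/
theorem quotient_of_universalCovering {D : M' → universalAdS}
    {ρ : deckGroup p →* (universalAdS ≃ₜ universalAdS)} (hp : IsUniversalCovering p)
    (hD : IsDevelopingPair p D ρ) {S : Set M} (hS : M.IsCauchySurface S)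
    (hcomp : M.IsCompleteSurface S) {S' : Set M'} (hS' : M'.IsCauchySurface S') :
    ActsFreelyProperlyOn ρ.range (invisibleDomain (boundaryAtInfinity (D '' S'))) ∧
      ∃ (N : AdSSpacetime.{0}) (π : universalAdS → N),
        IsQuotientSpacetime ρ.range (invisibleDomain (boundaryAtInfinity (D '' S'))) N π ∧
        ∃ F : M → N, IsIsometricEmbedding F := by
  have hdev := isDeveloped_of_covering hp hD.developing
  obtain ⟨s, hs, hsD, hsS⟩ := hdev.exists_section hp.covering hS hcomp
  obtain ⟨f, hf, hDs, hDS, hinj, -, hrange⟩ := hdev.exists_graph hp.covering hS hs hsD hsS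
  have hdev' := isDeveloped_id hD.developing
  obtain ⟨A, hAc, hAS, hAv, -⟩ := hdev'.exists_retraction isCoveringMap_id hS'
  -- The retraction of the section to `S'` is a section of `S'`, which need not be complete.
  obtain ⟨f', hf', -, hDS', -, -, hrange'⟩ := hdev'.exists_graph isCoveringMap_id hS'
    (hAc.comp hs) (fun a => (hAv (s a)).1.symm.trans (hsD a)) fun a => hAS (s a)
  have hE : graphDomain f' = graphDomain f :=
    graphDomain_eq (hDS.symm.subset.trans ((image_subset_range _ _).trans hrange'))
      (hDS'.symm.subset.trans ((image_subset_range _ _).trans hrange))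
  have hEq : invisibleDomain (boundaryAtInfinity (D '' S')) = graphDomain f := by
    exact (congrArg (fun A => invisibleDomain (boundaryAtInfinity A)) hDS').trans hE
  rw [hEq]
  have hact := actsFreelyProperlyOn hp hD hf hs hDs hDS hinj
  obtain ⟨N, π, hπ⟩ := exists_quotientSpacetime hf.isOpen_graphDomain hf.isConnected_graphDomain
    (G := ρ.range)
    (by rintro _ ⟨γ, rfl⟩; exact isLinearLift_of_isometry (hD.holonomy γ))
    (by
      rintro _ ⟨γ, rfl⟩
      exact hdev.preservesFuture (g := ρ γ) γ.2 (isLinearLift_of_isometry (hD.holonomy γ))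
        (hD.equivariant γ))
    hact
  exact ⟨hact, N, π, hπ, exists_isometricEmbedding hp hD hinj hrange hπ⟩

end

/-! ### The holonomy covering -/

/-- Two local isometries differ by a global isometry near each common point. -/
lemma exists_transition {M : AdSSpacetime.{u}} {φ ψ : M → E3} {U V : Set M} (hU : IsOpen U)
    (hV : IsOpen V) (hφ : IsLocalIsometryOn M.metric modelMetric φ U)
    (hψ : IsLocalIsometryOn M.metric modelMetric ψ V) {x : M} (hxU : x ∈ U) (hxV : x ∈ V) :
    ∃ g : E3 ≃ₜ E3, IsLinearLift g ∧ φ =ᶠ[𝓝 x] g ∘ ψ := by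
  obtain ⟨Ψ, hxΨ, -, hψΨ, -, hΨ⟩ := hψ.exists_inverse hV hxV
  have hn : Ψ.target ∩ Ψ.symm ⁻¹' U ∈ 𝓝 (Ψ x) :=
    (Ψ.symm.isOpen_inter_preimage hU).mem_nhds ⟨Ψ.map_source hxΨ, by
      rwa [mem_preimage, Ψ.left_inv hxΨ]⟩
  obtain ⟨ε, hε, hball⟩ := Metric.mem_nhds_iff.1 hn
  obtain ⟨g, hg, hgφ⟩ := exists_isometry_extension Metric.isOpen_ball
    (convex_ball (Ψ x) ε).isPreconnected
    (hφ.comp (hΨ.mono fun z hz => (hball hz).1) fun z hz => (hball hz).2)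
    ⟨Ψ x, Metric.mem_ball_self hε⟩
  refine ⟨g, hg, ?_⟩
  filter_upwards [Ψ.open_source.mem_nhds hxΨ,
    (Ψ.continuousAt hxΨ).preimage_mem_nhds (Metric.ball_mem_nhds _ hε)] with z hz hz'
  have h1 := hgφ hz'
  rw [Function.comp_apply, Ψ.left_inv hz] at h1
  rw [Function.comp_apply, h1, hψΨ hz]

lemma transition_unique {M : AdSSpacetime.{u}} {ψ : M → E3} {V : Set M} (hV : IsOpen V)
    (hψ : IsLocalIsometryOn M.metric modelMetric ψ V) {x : M} (hxV : x ∈ V) {g g' : E3 ≃ₜ E3}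
    (hg : IsLinearLift g) (hg' : IsLinearLift g') (h : g ∘ ψ =ᶠ[𝓝 x] g' ∘ ψ) : g = g' := by
  obtain ⟨Ψ, hxΨ, -, hψΨ, -, -⟩ := hψ.exists_inverse hV hxV
  refine DFunLike.coe_injective
    (hg.eq_of_eventuallyEq hg' g.continuous g'.continuous (x := Ψ x) ?_)
  have h1 := Ψ.symm.continuousAt (Ψ.map_source hxΨ)
  rw [ContinuousAt, Ψ.left_inv hxΨ] at h1
  filter_upwards [h1.eventually h, Ψ.open_target.mem_nhds (Ψ.map_source hxΨ)] with z hz hz'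
  rwa [Function.comp_apply, Function.comp_apply, hψΨ (Ψ.map_target hz'), Ψ.right_inv hz'] at hz

/-- The group of isometries of the universal anti-de Sitter space. -/
def isometryGroup : Subgroup (E3 ≃ₜ E3) where
  carrier := {g | IsLinearLift g}
  one_mem' := ⟨ContinuousLinearMap.id ℝ _, fun _ _ => rfl, fun _ => rfl⟩
  mul_mem' := fun hg hh => hg.comp hh
  inv_mem' := fun hg => hg.symm

/-- The isometry group is given the discrete topology. -/
instance : TopologicalSpace isometryGroup := ⊥

instance : DiscreteTopology isometryGroup := ⟨rfl⟩

section

variable (M : AdSSpacetime.{u})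

/-- The domain of a chosen isometric chart near a point. -/
def chartDomain (i : M) : Set M := (M.locallyAdS i).choose

/-- A chosen isometric chart near a point. -/
def isometricChart (i : M) : M → E3 := (M.locallyAdS i).choose_spec.choose

lemma isOpen_chartDomain (i : M) : IsOpen (chartDomain M i) :=
  (M.locallyAdS i).choose_spec.choose_spec.1

lemma mem_chartDomain (i : M) : i ∈ chartDomain M i :=
  (M.locallyAdS i).choose_spec.choose_spec.2.1

lemma isLocalIsometryOn_isometricChart (i : M) :
    IsLocalIsometryOn M.metric modelMetric (isometricChart M i) (chartDomain M i) :=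
  (M.locallyAdS i).choose_spec.choose_spec.2.2

lemma exists_chartTransition (i j x : M) : ∃ g : isometryGroup,
    x ∈ chartDomain M i → x ∈ chartDomain M j →
      isometricChart M i =ᶠ[𝓝 x] g.1 ∘ isometricChart M j := by
  by_cases h : x ∈ chartDomain M i ∧ x ∈ chartDomain M j
  · obtain ⟨g, hg, hev⟩ := exists_transition (isOpen_chartDomain M i) (isOpen_chartDomain M j)
      (isLocalIsometryOn_isometricChart M i) (isLocalIsometryOn_isometricChart M j) h.1 h.2
    exact ⟨⟨g, hg⟩, fun _ _ => hev⟩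
  · exact ⟨1, fun h1 h2 => absurd ⟨h1, h2⟩ h⟩

/-- The isometry by which two of the chosen charts differ near a point. -/
def chartTransition (i j x : M) : isometryGroup := (exists_chartTransition M i j x).choose

variable {M}

lemma chartTransition_spec {i j x : M} (hi : x ∈ chartDomain M i) (hj : x ∈ chartDomain M j) :
    isometricChart M i =ᶠ[𝓝 x] (chartTransition M i j x).1 ∘ isometricChart M j :=
  (exists_chartTransition M i j x).choose_spec hi hj

lemma eq_chartTransition {i j x : M} (hi : x ∈ chartDomain M i) (hj : x ∈ chartDomain M j)
    {g : isometryGroup} (h : isometricChart M i =ᶠ[𝓝 x] g.1 ∘ isometricChart M j) :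
    chartTransition M i j x = g :=
  Subtype.ext <| transition_unique (isOpen_chartDomain M j) (isLocalIsometryOn_isometricChart M j)
    hj (chartTransition M i j x).2 g.2 ((chartTransition_spec hi hj).symm.trans h)

variable (M)

/-- The covering of a spacetime by the germs of its local isometries with values in the universal
anti-de Sitter space. Over the domain of a chart `φ`, the pair `(x, g)` stands for the germ of
`g ∘ φ` at `x`. -/
def germCore : FiberBundleCore M M isometryGroup where
  baseSet := chartDomain M
  isOpen_baseSet := isOpen_chartDomain M
  indexAt := id
  mem_baseSet_at := mem_chartDomain M
  coordChange i j x g := g * chartTransition M i j x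
  coordChange_self i x hx g := by
    rw [eq_chartTransition hx hx (g := 1) (EventuallyEq.refl _ _), mul_one]
  continuousOn_coordChange i j := by
    rintro ⟨x, g⟩ ⟨⟨hi, hj⟩, -⟩
    have hev : ∀ᶠ y in 𝓝 x, chartTransition M i j y = chartTransition M i j x := by
      filter_upwards [(isOpen_chartDomain M i).mem_nhds hi, (isOpen_chartDomain M j).mem_nhds hj,
        (chartTransition_spec hi hj).eventuallyEq_nhds] with y h1 h2 h3
      exact eq_chartTransition h1 h2 h3
    have hc : ContinuousAt (fun z : M × isometryGroup => z.2 * chartTransition M i j x) (x, g) :=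
      (continuous_of_discreteTopology (f := fun g : isometryGroup =>
        g * chartTransition M i j x)).continuousAt.comp continuousAt_snd
    refine (hc.congr ?_).continuousWithinAt
    filter_upwards [continuousAt_fst.eventually hev] with z hz
    rw [hz]
  coordChange_comp i j k x hx g := by
    rw [mul_assoc]
    congr 1
    refine (eq_chartTransition hx.1.1 hx.2 ?_).symm
    filter_upwards [chartTransition_spec hx.1.1 hx.1.2, chartTransition_spec hx.1.2 hx.2]
      with y h1 h2
    rw [h1, Function.comp_apply, h2]
    rfl

/-- The value at its base point of a germ of local isometry. -/
def germValue (z : (germCore M).TotalSpace) : E3 :=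
  (show isometryGroup from z.2).1 (isometricChart M z.1 z.1)

lemma isCoveringMap_germCore : IsCoveringMap (germCore M).proj :=
  FiberBundle.isCoveringMap (F := isometryGroup) (E := (germCore M).Fiber)

lemma isDeveloped_germCore : IsDeveloped M (germCore M).proj (germValue M) := by
  refine ⟨(isCoveringMap_germCore M).isLocalHomeomorph, fun z => ?_⟩
  set g : isometryGroup := z.2 with hg
  refine ⟨chartDomain M z.1, g.1 ∘ isometricChart M z.1, isOpen_chartDomain M _,
    mem_chartDomain M _, (g.2.isLocalIsometryOn univ).comp (isLocalIsometryOn_isometricChart M _)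
      fun _ _ => mem_univ _, ?_⟩
  have hsrc : z ∈ ((germCore M).localTriv z.1).source :=
    ((germCore M).mem_localTriv_source z.1 z).2 (mem_chartDomain M z.1)
  have hcont : ContinuousAt (fun w => ((germCore M).localTriv z.1 w).2) z :=
    continuousAt_snd.comp (((germCore M).localTriv z.1).continuousOn.continuousAt
      (((germCore M).localTriv z.1).open_source.mem_nhds hsrc))
  have hev : ∀ᶠ w in 𝓝 z, ((germCore M).localTriv z.1 w).2 = ((germCore M).localTriv z.1 z).2 :=
    hcont.eventually ((isOpen_discrete {((germCore M).localTriv z.1 z).2}).mem_nhds rfl)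
  have hproj : ContinuousAt (germCore M).proj z := (germCore M).continuous_proj.continuousAt
  filter_upwards [hev,
    hproj.preimage_mem_nhds ((isOpen_chartDomain M z.1).mem_nhds (mem_chartDomain M z.1))]
    with w hw hwz
  rw [FiberBundleCore.localTriv_apply, FiberBundleCore.localTriv_apply] at hw
  change (show isometryGroup from w.2) * chartTransition M w.1 z.1 w.1 =
    g * chartTransition M z.1 z.1 z.1 at hw
  rw [eq_chartTransition (g := 1) (mem_chartDomain M z.1) (mem_chartDomain M z.1)
    (EventuallyEq.refl _ _), mul_one] at hw
  rw [← hw]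
  have h1 := (chartTransition_spec (mem_chartDomain M w.1) hwz).self_of_nhds
  exact congrArg (show isometryGroup from w.2).1 h1

end

/-- The restriction of a covering to an open and closed subset of the total space. -/
lemma IsCoveringMap.restrict_isClopen {X B : Type*} [TopologicalSpace X] [TopologicalSpace B]
    [LocallyConnectedSpace B] {p : X → B} (hp : IsCoveringMap p) {C : Set X} (hC : IsClopen C) :
    IsCoveringMap fun x : C => p x := by
  intro y
  obtain ⟨hdisc, U, hyU, hU, hpU, H, hH⟩ := hp y
  obtain ⟨V, ⟨hV, hyV, hVc⟩, hVU⟩ :=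
    (LocallyConnectedSpace.open_connected_basis y).mem_iff.1 (hU.mem_nhds hyU)
  have hVU : V ⊆ U := hVU
  -- A sheet over the connected set `V` is contained in `C` as soon as one of its points is.
  have hsheet : ∀ (i : p ⁻¹' {y}) (v w : V),
      (H.symm (⟨v, hVU v.2⟩, i) : X) ∈ C → (H.symm (⟨w, hVU w.2⟩, i) : X) ∈ C := by
    intro i v w hv
    have : PreconnectedSpace V := isPreconnected_iff_preconnectedSpace.1 hVc.isPreconnected
    have hVp : IsPreconnected (univ : Set V) := isPreconnected_univ
    have hcl : IsClopen {v : V | (H.symm (⟨v, hVU v.2⟩, i) : X) ∈ C} :=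
      hC.preimage (by fun_prop)
    have := hVp.subset_isClopen hcl ⟨v, mem_univ v, hv⟩
    exact this (mem_univ w)
  have hpH : ∀ (v : V) (i : p ⁻¹' {y}), p (H.symm (⟨v, hVU v.2⟩, i)) = v := by
    intro v i
    rw [← hH, H.apply_symm_apply]
  set I := {i : p ⁻¹' {y} // (H.symm (⟨y, hyU⟩, i) : X) ∈ C}
  have hopen : IsOpen ((fun x : C => p x) ⁻¹' V) :=
    hV.preimage (hp.continuous.comp continuous_subtype_val)
  refine IsEvenlyCovered.to_isEvenlyCovered_preimage (I := I)
    ⟨inferInstance, V, hyV, hV, hopen, ?_⟩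
  have hmem : ∀ x : (fun x : C => p x) ⁻¹' V, (x.1 : X) ∈ p ⁻¹' U := fun x => hVU x.2
  have hinv : ∀ x : (fun x : C => p x) ⁻¹' V,
      H.symm (⟨p x.1, hVU x.2⟩, (H ⟨x.1, hmem x⟩).2) = ⟨x.1, hmem x⟩ := by
    intro x
    rw [H.symm_apply_eq]
    exact Prod.ext (Subtype.ext (hH ⟨x.1, hmem x⟩).symm) rfl
  let K : (fun x : C => p x) ⁻¹' V ≃ₜ V × I :=
    { toFun := fun x => (⟨p x.1, x.2⟩, ⟨(H ⟨x.1, hmem x⟩).2,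
        hsheet _ ⟨p x.1, x.2⟩ ⟨y, hyV⟩ (by rw [hinv]; exact x.1.2)⟩)
      invFun := fun z => ⟨⟨H.symm (⟨z.1, hVU z.1.2⟩, z.2.1), hsheet _ ⟨y, hyV⟩ _ z.2.2⟩, by
        change p (H.symm (⟨z.1, hVU z.1.2⟩, z.2.1)) ∈ V
        rw [hpH]
        exact z.1.2⟩
      left_inv := fun x => Subtype.ext (Subtype.ext (congrArg (fun z : p ⁻¹' U => (z : X)) (hinv x)))
      right_inv := fun z => Prod.ext (Subtype.ext (hpH _ _)) (Subtype.ext (by simp))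
      continuous_toFun := by
        refine Continuous.prodMk (Continuous.subtype_mk ?_ _) (Continuous.subtype_mk ?_ _)
        · exact hp.continuous.comp (continuous_subtype_val.comp continuous_subtype_val)
        · exact continuous_snd.comp (H.continuous.comp
            ((continuous_subtype_val.comp continuous_subtype_val).subtype_mk _))
      continuous_invFun := by
        refine Continuous.subtype_mk (Continuous.subtype_mk ?_ _) _
        refine continuous_subtype_val.comp (H.symm.continuous.comp ?_)
        exact ((continuous_subtype_val.comp continuous_fst).subtype_mk _).prodMk
          (continuous_subtype_val.comp continuous_snd) }
  exact ⟨K, fun _ => rfl⟩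

lemma IsCoveringMap.t2Space {X B : Type*} [TopologicalSpace X] [TopologicalSpace B] [T2Space B]
    {p : X → B} (hp : IsCoveringMap p) : T2Space X := by
  refine ⟨fun x y hxy => ?_⟩
  by_cases h : p x = p y
  · exact hp.isSeparatedMap x y h hxy
  · obtain ⟨U, V, hU, hV, hxU, hyV, hUV⟩ := t2_separation h
    exact ⟨p ⁻¹' U, p ⁻¹' V, hU.preimage hp.continuous, hV.preimage hp.continuous, hxU, hyV,
      hUV.preimage p⟩

lemma IsDeveloped.locallyConnectedSpace {M : AdSSpacetime.{u}} {X : Type*} [TopologicalSpace X]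
    {p : X → M} {D : X → E3} (hD : IsDeveloped M p D) : LocallyConnectedSpace X := by
  let _ : ChartedSpace E3 X :=
    { atlas := univ
      chartAt := fun x => (hD.isLocalHomeomorph x).choose
      mem_chart_source := fun x => (hD.isLocalHomeomorph x).choose_spec.1
      chart_mem_atlas := fun _ => mem_univ _ }
  exact ChartedSpace.locallyConnectedSpace E3 X

lemma IsDeveloped.comp_isOpenEmbedding {M : AdSSpacetime.{u}} {X Z : Type*} [TopologicalSpace X]
    [TopologicalSpace Z] {p : X → M} {D : X → E3} (hD : IsDeveloped M p D) {i : Z → X}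
    (hi : IsOpenEmbedding i) : IsDeveloped M (p ∘ i) (D ∘ i) := by
  refine ⟨hD.localHomeomorph.comp hi.isLocalHomeomorph, fun z => ?_⟩
  obtain ⟨U, φ, hU, hzU, hφ, hev⟩ := hD.chart (i z)
  exact ⟨U, φ, hU, hzU, hφ, hi.continuous.continuousAt.eventually hev⟩

/-- A connected covering of a spacetime that develops in the universal anti-de Sitter space. -/
theorem exists_developedCovering (M : AdSSpacetime.{u}) :
    ∃ (X : Type u) (_ : TopologicalSpace X) (_ : T2Space X) (_ : ConnectedSpace X) (p : X → M)
      (D : X → E3), IsCoveringMap p ∧ IsDeveloped M p D := by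
  have hcov := isCoveringMap_germCore M
  have hdev := isDeveloped_germCore M
  obtain ⟨x⟩ := M.connected.toNonempty
  have : LocallyConnectedSpace M := ChartedSpace.locallyConnectedSpace E3 M
  have : LocallyConnectedSpace (germCore M).TotalSpace := hdev.locallyConnectedSpace
  have : T2Space (germCore M).TotalSpace := IsCoveringMap.t2Space hcov
  let z : (germCore M).TotalSpace := ⟨x, (1 : isometryGroup)⟩
  have hC : IsClopen (connectedComponent z) := isClopen_connectedComponent
  have : ConnectedSpace (connectedComponent z) :=
    isConnected_iff_connectedSpace.1 isConnected_connectedComponent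
  exact ⟨connectedComponent z, inferInstance, inferInstance, inferInstance, _, _,
    IsCoveringMap.restrict_isClopen hcov hC,
    hdev.comp_isOpenEmbedding hC.isOpen.isOpenEmbedding_subtypeVal⟩

/-! ### Time reversal -/

/-- The reflection `t ↦ -t`, as a linear map. -/
def timeReversalL : E3 →L[ℝ] E3 :=
  LinearMap.toContinuousLinearMap
    { toFun := fun x => pt (proj x) (-x 2)
      map_add' := fun z w => by ext i; fin_cases i <;> simp [pt, proj]; ring
      map_smul' := fun c z => by ext i; fin_cases i <;> simp [pt, proj] }

lemma timeReversalL_apply (x : E3) : timeReversalL x = pt (proj x) (-x 2) := rfl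

/-- The reflection `t ↦ -t`. -/
def timeReversal : E3 ≃ₜ E3 where
  toFun := timeReversalL
  invFun := timeReversalL
  left_inv x := by simp [timeReversalL_apply]
  right_inv x := by simp [timeReversalL_apply]

lemma timeReversal_apply (x : E3) : timeReversal x = timeReversalL x := rfl

lemma isLinearLift_timeReversal : IsLinearLift timeReversal := by
  refine ⟨LinearMap.toContinuousLinearMap
    { toFun := fun y => ![y 0, -y 1, y 2, y 3]
      map_add' := fun y z => by
        funext i; fin_cases i <;> simp; ring
      map_smul' := fun c y => by funext i; fin_cases i <;> simp }, fun y z => ?_, fun x => ?_⟩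
  · rw [Q_apply, Q_apply]
    simp
  · funext i
    fin_cases i <;> simp [cover, timeReversal_apply, timeReversalL_apply, proj]

lemma fderiv_timeReversal (x v : E3) : fderiv ℝ timeReversal x v 2 = -v 2 := by
  have : fderiv ℝ (timeReversal : E3 → E3) x = timeReversalL := timeReversalL.fderiv
  rw [this, timeReversalL_apply, pt_two]

section

variable {M : AdSSpacetime.{u}} {X : Type*} [TopologicalSpace X] {p : X → M} {D : X → E3}

lemma IsDeveloped.comp_isometry (hD : IsDeveloped M p D) {g : E3 ≃ₜ E3} (hg : IsLinearLift g) :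
    IsDeveloped M p (g ∘ D) := by
  refine ⟨hD.localHomeomorph, fun x => ?_⟩
  obtain ⟨U, φ, hU, hxU, hφ, hev⟩ := hD.chart x
  refine ⟨U, g ∘ φ, hU, hxU, (hg.isLocalIsometryOn univ).comp hφ fun _ _ => mem_univ _, ?_⟩
  filter_upwards [hev] with y hy
  rw [Function.comp_apply, hy, Function.comp_apply]

/-- After composition with a time reversal if necessary, a developing map preserves the direction
of time. -/
lemma IsDeveloped.exists_timeOriented [PreconnectedSpace X] (hD : IsDeveloped M p D) :
    ∃ D' : X → E3, IsDeveloped M p D' ∧ ∃ T, IsTimeCoordinate M p D' T ∧ ∀ x, 0 < T x := by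
  obtain ⟨T, hTc, hT0, hT⟩ := hD.exists_time
  rcases exists_sign hTc hT0 with h | h
  · exact ⟨D, hD, T, hT, h⟩
  have hD' := hD.comp_isometry isLinearLift_timeReversal
  -- The time coordinate for the reflected developing map is the opposite one.
  obtain ⟨T', -, -, hT'⟩ := hD'.exists_time
  refine ⟨_, hD', T', hT', fun x => ?_⟩
  obtain ⟨U, φ, hU, hxU, hφ, hev⟩ := hD.chart x
  have hR := isLinearLift_timeReversal.isLocalIsometryOn univ
  have h1 := hT' x U (timeReversal ∘ φ) hU hxU (hR.comp hφ fun _ _ => mem_univ _) (by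
    filter_upwards [hev] with y hy
    rw [Function.comp_apply, hy, Function.comp_apply])
  rw [mder_comp (hR.mdifferentiableAt (mem_univ _)) (hφ.mdifferentiableAt hxU), mder_eq_fderiv,
    fderiv_timeReversal, ← hT x U φ hU hxU hφ hev] at h1
  rw [h1]
  linarith [h x]

/-! ### The universal covering -/

/-- The developed space retracts along vertical segments to a plane, hence it is contractible. -/
lemma contractibleSpace_of_section (hD : IsOpenEmbedding D) {s : ℝ × ℝ → X}
    (hs : Continuous s) (hsD : ∀ a, proj (D (s a)) = a)
    (hv : ∀ x, VertJoined D x (s (proj (D x)))) : ContractibleSpace X := by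
  have hDc := hD.continuous
  let e : X ≃ₜ range D := hD.isEmbedding.toHomeomorph
  have he : ∀ x, (e x : E3) = D x := fun _ => rfl
  let h : X → ℝ := fun x => D (s (proj (D x))) 2
  have hh : Continuous h := by
    have : Continuous fun x : X => D (s (proj (D x))) :=
      hDc.comp (hs.comp (continuous_proj.comp hDc))
    exact (EuclideanSpace.proj (2 : Fin 3)).continuous.comp this
  have hmem : ∀ (τ : unitInterval) (x : X),
      pt (proj (D x)) ((1 - (τ : ℝ)) * h x + τ * D x 2) ∈ range D := by
    intro τ x
    obtain ⟨-, c, -, hc, -, -⟩ := hv x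
    refine ⟨_, hc _ ?_⟩
    rw [← segment_eq_uIcc]
    exact ⟨τ, 1 - τ, τ.2.1, by linarith [τ.2.2], by ring, by
      simp only [smul_eq_mul]
      exact add_comm _ _⟩
  let H : ContinuousMap.Homotopy
      ((⟨s, hs⟩ : C(ℝ × ℝ, X)).comp ⟨fun x => proj (D x), continuous_proj.comp hDc⟩)
      (ContinuousMap.id X) :=
    { toFun := fun z => e.symm ⟨_, hmem z.1 z.2⟩
      continuous_toFun := by
        refine e.symm.continuous.comp (Continuous.subtype_mk ?_ _)
        refine continuous_pt.comp (Continuous.prodMk ?_ ?_)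
        · exact continuous_proj.comp (hDc.comp continuous_snd)
        · have h1 : Continuous fun z : unitInterval × X => h z.2 := hh.comp continuous_snd
          have h2 : Continuous fun z : unitInterval × X => D z.2 2 :=
            (EuclideanSpace.proj (2 : Fin 3)).continuous.comp (hDc.comp continuous_snd)
          fun_prop
      map_zero_left := fun x => by
        change e.symm _ = s (proj (D x))
        rw [e.symm_apply_eq]
        refine Subtype.ext ?_
        change pt (proj (D x)) _ = D (s (proj (D x)))
        rw [← pt_proj (D (s (proj (D x)))), hsD]
        congr 1
        simp [h]
      map_one_left := fun x => by
        change e.symm _ = x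
        rw [e.symm_apply_eq]
        refine Subtype.ext ?_
        change pt (proj (D x)) _ = D x
        conv_rhs => rw [← pt_proj (D x)]
        congr 1
        simp }
  let E : ContinuousMap.HomotopyEquiv X (ℝ × ℝ) :=
    { toFun := ⟨fun x => proj (D x), continuous_proj.comp hDc⟩
      invFun := ⟨s, hs⟩
      left_inv := ⟨H⟩
      right_inv := by
        have h : (⟨fun x => proj (D x), continuous_proj.comp hDc⟩ : C(X, ℝ × ℝ)).comp ⟨s, hs⟩ =
            ContinuousMap.id _ := ContinuousMap.ext hsD
        rw [h] }
  exact E.contractibleSpace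

/-- A space with an injective developing map is a spacetime, for the metric of its image. -/
lemma exists_spacetime_of_injective {X : Type u} [TopologicalSpace X] [ConnectedSpace X]
    {D : X → E3} (hD : IsOpenEmbedding D) : ∃ (N : AdSSpacetime.{u}) (e : X ≃ₜ N),
      IsLocalIsometryOn N.metric modelMetric (D ∘ e.symm) univ ∧
      ∀ x, 0 < mder (D ∘ e.symm) x (timeVec N x) 2 := by
  have : T2Space X := hD.isEmbedding.t2Space
  have : SecondCountableTopology X := hD.isEmbedding.secondCountableTopology
  -- `X` is the quotient of the image of `D` by the trivial group.
  set q : E3 → X := Function.invFun D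
  have hq : ∀ x, q (D x) = x := Function.leftInverse_invFun hD.injective
  have hmodel : IsModelQuotient q (range D) := by
    refine ⟨hD.isOpen_range, fun x hx => ?_, fun y => ⟨D y, mem_range_self y, hq y⟩, ?_⟩
    · let i := hD.toOpenPartialHomeomorph D
      refine ⟨i.symm, by simpa [i] using hx, by simp [i], ?_⟩
      intro z hz
      obtain ⟨y, rfl⟩ : z ∈ range D := by simpa [i] using hz
      rw [hq]
      exact i.left_inv (by simp [i])
    · rintro _ ⟨x, rfl⟩ _ ⟨x', rfl⟩ h
      rw [hq, hq] at h
      subst h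
      refine ⟨1, isometryGroup.one_mem, fun y => ?_, rfl, Eventually.of_forall fun _ => rfl⟩
      have : fderiv ℝ ((1 : E3 ≃ₜ E3) : E3 → E3) y = ContinuousLinearMap.id ℝ E3 := fderiv_id
      rw [this]
      simp
  obtain ⟨N, e, hiso, htime⟩ := hmodel.exists_spacetime (isConnected_range hD.continuous)
  have hinv : ∀ x, (e ∘ q) ((D ∘ e.symm) x) = x := fun x => by simp [hq]
  have hinv' : ∀ z ∈ range D, (D ∘ e.symm) ((e ∘ q) z) = z := by
    rintro _ ⟨x, rfl⟩
    simp [hq]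
  have hDe : IsLocalIsometryOn N.metric modelMetric (D ∘ e.symm) univ := by
    refine isLocalIsometryOn_of_local fun x _ => ?_
    have hx : (D ∘ e.symm) x ∈ range D := mem_range_self _
    obtain ⟨Φ, hxΦ, hΦD, hqΦ, -, hΦ⟩ := hiso.exists_inverse hD.isOpen_range hx
    have hxt : x ∈ Φ.target := by
      have := Φ.map_source hxΦ
      rwa [← hqΦ hxΦ, hinv] at this
    refine ⟨Φ.target, Φ.symm, hxt, hΦ, ?_⟩
    filter_upwards [Φ.open_target.mem_nhds hxt] with y hy
    have h1 := Φ.map_target hy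
    rw [← hinv' _ (hΦD h1), hqΦ h1, Φ.right_inv hy]
  refine ⟨N, e, hDe, fun x => ?_⟩
  set z := (D ∘ e.symm) x with hz
  have hzr : z ∈ range D := mem_range_self _
  have h1 : form N ((e ∘ q) z) (mder (e ∘ q) z (pt 0 1)) (timeVec N ((e ∘ q) z)) < 0 := by
    have := htime z hzr
    rw [← modelTime_eq z]
    exact this
  have hxz : (e ∘ q) z = x := hinv x
  have h2 : mder (D ∘ e.symm) ((e ∘ q) z) (mder (e ∘ q) z (pt 0 1)) = pt 0 1 := by
    rw [← mder_comp (hDe.mdifferentiableAt (mem_univ _)) (hiso.mdifferentiableAt hzr)]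
    have : (D ∘ e.symm) ∘ (e ∘ q) =ᶠ[𝓝 z] id := by
      filter_upwards [hD.isOpen_range.mem_nhds hzr] with y hy using hinv' y hy
    rw [mder_congr this, mder_id]
  have h3 := form_time N x
  rw [← adsForm_mder hDe (mem_univ _), h2, hxz, ← hz] at h1
  rw [← adsForm_mder hDe (mem_univ _), ← hz] at h3
  have h4 := adsForm_mul_time_neg (adsForm_pt_time_neg z).le pt_time_ne_zero h3
  rw [pt_two, one_mul] at h4
  exact pos_of_mul_neg_right h4 h1.le

/-- The holonomy of a developing map with a connected image: a local isometry of a domain extends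
to a unique isometry of the universal anti-de Sitter space. -/
lemma exists_holonomy {M' : AdSSpacetime.{v}} {M : AdSSpacetime.{u}} {p : M' → M}
    {D : M' → universalAdS} (hp : IsLocalIsometry p) (hD : IsLocalIsometry D)
    (hinj : Function.Injective D) :
    ∃ ρ : deckGroup p →* (universalAdS ≃ₜ universalAdS), IsDevelopingPair p D ρ := by
  have hDc : Continuous D := (contMDiffOn_univ.1 hD.1.contMDiffOn).continuous
  have hop : IsOpen (range D) := by
    have h : IsLocalHomeomorph D := by
      rw [isLocalHomeomorph_iff_isLocalHomeomorphOn_univ]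
      exact hD.1.isLocalHomeomorphOn
    exact h.isOpenMap.isOpen_range
  have hdeck : ∀ γ : deckGroup p, IsLocalIsometryOn M'.metric M'.metric γ.1 univ := by
    intro γ
    refine isLocalIsometryOn_of_local fun x _ => ?_
    obtain ⟨Φ, hxΦ, -, hpΦ, -, hΦ⟩ := hp.exists_inverse isOpen_univ (mem_univ (γ.1 x))
    have hxt : p x ∈ Φ.target := by
      have := Φ.map_source hxΦ
      rwa [← hpΦ hxΦ, γ.2] at this
    have hpc : Continuous p := (contMDiffOn_univ.1 hp.1.contMDiffOn).continuous
    refine ⟨p ⁻¹' Φ.target, Φ.symm ∘ p, hxt, hΦ.comp (hp.mono (subset_univ _)) fun _ => id, ?_⟩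
    filter_upwards [γ.1.continuous.continuousAt.preimage_mem_nhds
      (Φ.open_source.mem_nhds hxΦ)] with y hy
    rw [Function.comp_apply, ← γ.2 y, hpΦ hy, Φ.left_inv hy]
  have hex : ∀ γ : deckGroup p, ∃ g : E3 ≃ₜ E3, IsLinearLift g ∧ ∀ x, D (γ.1 x) = g (D x) := by
    intro γ
    -- `D ∘ γ ∘ D⁻¹` is a local isometry on the image of `D`, which is connected.
    set q : E3 → M' := Function.invFun D
    have hq : ∀ x, q (D x) = x := Function.leftInverse_invFun hinj
    have hiso : IsLocalIsometryOn modelMetric modelMetric (D ∘ γ.1 ∘ q) (range D) := by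
      refine isLocalIsometryOn_of_local ?_
      rintro _ ⟨x, rfl⟩
      obtain ⟨Φ, hxΦ, -, hDΦ, -, hΦ⟩ := hD.exists_inverse isOpen_univ (mem_univ x)
      have hxt : D x ∈ Φ.target := hDΦ hxΦ ▸ Φ.map_source hxΦ
      refine ⟨Φ.target, D ∘ γ.1 ∘ Φ.symm, hxt,
        hD.comp ((hdeck γ).comp hΦ fun _ _ => mem_univ _) fun _ _ => mem_univ _, ?_⟩
      filter_upwards [Φ.open_target.mem_nhds hxt] with z hz
      have h1 : q z = Φ.symm z := by
        have h2 := hDΦ (Φ.map_target hz)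
        rw [Φ.right_inv hz] at h2
        exact (congrArg q h2).symm.trans (hq _)
      exact congrArg (fun y => D (γ.1 y)) h1
    obtain ⟨g, hg, hgq⟩ := exists_isometry_extension hop (isPreconnected_range hDc) hiso
      (range_nonempty D)
    refine ⟨g, hg, fun x => ?_⟩
    exact (congrArg (fun y => D (γ.1 y)) (hq x)).symm.trans (hgq (mem_range_self x))
  choose ρ hρ hρD using hex
  have huniq : ∀ g g' : E3 ≃ₜ E3, IsLinearLift g → IsLinearLift g' →
      (∀ x, g (D x) = g' (D x)) → g = g' := by
    intro g g' hg hg' h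
    obtain ⟨x⟩ := M'.connected.toNonempty
    refine DFunLike.coe_injective
      (hg.eq_of_eventuallyEq hg' g.continuous g'.continuous (x := D x) ?_)
    filter_upwards [hop.mem_nhds (mem_range_self x)]
    rintro _ ⟨y, rfl⟩
    exact h y
  let ρ' : deckGroup p →* (E3 ≃ₜ E3) :=
    { toFun := ρ
      map_one' := huniq _ _ (hρ 1) isometryGroup.one_mem fun x => (hρD 1 x).symm
      map_mul' := fun γ γ' => huniq _ _ (hρ _) (isometryGroup.mul_mem (hρ γ) (hρ γ')) fun x => by
        rw [← hρD]
        change D (γ.1 (γ'.1 x)) = ρ γ (ρ γ' (D x))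
        rw [hρD, hρD] }
  exact ⟨ρ', hD, fun γ => (hρ γ).isLocalIsometryOn univ, fun γ x => hρD γ x⟩

/-- A spacetime with a complete Cauchy surface has a universal covering, with an injective
developing map. -/
theorem exists_universalCovering (M : AdSSpacetime.{u}) {S : Set M} (hS : M.IsCauchySurface S)
    (hcomp : M.IsCompleteSurface S) :
    ∃ (M' : AdSSpacetime.{u}) (p : M' → M) (D : M' → universalAdS)
      (ρ : deckGroup p →* (universalAdS ≃ₜ universalAdS)),
      IsUniversalCovering p ∧ IsDevelopingPair p D ρ := by
  obtain ⟨X, _, _, _, p, D₀, hp, hD₀⟩ := exists_developedCovering M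
  obtain ⟨D, hD, T, hT, hT0⟩ := hD₀.exists_timeOriented
  obtain ⟨s, hs, hsD, hsS⟩ := hD.exists_section hp hS hcomp
  obtain ⟨f, -, -, -, hinj, hv, -⟩ := hD.exists_graph hp hS hs hsD hsS
  have hemb : IsOpenEmbedding D := hD.isLocalHomeomorph.isOpenEmbedding_of_injective hinj
  have hcontr : ContractibleSpace X := contractibleSpace_of_section hemb hs hsD hv
  obtain ⟨N, e, hiso, htime⟩ := exists_spacetime_of_injective hemb
  have hsc : ContractibleSpace N := e.symm.contractibleSpace
  -- Near each point the covering is the composition of the developing map and of a local isometry.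
  have hlocal : ∀ x : N, ∃ (W : Set N) (V : Set E3) (ψ : E3 → M), IsOpen W ∧ x ∈ W ∧
      IsLocalIsometryOn modelMetric M.metric ψ V ∧ MapsTo (D ∘ e.symm) W V ∧
      ∀ y ∈ W, (p ∘ e.symm) y = ψ ((D ∘ e.symm) y) := by
    intro x
    obtain ⟨k, ψ, hxk, hDk, hψ, hpψ⟩ := hD.exists_local_model (e.symm x)
    refine ⟨e.symm ⁻¹' k.source, k.target, ψ, k.open_source.preimage e.symm.continuous, hxk, hψ,
      fun y hy => ?_, fun y hy => hpψ _ hy⟩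
    have := k.map_source hy
    rwa [← hDk hy] at this
  have hpiso : IsLocalIsometry (p ∘ e.symm) := by
    refine isLocalIsometryOn_of_local fun x _ => ?_
    obtain ⟨W, V, ψ, hW, hxW, hψ, hWV, hpψ⟩ := hlocal x
    refine ⟨W, ψ ∘ (D ∘ e.symm), hxW, hψ.comp (hiso.mono (subset_univ _)) hWV, ?_⟩
    filter_upwards [hW.mem_nhds hxW] with y hy using hpψ y hy
  obtain ⟨ρ, hρ⟩ := exists_holonomy hpiso hiso (hinj.comp e.symm.injective)
  refine ⟨N, p ∘ e.symm, D ∘ e.symm, ρ, ⟨hp.comp_homeomorph e.symm, inferInstance, hpiso, ?_⟩, hρ⟩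
  intro x _
  obtain ⟨U, φ, hU, hxU, hφ, hev⟩ := hD.chart (e.symm x)
  have h1 := hT (e.symm x) U φ hU hxU hφ hev
  have h2 := hT0 (e.symm x)
  rw [h1] at h2
  have h3 : φ ∘ (p ∘ e.symm) =ᶠ[𝓝 x] D ∘ e.symm := by
    filter_upwards [e.symm.continuous.continuousAt.eventually hev] with y hy using hy.symm
  have h4 : mder φ (p (e.symm x)) (mder (p ∘ e.symm) x (timeVec N x)) =
      mder (D ∘ e.symm) x (timeVec N x) := by
    rw [← mder_congr h3]
    exact (mder_comp (f := p ∘ e.symm) (hφ.mdifferentiableAt hxU)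
      (hpiso.mdifferentiableAt (mem_univ x)) _).symm
  change form M (p (e.symm x)) (mder (p ∘ e.symm) x (timeVec N x)) (timeVec M (p (e.symm x))) < 0
  have h5 := form_time M (p (e.symm x))
  have h6 : form M (p (e.symm x)) (mder (p ∘ e.symm) x (timeVec N x))
      (mder (p ∘ e.symm) x (timeVec N x)) < 0 :=
    (hpiso.2 x (mem_univ x) _ _).trans_lt (form_time N x)
  rw [← adsForm_mder hφ hxU] at h5 h6 ⊢
  refine adsForm_neg_of_mem_futureCone ⟨h6, ?_⟩ ⟨h5, h2⟩
  rw [h4]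
  exact htime x

end

end AdS

end

theorem mainTheorem8 (M : AdSSpacetime.{u}) (hM : M.IsGloballyHyperbolic)
    (S : Set M) (hS : M.IsCauchySurface S) (hcomplete : M.IsCompleteSurface S) :
    (∃ (M' : AdSSpacetime.{u}) (p : M' → M) (D : M' → AdS.universalAdS)
        (ρ : AdSSpacetime.deckGroup p →* (AdS.universalAdS ≃ₜ AdS.universalAdS)),
        AdSSpacetime.IsUniversalCovering p ∧ AdS.IsDevelopingPair p D ρ) ∧
    ∀ (M' : AdSSpacetime.{v}) (p : M' → M) (D : M' → AdS.universalAdS)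
      (ρ : AdSSpacetime.deckGroup p →* (AdS.universalAdS ≃ₜ AdS.universalAdS)),
      AdSSpacetime.IsUniversalCovering p → AdS.IsDevelopingPair p D ρ →
      M'.IsCauchySurface (p ⁻¹' S) ∧
      ∀ S' : Set M', M'.IsCauchySurface S' →
        AdS.ActsFreelyProperlyOn ρ.range
          (AdS.invisibleDomain (AdS.boundaryAtInfinity (D '' S'))) ∧
        ∃ (N : AdSSpacetime.{0}) (π : AdS.universalAdS → N),
          AdS.IsQuotientSpacetime ρ.range
            (AdS.invisibleDomain (AdS.boundaryAtInfinity (D '' S'))) N π ∧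
          ∃ F : M → N, AdSSpacetime.IsIsometricEmbedding F := by
  refine ⟨AdS.exists_universalCovering M hS hcomplete, fun M' p D ρ hp hD =>
    ⟨AdS.IsCauchySurface.preimage hp hS, fun S' hS' => ?_⟩⟩
  exact AdS.quotient_of_universalCovering hp hD hS hcomplete hS'
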